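/- Conventions. $A,B,E,Y$ are finite-dimensional systems, and $Y_1$ is a copy of $Y$; $\{|y\rangle\}$ is the standard basis of $Y$ and of $Y_1$; $\log$ is to base 2. Real powers and logarithms of positive semidefinite matrices are taken on the support (so $M^0$ is the support projection and negative powers are generalized inverses); $\|X\|_b=(\mathrm{tr}\,|X|^b)^{1/b}$, and $\|X\|_\infty$ is the operator norm. $\rho\ll\sigma$ means that the support of $\rho$ lies in that of $\sigma$. For $\rho\ll\sigma$ and $a\neq1$ let $$D_a(\rho\|\sigma)=\tfrac1{a-1}\log\mathrm{tr}(\rho^a\sigma^{1-a}),\qquad \tilde D_a(\rho\|\sigma)=\tfrac1{a-1}\log\mathrm{tr}\big[(\sigma^{\frac{1-a}{2a}}\rho\,\sigma^{\frac{1-a}{2a}})^a\big],$$ let $D_1=\tilde D_1=\mathrm{tr}[\rho(\log\rho-\log\sigma)]$, and put all divergences equal to $+\infty$ if $\rho\not\ll\sigma$. For a positive semidefinite $\rho_{XS}$, $H_a^\downarrow(X|S)=-D_a(\rho_{XS}\|\mathbb I\otimes\rho_S)$ and $H_a^\uparrow(X|S)=\sup_{\sigma_S}-D_a(\rho_{XS}\|\mathbb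 I\otimes\sigma_S)$ over all density matrices $\sigma_S$; $\tilde H_a^\downarrow,\tilde H_a^\uparrow$ are defined in the same way from $\tilde D_a$. For a density matrix $\rho_{XS}$, $$\tilde H_{\min}^{\uparrow\epsilon}(X|S)=\sup_{\tau,\sigma}-\log\big\|\sigma_S^{-1/2}\tau_{XS}\,\sigma_S^{-1/2}\big\|_\infty$$ over density matrices $\tau_{XS},\sigma_S$ with $\tau\ll\mathbb I\otimes\sigma$ and $\sqrt{1-F(\rho,\tau)^2}\le\epsilon$, where $F(\rho,\tau)=\mathrm{tr}\sqrt{\sqrt\rho\,\tau\sqrt\rho}$. Let $g(\epsilon)=-\log(1-\sqrt{1-\epsilon^2})$. Setting. Let $\rho_{ABE}=|\psi\rangle\langle\psi|$ be a pure state with marginal $\rho_{AB}$. Let $\Lambda_y\ge0$ be operators on $B$ with $\sum_y\Lambda_y\le\mathbb I$ (strict inequality means post-selection). Let $\mathcal G(M)=KMK^\dagger$ with $K=\sum_y|y\rangle_{Y_1}\otimes\sqrt{\Lambda_y}$ (acting trivially on $A$ and $E$), $\mathcal G^\dagger(M)=K^\dagger MK$, $V=\sum_y|y\rangle_Y\otimes|y\rangle\langle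 y|_{Y_1}$, and let $\mathcal Z(M)=\sum_y|y\rangle\langle y|_{Y_1}M|y\rangle\langle y|_{Y_1}$ be the pinching. Let $\rho_{ABYY_1E}=V\mathcal G(\rho_{ABE})V^\dagger$, and assume it is nonzero. All entropies below refer to its marginals. Write $G=\mathcal G(\rho_{AB})$ and $\tau_y=\sqrt{\Lambda_y}\,\rho_{AB}\sqrt{\Lambda_y}$. Claims. (0) $\rho_{YABY_1}=VGV^\dagger$ and $\rho_{ABY_1}=\mathcal Z(G)$. (1) Duality. $H_a^\downarrow(Y|E)+H_b^\downarrow(Y|ABY_1)=0$ for $a,b\in[0,2]$, $a+b=2$; $\tilde H_a^\uparrow(Y|E)+\tilde H_b^\uparrow(Y|ABY_1)=0$ for $a,b\ge\frac12$, $\frac1a+\frac1b=2$; $\tilde H_a^\downarrow(Y|E)+H_b^\uparrow(Y|ABY_1)=0$ and $H_a^\uparrow(Y|E)+\tilde H_b^\downarrow(Y|ABY_1)=0$ for $a,b>0$, $ab=1$. In the last two lines, when $a=1$, $\rho_{ABYY_1E}$ is also assumed to have trace 1. (2) For $b\ge0$, $b\ne1$: $$H_b^\downarrow(Y|ABY_1)=\tfrac1{1-b}\log\mathrm{tr}\{G^b\mathcal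 Z(G)^{1-b}\}=\tfrac1{1-b}\log\mathrm{tr}\Big\{G^b\sum_y|y\rangle\langle y|\otimes\tau_y^{1-b}\Big\}=\tfrac1{1-b}\log\mathrm{tr}\{\mathcal Z(G^b)\mathcal Z(G)^{1-b}\}=\tfrac1{1-b}\log\sum_y\mathrm{tr}\{\langle y|G^b|y\rangle\,\tau_y^{1-b}\}.$$ If $\sum_y\Lambda_y=\mathbb I$, it is also equal to $$\tfrac1{1-b}\log\mathrm{tr}\{\mathcal G(\rho_{AB}^b)\mathcal Z(G)^{1-b}\}=\tfrac1{1-b}\log\mathrm{tr}\{\rho_{AB}^b\,\mathcal G^\dagger(\mathcal Z(G)^{1-b})\}=\tfrac1{1-b}\log\sum_y\mathrm{tr}\{\sqrt{\Lambda_y}\,\rho_{AB}^b\sqrt{\Lambda_y}\,\tau_y^{1-b}\}.$$ (3) For $b>0$, $b\neq1$, with suprema over density matrices $\sigma_{ABY_1}$ with $\mathcal Z(G)\ll\sigma$: $$\tilde H_b^\uparrow(Y|ABY_1)=\sup_\sigma\tfrac b{1-b}\log\big\|G^{\frac12}\mathcal Z(\sigma^{\frac{1-b}b})G^{\frac12}\big\|_b=\sup_\sigma\tfrac1{1-b}\log\mathrm{tr}\big[\big(\mathcal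 Z(\sigma^{\frac{1-b}b})^{\frac12}\,G\,\mathcal Z(\sigma^{\frac{1-b}b})^{\frac12}\big)^b\big].$$ (4) For $b>0$, $b\ne1$: $$H_b^\uparrow(Y|ABY_1)=\tfrac b{1-b}\log\mathrm{tr}\big[(\mathrm{tr}_Y\rho_{YABY_1}^b)^{\frac1b}\big]=\tfrac b{1-b}\log\mathrm{tr}\big[\mathcal Z(G^b)^{\frac1b}\big]=\tfrac b{1-b}\log\sum_y\mathrm{tr}\big[\langle y|G^b|y\rangle^{\frac1b}\big],$$ and the supremum that defines $H_b^\uparrow$ is attained at the density matrix $\sigma^*=(\mathrm{tr}_Y\rho_{YABY_1}^b)^{1/b}/\mathrm{tr}[(\mathrm{tr}_Y\rho_{YABY_1}^b)^{1/b}]$. (5) For $b>0$, $b\ne1$: $$\tilde H_b^\downarrow(Y|ABY_1)=\tfrac b{1-b}\log\big\|G^{\frac12}\mathcal Z(G)^{\frac{1-b}b}G^{\frac12}\big\|_b=\tfrac1{1-b}\log\mathrm{tr}\big[\big(\mathcal Z(G)^{\frac{1-b}{2b}}\,G\,\mathcal Z(G)^{\frac{1-b}{2b}}\big)^b\big].$$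 (6) If $\rho_{ABYY_1E}$ has trace 1, then for all $n\in\mathbb N$ and $\epsilon\in(0,1]$, with $Y^n,E^n$ in the state $\rho_{YE}^{\otimes n}$: $$\tilde H_{\min}^{\uparrow\epsilon}(Y^n|E^n)\ge H_a^\downarrow(Y^n|E^n)-\tfrac{g(\epsilon)}{a-1}=-n\,H_{2-a}^\downarrow(Y|ABY_1)-\tfrac{g(\epsilon)}{a-1},\quad a\in(1,2];$$ $$\tilde H_{\min}^{\uparrow\epsilon}(Y^n|E^n)\ge\tilde H_a^\uparrow(Y^n|E^n)-\tfrac{g(\epsilon)}{a-1}=-n\,\tilde H_{a/(2a-1)}^\uparrow(Y|ABY_1)-\tfrac{g(\epsilon)}{a-1},\quad a>1;$$ $$\tilde H_{\min}^{\uparrow\epsilon}(Y^n|E^n)\ge\tilde H_a^\downarrow(Y^n|E^n)-\tfrac{g(\epsilon)}{a-1}=-n\,H_{1/a}^\uparrow(Y|ABY_1)-\tfrac{g(\epsilon)}{a-1},\quad a\in(1,2];$$ $$\tilde H_{\min}^{\uparrow\epsilon}(Y^n|E^n)\ge H_a^\uparrow(Y^n|E^n)-\tfrac{g(\epsilon)}{a-1}=-n\,\tilde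 H_{1/a}^\downarrow(Y|ABY_1)-\tfrac{g(\epsilon)}{a-1},\quad a\in(1,2].$$ -/

import Mathlib

open scoped Matrix Kronecker ComplexOrder

namespace KeyDuality

noncomputable section

/-! ### Matrix functions, states, partial traces -/

/-- The real power `M ^ p` of a positive semidefinite matrix, taken on the support of `M`: each
eigenvalue `x > 0` becomes `x ^ p`, and the kernel is kept.  So `M ^ 0` is the projection on the
support, and negative powers are generalized inverses. -/
def mpow {n : Type*} [Fintype n] [DecidableEq n] (M : Matrix n n ℂ) (p : ℝ) : Matrix n n ℂ :=
  cfc (fun x : ℝ => if x = 0 then 0 else x ^ p) M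

/-- The base-2 logarithm of a positive semidefinite matrix, taken on its support. -/
def mlog {n : Type*} [Fintype n] [DecidableEq n] (M : Matrix n n ℂ) : Matrix n n ℂ :=
  cfc (fun x : ℝ => Real.logb 2 x) M

/-- The real number `tr M` (all traces used below are traces of products with real trace). -/
def rtr {n : Type*} [Fintype n] (M : Matrix n n ℂ) : ℝ := M.trace.re

/-- The Schatten (quasi-)norm `‖X‖_b = (tr |X|^b)^(1/b)`, with `|X| = (X† X)^(1/2)`. -/
def schatten {n : Type*} [Fintype n] [DecidableEq n] (b : ℝ) (X : Matrix n n ℂ) : ℝ :=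
  rtr (mpow (Xᴴ * X) (b / 2)) ^ (1 / b)

/-- The operator norm `‖X‖_∞` for the Euclidean norm. -/
def opNorm {n : Type*} [Fintype n] [DecidableEq n] (X : Matrix n n ℂ) : ℝ :=
  ‖Matrix.toEuclideanCLM (n := n) (𝕜 := ℂ) X‖

/-- `ρ` is a density matrix. -/
def IsState {n : Type*} [Fintype n] (ρ : Matrix n n ℂ) : Prop :=
  ρ.PosSemidef ∧ ρ.trace = 1

/-- `ρ ≪ σ`: the support of `ρ` is contained in the support of `σ` (for Hermitian matrices,
equivalently, the kernel of `σ` is contained in the kernel of `ρ`). -/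
def SuppLE {n : Type*} [Fintype n] (ρ σ : Matrix n n ℂ) : Prop :=
  ∀ v : n → ℂ, σ *ᵥ v = 0 → ρ *ᵥ v = 0

/-- Partial trace over the first factor. -/
def trFst {m n : Type*} [Fintype m] (M : Matrix (m × n) (m × n) ℂ) : Matrix n n ℂ :=
  fun i j => ∑ k, M (k, i) (k, j)

/-- Partial trace over the second factor. -/
def trSnd {m n : Type*} [Fintype n] (M : Matrix (m × n) (m × n) ℂ) : Matrix m m ℂ :=
  fun i j => ∑ k, M (i, k) (j, k)

/-- Partial trace over the middle factor of `(Y × C) × E`. -/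
def trMid {Y C E : Type*} [Fintype C] (M : Matrix ((Y × C) × E) ((Y × C) × E) ℂ) :
    Matrix (Y × E) (Y × E) ℂ :=
  fun i j => ∑ c, M ((i.1, c), i.2) ((j.1, c), j.2)

/-- The `k`-fold tensor power of a bipartite matrix, regarded as a matrix on the bipartite system
`X^k`, `S^k`. -/
def iidPow {X S : Type*} (k : ℕ) (ρ : Matrix (X × S) (X × S) ℂ) :
    Matrix ((Fin k → X) × (Fin k → S)) ((Fin k → X) × (Fin k → S)) ℂ :=
  fun i j => ∏ t, ρ (i.1 t, i.2 t) (j.1 t, j.2 t)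

/-! ### Rényi divergences and conditional entropies

The divergences are given by their trace formulas when `ρ ≪ σ`, and are `+∞` otherwise.  At the
order `a = 1` both are the relative entropy `tr [ρ (log ρ - log σ)]`. -/

open Classical in
/-- The Petz–Rényi divergence `D_a(ρ‖σ)`. -/
def petzDiv {n : Type*} [Fintype n] [DecidableEq n] (a : ℝ) (ρ σ : Matrix n n ℂ) : EReal :=
  if SuppLE ρ σ then
    if a = 1 then ((rtr (ρ * (mlog ρ - mlog σ)) : ℝ) : EReal)
    else ((1 / (a - 1) * Real.logb 2 (rtr (mpow ρ a * mpow σ (1 - a))) : ℝ) : EReal)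
  else ⊤

open Classical in
/-- The sandwiched Rényi divergence `D̃_a(ρ‖σ)`. -/
def sandDiv {n : Type*} [Fintype n] [DecidableEq n] (a : ℝ) (ρ σ : Matrix n n ℂ) : EReal :=
  if SuppLE ρ σ then
    if a = 1 then ((rtr (ρ * (mlog ρ - mlog σ)) : ℝ) : EReal)
    else ((1 / (a - 1) * Real.logb 2
      (rtr (mpow (mpow σ ((1 - a) / (2 * a)) * ρ * mpow σ ((1 - a) / (2 * a))) a)) : ℝ) : EReal)
  else ⊤

section Entropies

variable {X S : Type*} [Fintype X] [DecidableEq X] [Fintype S] [DecidableEq S]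

/-- `H_a^↓(X|S)`. -/
def petzDown (a : ℝ) (ρ : Matrix (X × S) (X × S) ℂ) : EReal :=
  -petzDiv a ρ ((1 : Matrix X X ℂ) ⊗ₖ trFst ρ)

/-- `H̃_a^↓(X|S)`. -/
def sandDown (a : ℝ) (ρ : Matrix (X × S) (X × S) ℂ) : EReal :=
  -sandDiv a ρ ((1 : Matrix X X ℂ) ⊗ₖ trFst ρ)

/-- `H_a^↑(X|S)`, the supremum over all density matrices of `S`. -/
def petzUp (a : ℝ) (ρ : Matrix (X × S) (X × S) ℂ) : EReal :=
  ⨆ (σ : Matrix S S ℂ) (_ : IsState σ), -petzDiv a ρ ((1 : Matrix X X ℂ) ⊗ₖ σ)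

/-- `H̃_a^↑(X|S)`, the supremum over all density matrices of `S`. -/
def sandUp (a : ℝ) (ρ : Matrix (X × S) (X × S) ℂ) : EReal :=
  ⨆ (σ : Matrix S S ℂ) (_ : IsState σ), -sandDiv a ρ ((1 : Matrix X X ℂ) ⊗ₖ σ)

/-- The fidelity `F(ρ,τ) = tr √(√ρ τ √ρ)`. -/
def fidelity {n : Type*} [Fintype n] [DecidableEq n] (ρ τ : Matrix n n ℂ) : ℝ :=
  rtr (mpow (mpow ρ (1 / 2) * τ * mpow ρ (1 / 2)) (1 / 2))

/-- The smooth conditional min-entropy: the supremum of `-log ‖σ^(-1/2) τ σ^(-1/2)‖_∞` over all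
density matrices `τ` of `XS` in the `ε`-ball (purified distance) around `ρ` and all density
matrices `σ` of `S` with `τ ≪ 𝕀 ⊗ σ`. -/
def hMinSmooth (ε : ℝ) (ρ : Matrix (X × S) (X × S) ℂ) : EReal :=
  ⨆ (τ : Matrix (X × S) (X × S) ℂ) (σ : Matrix S S ℂ)
    (_ : IsState τ ∧ √(1 - fidelity ρ τ ^ 2) ≤ ε ∧ IsState σ ∧
      SuppLE τ ((1 : Matrix X X ℂ) ⊗ₖ σ)),
    ((-Real.logb 2 (opNorm (((1 : Matrix X X ℂ) ⊗ₖ mpow σ (-1 / 2)) * τ *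
      ((1 : Matrix X X ℂ) ⊗ₖ mpow σ (-1 / 2)))) : ℝ) : EReal)

end Entropies

/-- `g(ε) = -log (1 - √(1 - ε²))`. -/
def gFun (ε : ℝ) : ℝ := -Real.logb 2 (1 - √(1 - ε ^ 2))

/-! ### Key map, copying isometry, pinching -/

section Protocol

variable {A B E Y : Type*} [Fintype A] [DecidableEq A] [Fintype B] [DecidableEq B]
  [Fintype E] [DecidableEq E] [Fintype Y] [DecidableEq Y]

/-- `√Λ_y` acting on `AB` (trivially on `A`). -/
def sqrtL (A : Type*) [DecidableEq A] (Λ : Y → Matrix B B ℂ) (y : Y) : Matrix (A × B) (A × B) ℂ :=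
  (1 : Matrix A A ℂ) ⊗ₖ mpow (Λ y) (1 / 2)

/-- The operator `∑_y |y⟩_{Y₁} ⊗ √Λ_y` from `AB` to `ABY₁`. -/
def keyOp (A : Type*) [DecidableEq A] (Λ : Y → Matrix B B ℂ) :
    Matrix ((A × B) × Y) (A × B) ℂ :=
  fun i j => sqrtL A Λ i.2 i.1 j

/-- The key map `𝒢` on operators of `AB`. -/
def keyMap (Λ : Y → Matrix B B ℂ) (M : Matrix (A × B) (A × B) ℂ) :
    Matrix ((A × B) × Y) ((A × B) × Y) ℂ :=
  keyOp A Λ * M * (keyOp A Λ)ᴴ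

/-- The dual `𝒢†` of the key map. -/
def keyMapDual (Λ : Y → Matrix B B ℂ) (M : Matrix ((A × B) × Y) ((A × B) × Y) ℂ) :
    Matrix (A × B) (A × B) ℂ :=
  (keyOp A Λ)ᴴ * M * keyOp A Λ

/-- The key map on operators of `ABE`, trivial on `E`. -/
def keyMapE (Λ : Y → Matrix B B ℂ) (M : Matrix ((A × B) × E) ((A × B) × E) ℂ) :
    Matrix (((A × B) × Y) × E) (((A × B) × Y) × E) ℂ :=
  (keyOp A Λ ⊗ₖ (1 : Matrix E E ℂ)) * M * (keyOp A Λ ⊗ₖ (1 : Matrix E E ℂ))ᴴ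

/-- The copying isometry `V = ∑_y |y⟩_Y ⊗ |y⟩⟨y|_{Y₁}`, from `CY₁` to `YCY₁`, trivial on `C`. -/
def copyV (Y C : Type*) [DecidableEq Y] [DecidableEq C] : Matrix (Y × (C × Y)) (C × Y) ℂ :=
  fun i j => if i.1 = j.2 ∧ i.2 = j then 1 else 0

/-- The pinching `𝒵(M) = ∑_y (𝕀 ⊗ |y⟩⟨y|) M (𝕀 ⊗ |y⟩⟨y|)` in the basis of the last register. -/
def pinch {C : Type*} [Fintype C] [DecidableEq C] (M : Matrix (C × Y) (C × Y) ℂ) :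
    Matrix (C × Y) (C × Y) ℂ :=
  ∑ y : Y, ((1 : Matrix C C ℂ) ⊗ₖ Matrix.single y y (1 : ℂ)) * M *
    ((1 : Matrix C C ℂ) ⊗ₖ Matrix.single y y (1 : ℂ))

/-- The block `⟨y|M|y⟩`, with `y` in the last register. -/
def block {C : Type*} (M : Matrix (C × Y) (C × Y) ℂ) (y : Y) : Matrix C C ℂ :=
  M.submatrix (fun c => (c, y)) (fun c => (c, y))

/-- `ρ_ABE = |ψ⟩⟨ψ|`. -/
def rhoABE (ψ : (A × B) × E → ℂ) : Matrix ((A × B) × E) ((A × B) × E) ℂ :=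
  Matrix.vecMulVec ψ (star ψ)

/-- `ρ_AB = tr_E ρ_ABE`. -/
def rhoAB (ψ : (A × B) × E → ℂ) : Matrix (A × B) (A × B) ℂ := trSnd (rhoABE ψ)

/-- `ρ_{ABYY₁E} = V 𝒢(ρ_ABE) V†`, with the systems in the order `Y`, `ABY₁`, `E`. -/
def rhoFull (Λ : Y → Matrix B B ℂ) (ψ : (A × B) × E → ℂ) :
    Matrix ((Y × ((A × B) × Y)) × E) ((Y × ((A × B) × Y)) × E) ℂ :=
  (copyV Y (A × B) ⊗ₖ (1 : Matrix E E ℂ)) * keyMapE Λ (rhoABE ψ) * (copyV Y (A × B) ⊗ₖ (1 : Matrix E E ℂ))ᴴ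

/-- `ρ_{YE}`, the marginal of `ρ_{ABYY₁E}`. -/
def rhoYE (Λ : Y → Matrix B B ℂ) (ψ : (A × B) × E → ℂ) : Matrix (Y × E) (Y × E) ℂ :=
  trMid (rhoFull Λ ψ)

/-- `ρ_{YABY₁}`, the marginal of `ρ_{ABYY₁E}`. -/
def rhoYABY (Λ : Y → Matrix B B ℂ) (ψ : (A × B) × E → ℂ) :
    Matrix (Y × ((A × B) × Y)) (Y × ((A × B) × Y)) ℂ :=
  trSnd (rhoFull Λ ψ)

end Protocol

end

end KeyDuality

open KeyDuality

/-! Let $\phi$ be the vector of the pure state $V\mathcal G(\rho_{ABE})V^\dagger$ with parties $Y$,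
$C=ABY_1$ and $E$, and read it as a matrix $\Phi$ from $E$ to $YC$. Then
$\rho_{YC}=\Phi\Phi^\dagger$, while $\Phi^\dagger\Phi$ is the transpose of $\rho_E$. Duality comes
from moving functions across $\Phi$: $f(\Phi\Phi^\dagger)\Phi=\Phi f(\Phi^\dagger\Phi)$, and
$XX^\dagger$, $X^\dagger X$ have the same nonzero spectrum (`cfc_intertwine`,
`mpow_mul_conjTranspose`, `rtr_mpow_mul_conjTranspose`).

For the Petz entropies of type $\downarrow$ both traces become
$\langle\phi|\rho_C^{a-1}\otimes\rho_E^{1-a}|\phi\rangle$. For the mixed pairs, the sandwiched trace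
at the marginal becomes $\mathrm{tr}\,(\mathrm{tr}_Y\rho_{YC}^{1/a})^{a}$, which is Sibson's closed
form of the optimised Petz entropy (`petzUp_closed_form`, from Hölder's inequality and its reverse).
For the sandwiched entropies of type $\uparrow$, put $c=(a-1)/a$ with $a>1$ and consider
$\langle\phi|\tau_C^{c}\otimes\sigma_E^{-c}|\phi\rangle$. Its supremum over $\tau$ is a Schatten
norm of order $a$, its infimum over $\sigma$ a quasi-norm of order $b$, and duality says that
supremum and infimum may be exchanged. The form is bilinear in $\tau^c$ and $\sigma^{-c}$, which
fill convex sets once subnormalised states are admitted (`dualBall`, `dualCoball`), so Sion's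
minimax theorem applies.

The explicit formulas hold because $V$ is an isometry with $\mathrm{tr}_Y(VMV^\dagger)=\mathcal
Z(M)=V^\dagger(\mathbb I\otimes M)V$, and powers of a pinched operator are taken block by block.

For the min-entropy, take $L=c\,\mathbb I\otimes\sigma$ with a new constant $c$, and let $D$ be the
positive part of $\rho-L$. Some state below $L$ has fidelity at least $1-\mathrm{tr}\,D$ with $\rho$
(`exists_state_le_of_le_add`). To make $\mathrm{tr}\,D$ small it suffices to bound the weight $p$ of
a projection under $\rho$ by its weight $q$ under $\mathbb I\otimes\sigma$, as $p^a\le Q\,q^{a-1}$,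
where $Q$ is the trace inside the divergence. Hölder and Peierls give this for the sandwiched
divergence, and Cauchy–Schwarz in addition for Petz with $a\le2$. The values for $n$ copies follow
from multiplicativity. For the optimised sandwiched entropy only superadditivity is direct;
superadditivity at the dual order supplies the converse. -/

set_option linter.unusedSectionVars false

namespace KeyDuality

/-! ### Functional calculus of Hermitian matrices and powers on the support -/

section FunctionalCalculus

variable {m n k : Type*} [Fintype m] [DecidableEq m] [Fintype n] [DecidableEq n]
  [Fintype k] [DecidableEq k]

/-- The unitary and the eigenvalues do not depend on `f`, so identities of the functional calculus
become identities between diagonal matrices. -/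
theorem exists_diagonalization {M : Matrix n n ℂ} (hM : M.IsHermitian) :
    ∃ (U : Matrix n n ℂ) (d : n → ℝ), Uᴴ * U = 1 ∧ U * Uᴴ = 1 ∧
      (∀ f : ℝ → ℝ, cfc f M = U * Matrix.diagonal (fun i => ((f (d i) : ℝ) : ℂ)) * Uᴴ) ∧
      M = U * Matrix.diagonal (fun i => (d i : ℂ)) * Uᴴ ∧ (M.PosSemidef → ∀ i, 0 ≤ d i) ∧
      (M.PosDef → ∀ i, 0 < d i) := by
  refine ⟨hM.eigenvectorUnitary, hM.eigenvalues, ?_, ?_, fun f => ?_, ?_,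
    fun h i => h.eigenvalues_nonneg i, fun h i => h.eigenvalues_pos i⟩
  · exact Unitary.coe_star_mul_self hM.eigenvectorUnitary
  · exact Unitary.coe_mul_star_self hM.eigenvectorUnitary
  · rw [hM.cfc_eq]; rfl
  · exact hM.spectral_theorem

/-- In eigenbases of `M` and `N` the hypothesis says that an entry of `X` can be nonzero only where
the two eigenvalues coincide, and there `f` takes one value; no continuity is needed. The transport
rules below (isometries, Kronecker products, transposes, reindexing, `X * Xᴴ` against `Xᴴ * X`) come
from suitable choices of `X`. -/
theorem cfc_intertwine {M : Matrix m m ℂ} {N : Matrix n n ℂ} (hM : M.IsHermitian)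
    (hN : N.IsHermitian) {X : Matrix m n ℂ} (h : M * X = X * N) (f : ℝ → ℝ) :
    cfc f M * X = X * cfc f N := by
  obtain ⟨U, d, hU, hU', hf, hd, -⟩ := exists_diagonalization hM
  obtain ⟨V, e, hV, hV', hg, he, -⟩ := exists_diagonalization hN
  have key : Matrix.diagonal (fun i => (d i : ℂ)) * (Uᴴ * X * V) =
      (Uᴴ * X * V) * Matrix.diagonal (fun i => (e i : ℂ)) := by
    have h1 : Uᴴ * (M * X) * V = Uᴴ * (X * N) * V := by rw [h]
    rw [hd, he] at h1
    calc _ = (Uᴴ * U) * Matrix.diagonal (fun i => (d i : ℂ)) * (Uᴴ * X * V) := by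
            rw [hU, Matrix.one_mul]
      _ = Uᴴ * (U * Matrix.diagonal (fun i => (d i : ℂ)) * Uᴴ * X) * V := by
            simp only [Matrix.mul_assoc]
      _ = _ := h1
      _ = Uᴴ * X * V * Matrix.diagonal (fun i => (e i : ℂ)) * (Vᴴ * V) := by
            simp only [Matrix.mul_assoc]
      _ = _ := by rw [hV, Matrix.mul_one]
  have key2 : Matrix.diagonal (fun i => ((f (d i) : ℝ) : ℂ)) * (Uᴴ * X * V) =
      (Uᴴ * X * V) * Matrix.diagonal (fun i => ((f (e i) : ℝ) : ℂ)) := by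
    ext i j
    have := congrFun (congrFun key i) j
    simp only [Matrix.diagonal_mul, Matrix.mul_diagonal] at this ⊢
    by_cases hx : (Uᴴ * X * V) i j = 0
    · simp [hx]
    · rw [mul_comm] at this
      have := mul_left_cancel₀ hx this
      rw [Complex.ofReal_inj] at this
      rw [this, mul_comm]
  rw [hf, hg]
  calc _ = U * (Matrix.diagonal (fun i => ((f (d i) : ℝ) : ℂ)) * (Uᴴ * X * V)) * Vᴴ := by
        simp only [Matrix.mul_assoc, hV', Matrix.mul_one]
    _ = (U * Uᴴ) * X * (V * Matrix.diagonal (fun i => ((f (e i) : ℝ) : ℂ)) * Vᴴ) := by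
        rw [key2]; simp only [Matrix.mul_assoc]
    _ = _ := by rw [hU', Matrix.one_mul]

theorem isHermitian_diagonal_ofReal (d : n → ℝ) :
    (Matrix.diagonal (fun i => (d i : ℂ))).IsHermitian := by
  rw [Matrix.IsHermitian, Matrix.diagonal_conjTranspose]
  congr 1
  ext i
  simp

theorem cfc_isHermitian (f : ℝ → ℝ) (M : Matrix n n ℂ) : (cfc f M).IsHermitian :=
  cfc_predicate (p := IsSelfAdjoint) f M

/-- A basis vector, as a one-column matrix, intertwines the diagonal matrix with a scalar; this
computes one column at a time. -/
theorem cfc_diagonal (f : ℝ → ℝ) (d : n → ℝ) :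
    cfc f (Matrix.diagonal (fun i => (d i : ℂ))) =
      Matrix.diagonal (fun i => ((f (d i) : ℝ) : ℂ)) := by
  ext i j
  have hN : (algebraMap ℝ (Matrix Unit Unit ℂ) (d j)).IsHermitian := by
    ext; simp [Matrix.algebraMap_matrix_apply]
  have := cfc_intertwine (isHermitian_diagonal_ofReal d) hN
    (X := Matrix.of fun i (_ : Unit) => if i = j then (1 : ℂ) else 0) (by
      ext i u
      simp only [Matrix.mul_apply, Matrix.diagonal_apply, Matrix.algebraMap_matrix_apply,
        Matrix.of_apply, Finset.univ_unique, Finset.sum_singleton]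
      by_cases h : i = j <;> simp [h]) f
  rw [cfc_algebraMap] at this
  have := congrFun (congrFun this i) ()
  simp only [Matrix.mul_apply, Matrix.of_apply, mul_ite, mul_one, mul_zero, Finset.sum_ite_eq',
    Finset.mem_univ, if_true, Matrix.algebraMap_matrix_apply] at this
  rw [this]
  by_cases h : i = j
  · simp [h]
  · simp [h]

/-- On the range of `W` the matrix is intertwined with `N`; on the complement it vanishes, and `f 0
= 0` keeps it so. -/
theorem cfc_conj_isometry {f : ℝ → ℝ} (h0 : f 0 = 0) {W : Matrix m n ℂ} (hW : Wᴴ * W = 1)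
    {N : Matrix n n ℂ} (hN : N.IsHermitian) :
    cfc f (W * N * Wᴴ) = W * cfc f N * Wᴴ := by
  have hM : (W * N * Wᴴ).IsHermitian := by
    rw [Matrix.IsHermitian]
    simp only [Matrix.conjTranspose_mul, Matrix.conjTranspose_conjTranspose, hN.eq,
      Matrix.mul_assoc]
  have h1 : cfc f (W * N * Wᴴ) * W = W * cfc f N :=
    cfc_intertwine hM hN (by rw [Matrix.mul_assoc, hW, Matrix.mul_one]) f
  have hz : cfc f (0 : Matrix m m ℂ) = 0 := by
    have := cfc_diagonal f (fun _ : m => 0)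
    simpa only [h0, Complex.ofReal_zero, Matrix.diagonal_zero] using this
  have h2 : cfc f (W * N * Wᴴ) * (1 - W * Wᴴ) = (1 - W * Wᴴ) * cfc f (0 : Matrix m m ℂ) := by
    refine cfc_intertwine hM Matrix.isHermitian_zero ?_ f
    rw [Matrix.mul_zero, Matrix.mul_sub, Matrix.mul_one, sub_eq_zero]
    calc W * N * Wᴴ = W * N * (Wᴴ * W) * Wᴴ := by rw [hW, Matrix.mul_one]
      _ = _ := by simp only [Matrix.mul_assoc]
  rw [hz, Matrix.mul_zero, Matrix.mul_sub, Matrix.mul_one, sub_eq_zero] at h2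
  rw [h2, ← Matrix.mul_assoc, h1]

/-- The scalar function `x ↦ x ^ p` on the support. -/
noncomputable def spow (p x : ℝ) : ℝ := if x = 0 then 0 else x ^ p

@[simp] theorem spow_zero_right (p : ℝ) : spow p 0 = 0 := by simp [spow]

theorem spow_of_pos (p : ℝ) {x : ℝ} (hx : 0 < x) : spow p x = x ^ p := by simp [spow, hx.ne']

theorem spow_of_ne {p x : ℝ} (hp : p ≠ 0) : spow p x = x ^ p := by
  unfold spow; split_ifs with h
  · rw [h, Real.zero_rpow hp]
  · rfl

theorem spow_nonneg (p : ℝ) {x : ℝ} (hx : 0 ≤ x) : 0 ≤ spow p x := by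
  unfold spow; split_ifs
  · exact le_rfl
  · positivity

theorem spow_pos (p : ℝ) {x : ℝ} (hx : 0 < x) : 0 < spow p x := by
  rw [spow_of_pos p hx]; positivity

theorem spow_mul_spow (p q : ℝ) {x : ℝ} (hx : 0 ≤ x) : spow p x * spow q x = spow (p + q) x := by
  rcases hx.eq_or_lt with rfl | h
  · simp
  · simp only [spow_of_pos _ h, Real.rpow_add h]

theorem spow_spow (p q : ℝ) {x : ℝ} (hx : 0 ≤ x) : spow q (spow p x) = spow (p * q) x := by
  rcases hx.eq_or_lt with rfl | h
  · simp
  · rw [spow_of_pos p h, spow_of_pos _ (by positivity), spow_of_pos _ h, Real.rpow_mul h.le]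

theorem mul_spow (p : ℝ) {x y : ℝ} (hx : 0 ≤ x) (hy : 0 ≤ y) :
    spow p (x * y) = spow p x * spow p y := by
  rcases hx.eq_or_lt with rfl | hx'
  · simp
  rcases hy.eq_or_lt with rfl | hy'
  · simp
  rw [spow_of_pos p hx', spow_of_pos p hy', spow_of_pos p (mul_pos hx' hy'),
    Real.mul_rpow hx hy]

theorem spow_one {x : ℝ} : spow 1 x = x := by
  rw [spow_of_ne one_ne_zero, Real.rpow_one]

theorem mpow_eq (M : Matrix n n ℂ) (p : ℝ) : mpow M p = cfc (spow p) M := rfl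

theorem mpow_isHermitian (M : Matrix n n ℂ) (p : ℝ) : (mpow M p).IsHermitian :=
  cfc_isHermitian _ _

theorem posSemidef_conj_diagonal (U : Matrix m n ℂ) {d : n → ℝ} (hd : ∀ i, 0 ≤ d i) :
    (U * Matrix.diagonal (fun i => (d i : ℂ)) * Uᴴ).PosSemidef := by
  apply Matrix.PosSemidef.mul_mul_conjTranspose_same
  apply Matrix.PosSemidef.diagonal
  intro i
  simpa using hd i

theorem cfc_posSemidef {M : Matrix n n ℂ} (hM : M.PosSemidef) {f : ℝ → ℝ}
    (hf : ∀ x, 0 ≤ x → 0 ≤ f x) : (cfc f M).PosSemidef := by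
  obtain ⟨U, d, hU, hU', hf', hd, h0, -⟩ := exists_diagonalization hM.isHermitian
  rw [hf']
  exact posSemidef_conj_diagonal U fun i => hf _ (h0 hM i)

theorem mpow_posSemidef {M : Matrix n n ℂ} (hM : M.PosSemidef) (p : ℝ) :
    (mpow M p).PosSemidef := cfc_posSemidef hM fun _ h => spow_nonneg p h

theorem posDef_of_unitary_diagonal {U : Matrix n n ℂ} (hU : U * Uᴴ = 1) {d : n → ℝ}
    (hd : ∀ i, 0 < d i) : (U * Matrix.diagonal (fun i => (d i : ℂ)) * Uᴴ).PosDef := by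
  refine Matrix.PosDef.mul_mul_conjTranspose_same (Matrix.PosDef.diagonal fun i => by
    simpa using hd i) ?_
  intro x y h
  have := congrArg (fun z => z ᵥ* Uᴴ) h
  simpa [Matrix.vecMul_vecMul, hU] using this

theorem mpow_posDef {M : Matrix n n ℂ} (hM : M.PosDef) (p : ℝ) : (mpow M p).PosDef := by
  obtain ⟨U, d, hU, hU', hf', hd, -, h0⟩ := exists_diagonalization hM.isHermitian
  rw [mpow_eq, hf']
  exact posDef_of_unitary_diagonal hU' fun i => spow_pos _ (h0 hM i)

theorem cfc_mul_cfc {M : Matrix n n ℂ} (hM : M.IsHermitian) (f g : ℝ → ℝ) :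
    cfc f M * cfc g M = cfc (fun x => f x * g x) M := by
  obtain ⟨U, d, hU, hU', hf, hd, -⟩ := exists_diagonalization hM
  simp only [hf]
  calc _ = U * (Matrix.diagonal (fun i => ((f (d i) : ℝ) : ℂ)) * (Uᴴ * U) *
        Matrix.diagonal (fun i => ((g (d i) : ℝ) : ℂ))) * Uᴴ := by simp only [Matrix.mul_assoc]
    _ = _ := by rw [hU, Matrix.mul_one, Matrix.diagonal_mul_diagonal]; simp

theorem cfc_congr_nonneg {M : Matrix n n ℂ} (hM : M.PosSemidef) {f g : ℝ → ℝ}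
    (h : ∀ x, 0 ≤ x → f x = g x) : cfc f M = cfc g M := by
  obtain ⟨U, d, hU, hU', hf', hd, h0, -⟩ := exists_diagonalization hM.isHermitian
  rw [hf', hf']
  simp only [h _ (h0 hM _)]

theorem cfc_id_eq {M : Matrix n n ℂ} (hM : M.IsHermitian) : cfc (fun x : ℝ => x) M = M := by
  obtain ⟨U, d, hU, hU', hf', hd, -⟩ := exists_diagonalization hM
  rw [hf']; exact hd.symm

theorem cfc_cfc {M : Matrix n n ℂ} (hM : M.IsHermitian) (f g : ℝ → ℝ) :
    cfc g (cfc f M) = cfc (fun x => g (f x)) M := by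
  obtain ⟨U, d, hU, hU', hf', hd, -⟩ := exists_diagonalization hM
  have h1 := cfc_intertwine (cfc_isHermitian f M) (isHermitian_diagonal_ofReal fun i => f (d i))
    (X := U) (by rw [hf', Matrix.mul_assoc, hU, Matrix.mul_one]) g
  rw [cfc_diagonal] at h1
  rw [hf' (fun x => g (f x)), ← h1, Matrix.mul_assoc, hU', Matrix.mul_one]

theorem mpow_mul_mpow {M : Matrix n n ℂ} (hM : M.PosSemidef) (p q : ℝ) :
    mpow M p * mpow M q = mpow M (p + q) := by
  rw [mpow_eq, mpow_eq, cfc_mul_cfc hM.isHermitian]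
  exact cfc_congr_nonneg hM fun x hx => spow_mul_spow p q hx

theorem mpow_mpow {M : Matrix n n ℂ} (hM : M.PosSemidef) (p q : ℝ) :
    mpow (mpow M p) q = mpow M (p * q) := by
  rw [mpow_eq, mpow_eq, cfc_cfc hM.isHermitian]
  exact cfc_congr_nonneg hM fun x hx => spow_spow p q hx

theorem mpow_one {M : Matrix n n ℂ} (hM : M.PosSemidef) : mpow M 1 = M := by
  conv_rhs => rw [← cfc_id_eq hM.isHermitian]
  exact cfc_congr_nonneg hM fun x _ => spow_one

theorem mpow_mul_self {M : Matrix n n ℂ} (hM : M.PosSemidef) (p : ℝ) :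
    mpow M p * M = mpow M (p + 1) := by
  rw [← mpow_mul_mpow hM, mpow_one hM]

theorem self_mul_mpow {M : Matrix n n ℂ} (hM : M.PosSemidef) (p : ℝ) :
    M * mpow M p = mpow M (p + 1) := by
  rw [add_comm, ← mpow_mul_mpow hM, mpow_one hM]

theorem mpow_zero_mul {M : Matrix n n ℂ} (hM : M.PosSemidef) : mpow M 0 * M = M := by
  nth_rw 2 [← mpow_one hM]
  rw [mpow_mul_mpow hM, zero_add, mpow_one hM]

theorem mul_mpow_zero {M : Matrix n n ℂ} (hM : M.PosSemidef) : M * mpow M 0 = M := by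
  nth_rw 1 [← mpow_one hM]
  rw [mpow_mul_mpow hM, add_zero, mpow_one hM]

theorem mpow_half_mul_self {M : Matrix n n ℂ} (hM : M.PosSemidef) :
    mpow M (1 / 2) * mpow M (1 / 2) = M := by
  rw [mpow_mul_mpow hM, add_halves, mpow_one hM]

theorem mpow_zero_posDef {M : Matrix n n ℂ} (hM : M.PosDef) : mpow M 0 = 1 := by
  obtain ⟨U, d, hU, hU', hf', hd, -, h0⟩ := exists_diagonalization hM.isHermitian
  rw [mpow_eq, hf']
  simp only [spow_of_pos _ (h0 hM _), Real.rpow_zero, Complex.ofReal_one, Matrix.diagonal_one,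
    Matrix.mul_one, hU']

theorem mpow_conj_isometry {W : Matrix m n ℂ} (hW : Wᴴ * W = 1)
    {N : Matrix n n ℂ} (hN : N.IsHermitian) (p : ℝ) :
    mpow (W * N * Wᴴ) p = W * mpow N p * Wᴴ := cfc_conj_isometry (by simp) hW hN

theorem mpow_diagonal (p : ℝ) (d : n → ℝ) :
    mpow (Matrix.diagonal (fun i => (d i : ℂ))) p =
      Matrix.diagonal (fun i => ((spow p (d i) : ℝ) : ℂ)) := cfc_diagonal _ d

theorem cfc_kron_one (f : ℝ → ℝ) {M : Matrix n n ℂ} (hM : M.IsHermitian) :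
    cfc f ((1 : Matrix m m ℂ) ⊗ₖ M) = (1 : Matrix m m ℂ) ⊗ₖ cfc f M := by
  obtain ⟨U, d, hU, hU', hf', hd, -, h0⟩ := exists_diagonalization hM
  have hH : ((1 : Matrix m m ℂ) ⊗ₖ M).IsHermitian := by
    rw [Matrix.IsHermitian, Matrix.conjTranspose_kronecker, hM.eq, Matrix.conjTranspose_one]
  have h1 := cfc_intertwine hH (isHermitian_diagonal_ofReal fun i : m × n => d i.2)
    (X := (1 : Matrix m m ℂ) ⊗ₖ U) (by
      have : Matrix.diagonal (fun i : m × n => (d i.2 : ℂ)) =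
          (1 : Matrix m m ℂ) ⊗ₖ Matrix.diagonal (fun i => (d i : ℂ)) := by
        rw [← Matrix.diagonal_one, Matrix.diagonal_kronecker_diagonal]; simp
      rw [this, ← Matrix.mul_kronecker_mul, ← Matrix.mul_kronecker_mul]
      congr 1
      conv_lhs => rw [hd]
      rw [Matrix.mul_assoc, hU, Matrix.mul_one]) f
  have hX : ((1 : Matrix m m ℂ) ⊗ₖ U) * ((1 : Matrix m m ℂ) ⊗ₖ Uᴴ) = 1 := by
    rw [← Matrix.mul_kronecker_mul, hU', Matrix.mul_one, Matrix.one_kronecker_one]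
  have := congrArg (· * ((1 : Matrix m m ℂ) ⊗ₖ Uᴴ)) h1
  simp only [Matrix.mul_assoc, hX, Matrix.mul_one] at this
  rw [this, cfc_diagonal, hf']
  have : Matrix.diagonal (fun i : m × n => ((f (d i.2) : ℝ) : ℂ)) =
      (1 : Matrix m m ℂ) ⊗ₖ Matrix.diagonal (fun i => ((f (d i) : ℝ) : ℂ)) := by
    rw [← Matrix.diagonal_one, Matrix.diagonal_kronecker_diagonal]; simp
  rw [this, ← Matrix.mul_kronecker_mul, ← Matrix.mul_kronecker_mul]
  simp [Matrix.mul_assoc]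

theorem mpow_one_kron {M : Matrix n n ℂ} (hM : M.IsHermitian) (p : ℝ) :
    mpow ((1 : Matrix m m ℂ) ⊗ₖ M) p = (1 : Matrix m m ℂ) ⊗ₖ mpow M p := cfc_kron_one _ hM

theorem mlog_one_kron {M : Matrix n n ℂ} (hM : M.IsHermitian) :
    mlog ((1 : Matrix m m ℂ) ⊗ₖ M) = (1 : Matrix m m ℂ) ⊗ₖ mlog M := cfc_kron_one _ hM

theorem cfc_transpose (f : ℝ → ℝ) {M : Matrix n n ℂ} (hM : M.IsHermitian) :
    cfc f Mᵀ = (cfc f M)ᵀ := by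
  obtain ⟨U, d, hU, hU', hf', hd, -, h0⟩ := exists_diagonalization hM
  have e1 : Uᴴᵀ * Uᵀ = 1 := by rw [← Matrix.transpose_mul, hU', Matrix.transpose_one]
  have e2 : Uᵀ * Uᴴᵀ = 1 := by rw [← Matrix.transpose_mul, hU, Matrix.transpose_one]
  have h1 := cfc_intertwine hM.transpose (isHermitian_diagonal_ofReal d)
    (X := Uᴴᵀ) (by
      conv_lhs => rw [hd]
      rw [Matrix.transpose_mul, Matrix.transpose_mul, Matrix.diagonal_transpose,
        Matrix.mul_assoc, Matrix.mul_assoc, e2, Matrix.mul_one]) f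
  have := congrArg (· * Uᵀ) h1
  simp only [Matrix.mul_assoc, e1, Matrix.mul_one] at this
  rw [this, hf', cfc_diagonal, Matrix.transpose_mul, Matrix.transpose_mul,
    Matrix.diagonal_transpose]

theorem mpow_transpose {M : Matrix n n ℂ} (hM : M.IsHermitian) (p : ℝ) :
    mpow Mᵀ p = (mpow M p)ᵀ := cfc_transpose _ hM

theorem cfc_submatrix_equiv (f : ℝ → ℝ) {M : Matrix n n ℂ} (hM : M.IsHermitian) (e : m ≃ n) :
    cfc f (M.submatrix e e) = (cfc f M).submatrix e e := by
  have h1 := cfc_intertwine (hM.submatrix e) hM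
    (X := (1 : Matrix n n ℂ).submatrix e id) (by
      ext i j; simp [Matrix.mul_apply, Matrix.one_apply]
      rw [Finset.sum_eq_single (e.symm j)] <;> simp
      intro b hb hb'
      rw [← hb'] at hb; simp at hb) f
  ext i j
  have := congrFun (congrFun h1 i) (e j)
  simp only [Matrix.mul_apply, Matrix.submatrix_apply, Matrix.one_apply, id,
    EmbeddingLike.apply_eq_iff_eq, mul_ite, mul_one, mul_zero, ite_mul, one_mul, zero_mul,
    Finset.sum_ite_eq, Finset.sum_ite_eq', Finset.mem_univ, if_true] at this
  rw [this, Matrix.submatrix_apply]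

theorem mpow_submatrix_equiv {M : Matrix n n ℂ} (hM : M.IsHermitian) (e : m ≃ n) (p : ℝ) :
    mpow (M.submatrix e e) p = (mpow M p).submatrix e e := cfc_submatrix_equiv _ hM e

theorem mpow_smul {M : Matrix n n ℂ} (hM : M.PosSemidef) {c : ℝ} (hc : 0 ≤ c) (p : ℝ) :
    mpow (c • M) p = spow p c • mpow M p := by
  obtain ⟨U, d, hU, hU', hf', hd, h0, -⟩ := exists_diagonalization hM.isHermitian
  have hs : ∀ (c : ℝ) (d : n → ℝ), c • (U * Matrix.diagonal (fun i => (d i : ℂ)) * Uᴴ) =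
      U * Matrix.diagonal (fun i => ((c * d i : ℝ) : ℂ)) * Uᴴ := by
    intro c d
    rw [← Matrix.smul_mul, ← Matrix.mul_smul, ← Matrix.diagonal_smul]
    congr 3
    ext i; simp
  have h1 : c • M = U * Matrix.diagonal (fun i => ((c * d i : ℝ) : ℂ)) * Uᴴ := by
    conv_lhs => rw [hd]
    exact hs c d
  rw [h1, mpow_conj_isometry hU (isHermitian_diagonal_ofReal _), mpow_diagonal, mpow_eq M, hf', hs]
  simp only [mul_spow p hc (h0 hM _)]

theorem mul_conjTranspose_intertwine (X : Matrix m n ℂ) (f : ℝ → ℝ) :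
    cfc f (X * Xᴴ) * X = X * cfc f (Xᴴ * X) :=
  cfc_intertwine (Matrix.isHermitian_mul_conjTranspose_self X)
    (Matrix.isHermitian_conjTranspose_mul_self X) (by rw [Matrix.mul_assoc]) f

/-- Split one factor $XX^\dagger$ off the power and move the rest across `X`. The support convention
makes this valid for every real exponent. It carries powers of one marginal of a pure state to the
complementary one. -/
theorem mpow_mul_conjTranspose (X : Matrix m n ℂ) (p : ℝ) :
    mpow (X * Xᴴ) p = X * mpow (Xᴴ * X) (p - 1) * Xᴴ := by
  have hP := Matrix.posSemidef_self_mul_conjTranspose X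
  have h := mul_conjTranspose_intertwine X (spow (p - 1))
  rw [mpow_eq (Xᴴ * X), ← h, Matrix.mul_assoc, ← mpow_eq]
  nth_rw 3 [← mpow_one hP]
  rw [mpow_mul_mpow hP, sub_add_cancel]

end FunctionalCalculus

/-! ### Real parts of traces -/

section RealTrace

variable {m n : Type*} [Fintype m] [Fintype n]

theorem rtr_add (A B : Matrix n n ℂ) : rtr (A + B) = rtr A + rtr B := by simp [rtr]

theorem rtr_sub (A B : Matrix n n ℂ) : rtr (A - B) = rtr A - rtr B := by simp [rtr]

theorem rtr_smul (c : ℝ) (A : Matrix n n ℂ) : rtr (c • A) = c * rtr A := by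
  simp [rtr, Matrix.trace_smul]

theorem rtr_mul_comm (A : Matrix m n ℂ) (B : Matrix n m ℂ) : rtr (A * B) = rtr (B * A) := by
  rw [rtr, rtr, Matrix.trace_mul_comm]

theorem rtr_transpose (A : Matrix n n ℂ) : rtr Aᵀ = rtr A := by
  rw [rtr, rtr, Matrix.trace_transpose]

theorem rtr_conjTranspose (A : Matrix n n ℂ) : rtr Aᴴ = rtr A := by
  rw [rtr, rtr, Matrix.trace_conjTranspose]; simp

theorem rtr_zero : rtr (0 : Matrix n n ℂ) = 0 := by simp [rtr]

theorem rtr_submatrix_equiv (A : Matrix n n ℂ) (e : m ≃ n) : rtr (A.submatrix e e) = rtr A := by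
  rw [rtr, rtr, Matrix.trace, Matrix.trace]
  congr 1
  exact Equiv.sum_comp e (fun i => A i i)

theorem rtr_nonneg {A : Matrix n n ℂ} (hA : A.PosSemidef) : 0 ≤ rtr A :=
  (Complex.nonneg_iff.1 hA.trace_nonneg).1

theorem trace_eq_rtr {A : Matrix n n ℂ} (hA : A.PosSemidef) : A.trace = (rtr A : ℂ) := by
  have := (Complex.nonneg_iff.1 hA.trace_nonneg).2
  apply Complex.ext
  · simp [rtr]
  · simpa using this.symm

theorem rtr_eq_zero_iff {A : Matrix n n ℂ} (hA : A.PosSemidef) : rtr A = 0 ↔ A = 0 := by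
  rw [← hA.trace_eq_zero_iff, trace_eq_rtr hA]
  simp

theorem rtr_pos {A : Matrix n n ℂ} (hA : A.PosSemidef) (h : A ≠ 0) : 0 < rtr A :=
  lt_of_le_of_ne (rtr_nonneg hA) fun h' => h ((rtr_eq_zero_iff hA).1 h'.symm)

theorem isState_iff {A : Matrix n n ℂ} : IsState A ↔ A.PosSemidef ∧ rtr A = 1 := by
  constructor
  · rintro ⟨h, h'⟩; exact ⟨h, by rw [rtr, h']; simp⟩
  · rintro ⟨h, h'⟩; exact ⟨h, by rw [trace_eq_rtr h, h']; simp⟩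

variable [DecidableEq m] [DecidableEq n]

theorem rtr_mul_nonneg {A B : Matrix n n ℂ} (hA : A.PosSemidef) (hB : B.PosSemidef) :
    0 ≤ rtr (A * B) := by
  rw [← mpow_half_mul_self hB, ← Matrix.mul_assoc, rtr_mul_comm, ← Matrix.mul_assoc]
  apply rtr_nonneg
  have := hA.mul_mul_conjTranspose_same (mpow B (1 / 2))
  rwa [(mpow_isHermitian B _).eq] at this

theorem rtr_mul_le_mul_left {A B C : Matrix n n ℂ} (hA : A.PosSemidef)
    (h : (C - B).PosSemidef) : rtr (A * B) ≤ rtr (A * C) := by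
  have := rtr_mul_nonneg hA h
  rw [Matrix.mul_sub, rtr_sub] at this
  linarith

theorem rtr_mul_le_mul_right {A B C : Matrix n n ℂ} (hA : A.PosSemidef)
    (h : (C - B).PosSemidef) : rtr (B * A) ≤ rtr (C * A) := by
  rw [rtr_mul_comm B, rtr_mul_comm C]; exact rtr_mul_le_mul_left hA h

/-- Write $f(x)=(f(x)/x)\,x$, move the first factor across `X` and use cyclicity. The condition `f 0
= 0` is needed because the two kernels may differ in dimension. -/
theorem rtr_cfc_mul_conjTranspose (X : Matrix m n ℂ) {f : ℝ → ℝ} (h0 : f 0 = 0) :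
    rtr (cfc f (X * Xᴴ)) = rtr (cfc f (Xᴴ * X)) := by
  have hP := Matrix.isHermitian_mul_conjTranspose_self X
  have hQ := Matrix.isHermitian_conjTranspose_mul_self X
  have hf : f = fun x => (f x / x) * x := by
    ext x
    by_cases hx : x = 0
    · simp [hx, h0]
    · field_simp
  rw [hf, ← cfc_mul_cfc hP (fun x => f x / x) (fun x => x),
    ← cfc_mul_cfc hQ (fun x => f x / x) (fun x => x), cfc_id_eq hP, cfc_id_eq hQ,
    ← Matrix.mul_assoc, mul_conjTranspose_intertwine, Matrix.mul_assoc, rtr_mul_comm,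
    Matrix.mul_assoc]

theorem rtr_mpow_mul_conjTranspose (X : Matrix m n ℂ) (p : ℝ) :
    rtr (mpow (X * Xᴴ) p) = rtr (mpow (Xᴴ * X) p) :=
  rtr_cfc_mul_conjTranspose X (spow_zero_right p)

end RealTrace

/-! ### Trace inequalities through eigenvector overlaps -/

section TraceInequalities

variable {m n : Type*} [Fintype m] [DecidableEq m] [Fintype n] [DecidableEq n]

/-- The trace of a product of functions of two Hermitian matrices as a double sum over the
eigenvalues, weighted by the doubly stochastic matrix of the overlaps of the eigenvectors. -/
theorem exists_overlap {A B : Matrix n n ℂ} (hA : A.IsHermitian) (hB : B.IsHermitian) :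
    ∃ (a b : n → ℝ) (w : n → n → ℝ), (∀ i j, 0 ≤ w i j) ∧ (∀ i, ∑ j, w i j = 1) ∧
      (∀ j, ∑ i, w i j = 1) ∧
      (∀ f g : ℝ → ℝ, rtr (cfc f A * cfc g B) = ∑ i, ∑ j, f (a i) * g (b j) * w i j) ∧
      (A.PosSemidef → ∀ i, 0 ≤ a i) ∧ (B.PosSemidef → ∀ i, 0 ≤ b i) := by
  obtain ⟨U, a, hU, hU', hf, -, ha, -⟩ := exists_diagonalization hA
  obtain ⟨V, b, hV, hV', hg, -, hb, -⟩ := exists_diagonalization hB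
  have hn : ∀ i j, (Uᴴ * V) i j * (Vᴴ * U) j i = ((Complex.normSq ((Uᴴ * V) i j) : ℝ) : ℂ) := by
    intro i j
    have : Vᴴ * U = (Uᴴ * V)ᴴ := by simp
    rw [this, Matrix.conjTranspose_apply, ← Complex.mul_conj]
    rfl
  refine ⟨a, b, fun i j => Complex.normSq ((Uᴴ * V) i j), fun i j => Complex.normSq_nonneg _,
    fun i => ?_, fun j => ?_, fun f g => ?_, ha, hb⟩
  · have h1 : (Uᴴ * V) * (Vᴴ * U) = 1 := by
      rw [Matrix.mul_assoc, ← Matrix.mul_assoc V, hV', Matrix.one_mul, hU]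
    have h2 := congrFun (congrFun h1 i) i
    rw [Matrix.mul_apply, Matrix.one_apply_eq] at h2
    simp only [hn] at h2
    exact_mod_cast h2
  · have h1 : (Vᴴ * U) * (Uᴴ * V) = 1 := by
      rw [Matrix.mul_assoc, ← Matrix.mul_assoc U, hU', Matrix.one_mul, hV]
    have h2 := congrFun (congrFun h1 j) j
    rw [Matrix.mul_apply, Matrix.one_apply_eq] at h2
    simp only [mul_comm ((Vᴴ * U) _ _), hn] at h2
    exact_mod_cast h2
  · rw [hf, hg]
    have : U * Matrix.diagonal (fun i => ((f (a i) : ℝ) : ℂ)) * Uᴴ *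
        (V * Matrix.diagonal (fun i => ((g (b i) : ℝ) : ℂ)) * Vᴴ) =
        U * (Matrix.diagonal (fun i => ((f (a i) : ℝ) : ℂ)) * (Uᴴ * V) *
          (Matrix.diagonal (fun i => ((g (b i) : ℝ) : ℂ)) * Vᴴ)) := by
      simp only [Matrix.mul_assoc]
    rw [this, rtr_mul_comm, Matrix.mul_assoc (_ * (Uᴴ * V)), Matrix.mul_assoc _ Vᴴ U]
    have key : (Matrix.diagonal (fun i => ((f (a i) : ℝ) : ℂ)) * (Uᴴ * V) *
        (Matrix.diagonal (fun i => ((g (b i) : ℝ) : ℂ)) * (Vᴴ * U))).trace =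
        ∑ i, ∑ j, ((f (a i) * g (b j) * Complex.normSq ((Uᴴ * V) i j) : ℝ) : ℂ) := by
      rw [Matrix.trace]
      refine Finset.sum_congr rfl fun i _ => ?_
      rw [Matrix.diag_apply, Matrix.mul_apply]
      refine Finset.sum_congr rfl fun j _ => ?_
      rw [Matrix.diagonal_mul, Matrix.diagonal_mul]
      push_cast
      rw [← hn]
      ring
    rw [rtr, key]
    simp

theorem cfc_one_eq (M : Matrix n n ℂ) (hM : M.IsHermitian) : cfc (fun _ : ℝ => (1 : ℝ)) M = 1 := by
  obtain ⟨U, d, hU, hU', hf', hd, h0, -⟩ := exists_diagonalization hM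
  rw [hf']; simp [hU']

/-- `1 - mpow B 0` is the projection on the kernel of `B`, and `mpow B 0 = mpow B (-1) * B`;
inclusion of supports thus becomes an algebraic identity. -/
theorem suppLE_iff {A : Matrix m m ℂ} {B : Matrix m m ℂ} (hB : B.PosSemidef) :
    SuppLE A B ↔ A * mpow B 0 = A := by
  constructor
  · intro h
    have h2 : A * (1 - mpow B 0) = 0 := by
      apply Matrix.ext_of_mulVec_single
      intro i
      rw [← Matrix.mulVec_mulVec, Matrix.zero_mulVec]
      apply h
      rw [Matrix.mulVec_mulVec, Matrix.mul_sub, Matrix.mul_one, mul_mpow_zero hB, sub_self,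
        Matrix.zero_mulVec]
    rw [Matrix.mul_sub, Matrix.mul_one, sub_eq_zero] at h2
    exact h2.symm
  · intro h v hv
    have : mpow B 0 = mpow B (-1) * B := by rw [mpow_mul_self hB]; simp
    rw [← h, ← Matrix.mulVec_mulVec, this, ← Matrix.mulVec_mulVec, hv, Matrix.mulVec_zero,
      Matrix.mulVec_zero]

theorem SuppLE.mul_mpow_zero {A B : Matrix m m ℂ} (h : SuppLE A B) (hB : B.PosSemidef) :
    A * mpow B 0 = A := (suppLE_iff hB).1 h

theorem SuppLE.mpow_zero_mul {A B : Matrix m m ℂ} (h : SuppLE A B) (hB : B.PosSemidef)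
    (hA : A.IsHermitian) : mpow B 0 * A = A := by
  have := congrArg Matrix.conjTranspose (h.mul_mpow_zero hB)
  rwa [Matrix.conjTranspose_mul, hA.eq, (mpow_isHermitian B 0).eq] at this

theorem SuppLE.trans {A B C : Matrix m m ℂ} (h : SuppLE A B) (h' : SuppLE B C) : SuppLE A C :=
  fun v hv => h v (h' v hv)

theorem suppLE_of_le {A B : Matrix m m ℂ} (hA : A.PosSemidef) (h : (B - A).PosSemidef) :
    SuppLE A B := by
  intro v hv
  rw [← hA.dotProduct_mulVec_zero_iff]
  have h1 := h.dotProduct_mulVec_nonneg v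
  rw [Matrix.sub_mulVec, hv, zero_sub, dotProduct_neg, neg_nonneg] at h1
  exact le_antisymm h1 (hA.dotProduct_mulVec_nonneg v)

theorem suppLE_posDef {A B : Matrix m m ℂ} (hB : B.PosDef) : SuppLE A B := by
  rw [suppLE_iff hB.posSemidef, mpow_zero_posDef hB, Matrix.mul_one]

theorem suppLE_mpow_self {A : Matrix m m ℂ} (hA : A.PosSemidef) (p : ℝ) :
    SuppLE (mpow A p) A := by
  rw [suppLE_iff hA, mpow_mul_mpow hA, add_zero]

theorem suppLE_self_mpow {A : Matrix m m ℂ} (hA : A.PosSemidef) (p : ℝ) :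
    SuppLE A (mpow A p) := by
  rw [suppLE_iff (mpow_posSemidef hA p), mpow_mpow hA, mul_zero, mul_mpow_zero hA]

theorem rtr_mpow_eq_sum {A B : Matrix n n ℂ} {a b : n → ℝ} {w : n → n → ℝ}
    (h : ∀ f g : ℝ → ℝ, rtr (cfc f A * cfc g B) = ∑ i, ∑ j, f (a i) * g (b j) * w i j)
    (hB : B.IsHermitian) (f : ℝ → ℝ) : rtr (cfc f A) = ∑ i, ∑ j, f (a i) * w i j := by
  have := h f fun _ => 1
  simpa [cfc_one_eq B hB] using this

theorem rtr_mpow_eq_sum' {A B : Matrix n n ℂ} {a b : n → ℝ} {w : n → n → ℝ}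
    (h : ∀ f g : ℝ → ℝ, rtr (cfc f A * cfc g B) = ∑ i, ∑ j, f (a i) * g (b j) * w i j)
    (hA : A.IsHermitian) (g : ℝ → ℝ) : rtr (cfc g B) = ∑ i, ∑ j, g (b j) * w i j := by
  have := h (fun _ => 1) g
  simpa [cfc_one_eq A hA] using this

/-- If `A ≪ B`, then eigenvectors of `A` to positive eigenvalues have no overlap with the kernel
of `B`. -/
theorem overlap_eq_zero {A B : Matrix n n ℂ} (hA : A.PosSemidef) (hB : B.PosSemidef)
    (hAB : SuppLE A B) {a b : n → ℝ} {w : n → n → ℝ} (hw : ∀ i j, 0 ≤ w i j)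
    (h : ∀ f g : ℝ → ℝ, rtr (cfc f A * cfc g B) = ∑ i, ∑ j, f (a i) * g (b j) * w i j)
    (ha : ∀ i, 0 ≤ a i) {i j : n} (hj : b j = 0) : a i * w i j = 0 := by
  -- Testing with the identity and the indicator of zero gives the weight of `A` on the kernel of
  -- `B`, which vanishes. All summands are nonnegative, so each of them is zero.
  have h1 := h (fun x => x) (fun x => if x = 0 then 1 else 0)
  have h2 : cfc (fun x : ℝ => if x = 0 then (1 : ℝ) else 0) B = 1 - mpow B 0 := by
    have : cfc (fun x : ℝ => if x = 0 then (1 : ℝ) else 0) B + mpow B 0 = 1 := by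
      obtain ⟨U, d, hU, hU', hf', hd, h0, -⟩ := exists_diagonalization hB.isHermitian
      rw [mpow_eq, hf', hf', ← Matrix.add_mul, ← Matrix.mul_add, Matrix.diagonal_add]
      have : ∀ x : ℝ, (if x = 0 then (1 : ℝ) else 0) + spow 0 x = 1 := by
        intro x; unfold spow; split_ifs <;> simp
      simp only [← Complex.ofReal_add, this, Complex.ofReal_one, Matrix.diagonal_one,
        Matrix.mul_one, hU']
    rw [← this, add_sub_cancel_right]
  rw [cfc_id_eq hA.isHermitian, h2, Matrix.mul_sub, Matrix.mul_one, hAB.mul_mpow_zero hB,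
    sub_self, rtr_zero] at h1
  have hpos : ∀ i j, 0 ≤ a i * (if b j = 0 then 1 else 0) * w i j := fun i j => by
    have := ha i; have := hw i j
    split_ifs
    · rw [mul_one]; positivity
    · simp
  have h3 := (Finset.sum_eq_zero_iff_of_nonneg fun i _ => Finset.sum_nonneg fun j _ => hpos i j).1
    h1.symm i (Finset.mem_univ i)
  have h4 := (Finset.sum_eq_zero_iff_of_nonneg fun j _ => hpos i j).1 h3 j (Finset.mem_univ j)
  simpa [hj] using h4

/-- Hölder's inequality for the trace. -/
theorem rtr_mul_le_holder {A B : Matrix n n ℂ} (hA : A.PosSemidef) (hB : B.PosSemidef)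
    {p q : ℝ} (hpq : p.HolderConjugate q) :
    rtr (A * B) ≤ rtr (mpow A p) ^ (1 / p) * rtr (mpow B q) ^ (1 / q) := by
  obtain ⟨a, b, w, hw, -, -, h, ha, hb⟩ := exists_overlap hA.isHermitian hB.isHermitian
  have h0 := h (fun x => x) (fun x => x)
  rw [cfc_id_eq hA.isHermitian, cfc_id_eq hB.isHermitian] at h0
  rw [h0, mpow_eq, mpow_eq, rtr_mpow_eq_sum h hB.isHermitian, rtr_mpow_eq_sum' h hA.isHermitian,
    ← Fintype.sum_prod_type', ← Fintype.sum_prod_type', ← Fintype.sum_prod_type']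
  -- Scalar Hölder over pairs of eigenvectors, with the weight split as $w=w^{1/p}w^{1/q}$.
  have key := Real.inner_le_Lp_mul_Lq Finset.univ
    (fun x : n × n => a x.1 * w x.1 x.2 ^ (1 / p)) (fun x : n × n => b x.2 * w x.1 x.2 ^ (1 / q)) hpq
  have e1 : ∀ x : n × n, a x.1 * w x.1 x.2 ^ (1 / p) * (b x.2 * w x.1 x.2 ^ (1 / q)) =
      a x.1 * b x.2 * w x.1 x.2 := by
    intro x
    have : w x.1 x.2 ^ (1 / p) * w x.1 x.2 ^ (1 / q) = w x.1 x.2 := by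
      rw [← Real.rpow_add_of_nonneg (hw _ _) (one_div_nonneg.2 hpq.nonneg)
        (one_div_nonneg.2 hpq.symm.nonneg), one_div, one_div, hpq.inv_add_inv_eq_one,
        Real.rpow_one]
    calc _ = a x.1 * b x.2 * (w x.1 x.2 ^ (1 / p) * w x.1 x.2 ^ (1 / q)) := by ring
      _ = _ := by rw [this]
  have e2 : ∀ (r : ℝ) (hr : 0 < r) (x : n × n) (c : ℝ), 0 ≤ c →
      |c * w x.1 x.2 ^ (1 / r)| ^ r = spow r c * w x.1 x.2 := by
    intro r hr x c hc
    have := hw x.1 x.2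
    rw [abs_of_nonneg (by positivity), Real.mul_rpow hc (by positivity), ← Real.rpow_mul this,
      one_div_mul_cancel hr.ne', Real.rpow_one, spow_of_ne hr.ne']
  simp only [e1, e2 p hpq.pos _ _ (ha hA _), e2 q hpq.symm.pos _ _ (hb hB _)] at key
  exact key

/-- The reverse Hölder inequality for the trace. -/
theorem rtr_mpow_le_reverse_holder {A B : Matrix n n ℂ} (hA : A.PosSemidef) (hB : B.PosSemidef)
    (hAB : SuppLE A B) {b : ℝ} (hb0 : 0 < b) (hb1 : b < 1) :
    rtr (mpow A b) ≤ rtr (A * mpow B (-((1 - b) / b))) ^ b * rtr B ^ (1 - b) := by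
  obtain ⟨x, y, w, hw, -, -, h, hx, hy⟩ := exists_overlap hA.isHermitian hB.isHermitian
  have hz : ∀ i j, y j = 0 → x i * w i j = 0 := fun i j hj =>
    overlap_eq_zero hA hB hAB hw h (hx hA) hj
  have h0 := h (fun x => x) (spow (-((1 - b) / b)))
  have h1 := rtr_mpow_eq_sum' h hA.isHermitian fun x => x
  rw [cfc_id_eq hA.isHermitian] at h0
  rw [cfc_id_eq hB.isHermitian] at h1
  have hpq : (1 / b).HolderConjugate (1 / (1 - b)) := by
    rw [Real.holderConjugate_iff]
    refine ⟨by rw [lt_div_iff₀ hb0]; linarith, by simp⟩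
  -- Scalar Hölder with exponents $1/b$, $1/(1-b)$ for $x^bw=(x\,y^{-(1-b)/b}w)^b(yw)^{1-b}$. Where
  -- $y=0$ the factorisation survives because `hz` gives $xw=0$.
  have key := Real.inner_le_Lp_mul_Lq Finset.univ
    (fun z : n × n => (x z.1 * spow (-((1 - b) / b)) (y z.2) * w z.1 z.2) ^ b)
    (fun z : n × n => (y z.2 * w z.1 z.2) ^ (1 - b)) hpq
  rw [mpow_eq, mpow_eq, h0, h1, rtr_mpow_eq_sum h hB.isHermitian,
    ← Fintype.sum_prod_type', ← Fintype.sum_prod_type', ← Fintype.sum_prod_type']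
  have e1 : ∀ z : n × n, (x z.1 * spow (-((1 - b) / b)) (y z.2) * w z.1 z.2) ^ b *
      (y z.2 * w z.1 z.2) ^ (1 - b) = spow b (x z.1) * w z.1 z.2 := by
    intro z
    have hw' := hw z.1 z.2
    have hx' := hx hA z.1
    rcases (hy hB z.2).eq_or_lt with h' | h'
    · rcases mul_eq_zero.1 (hz z.1 z.2 h'.symm) with h'' | h''
      · simp [h'', hb0.ne']
      · simp [h'', hb0.ne']
    · rw [spow_of_pos _ h', Real.mul_rpow (by positivity) hw', Real.mul_rpow hx' (by positivity),
        Real.mul_rpow h'.le hw', ← Real.rpow_mul h'.le, spow_of_ne hb0.ne']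
      have e : -((1 - b) / b) * b = -(1 - b) := by field_simp
      have e3 : w z.1 z.2 ^ b * w z.1 z.2 ^ (1 - b) = w z.1 z.2 := by
        rw [← Real.rpow_add_of_nonneg hw' hb0.le (by linarith), add_sub_cancel, Real.rpow_one]
      have e4 : y z.2 ^ (-(1 - b)) * y z.2 ^ (1 - b) = 1 := by
        rw [← Real.rpow_add h']; simp
      rw [e]
      calc _ = x z.1 ^ b * (y z.2 ^ (-(1 - b)) * y z.2 ^ (1 - b)) *
            (w z.1 z.2 ^ b * w z.1 z.2 ^ (1 - b)) := by ring
        _ = _ := by rw [e3, e4]; ring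
  have e2 : ∀ (r c : ℝ), 0 < r → 0 ≤ c → |c ^ r| ^ (1 / r) = c := by
    intro r c hr hc
    rw [abs_of_nonneg (by positivity), ← Real.rpow_mul hc, mul_one_div_cancel hr.ne', Real.rpow_one]
  simp only [e1] at key
  have p1 : ∀ z : n × n, 0 ≤ x z.1 * spow (-((1 - b) / b)) (y z.2) * w z.1 z.2 := fun z =>
    mul_nonneg (mul_nonneg (hx hA _) (spow_nonneg _ (hy hB _))) (hw _ _)
  have p2 : ∀ z : n × n, 0 ≤ y z.2 * w z.1 z.2 := fun z => mul_nonneg (hy hB _) (hw _ _)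
  simp only [e2 b _ hb0 (p1 _), e2 (1 - b) _ (sub_pos.2 hb1) (p2 _), one_div_one_div] at key
  exact key

/-- Klein's inequality: the relative entropy is nonnegative. -/
theorem rtr_relEntropy_nonneg {A B : Matrix n n ℂ} (hA : A.PosSemidef) (hB : B.PosSemidef)
    (hAB : SuppLE A B) (htr : rtr A = rtr B) : 0 ≤ rtr (A * (mlog A - mlog B)) := by
  obtain ⟨x, y, w, hw, -, -, h, hx, hy⟩ := exists_overlap hA.isHermitian hB.isHermitian
  have hz : ∀ i j, y j = 0 → x i * w i j = 0 := fun i j hj =>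
    overlap_eq_zero hA hB hAB hw h (hx hA) hj
  have h1 := rtr_mpow_eq_sum h hB.isHermitian fun x => x
  have h2 := rtr_mpow_eq_sum' h hA.isHermitian fun x => x
  have h3 := rtr_mpow_eq_sum h hB.isHermitian fun x => x * Real.logb 2 x
  have h4 := h (fun x => x) (fun x => Real.logb 2 x)
  rw [← cfc_mul_cfc hA.isHermitian (fun x => x)] at h3
  rw [cfc_id_eq hA.isHermitian] at h1 h3 h4
  rw [cfc_id_eq hB.isHermitian] at h2
  rw [Matrix.mul_sub, rtr_sub]
  unfold mlog
  rw [h3, h4, ← Finset.sum_sub_distrib]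
  simp only [← Finset.sum_sub_distrib]
  have hl2 : 0 < Real.log 2 := Real.log_pos one_lt_two
  -- Termwise $x(\ln x-\ln y)\ge x-y$; the right-hand sides add up to the difference of the traces,
  -- which is zero.
  have : ∑ i, ∑ j, (x i * w i j - y j * w i j) / Real.log 2 ≤
      ∑ i, ∑ j, (x i * Real.logb 2 (x i) * w i j - x i * Real.logb 2 (y j) * w i j) := by
    refine Finset.sum_le_sum fun i _ => Finset.sum_le_sum fun j _ => ?_
    rw [div_le_iff₀ hl2]
    have hw' := hw i j
    rcases (hx hA i).eq_or_lt with h' | h'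
    · simp only [← h', zero_mul, zero_sub, sub_self, neg_nonpos]
      exact mul_nonneg (hy hB j) hw'
    rcases (hy hB j).eq_or_lt with h'' | h''
    · rcases mul_eq_zero.1 (hz i j h''.symm) with h3 | h3
      · exact absurd h3 h'.ne'
      · simp [h3]
    · have h5 : Real.log (y j / x i) ≤ y j / x i - 1 :=
        Real.log_le_sub_one_of_pos (by positivity)
      rw [Real.log_div h''.ne' h'.ne'] at h5
      have h6 : x i * (Real.log (y j) - Real.log (x i)) ≤ y j - x i := by
        calc _ ≤ x i * (y j / x i - 1) := by gcongr
          _ = _ := by field_simp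
      have e : (x i * Real.logb 2 (x i) * w i j - x i * Real.logb 2 (y j) * w i j) * Real.log 2 =
          x i * (Real.log (x i) - Real.log (y j)) * w i j := by
        simp only [Real.logb]; field_simp
      rw [e, ← sub_mul]
      gcongr
      linarith
  refine le_trans (le_of_eq ?_) this
  simp only [← Finset.sum_div, Finset.sum_sub_distrib, ← h1, ← h2, htr, sub_self, zero_div]

/-- Peierls' inequality `tr (P X P)^r ≤ tr (P X^r)` for a projection `P` and `r ≥ 1`. -/
theorem rtr_mpow_compress_le {P X : Matrix n n ℂ} (hP : P.IsHermitian) (hPP : P * P = P)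
    (hX : X.PosSemidef) {r : ℝ} (hr : 1 ≤ r) :
    rtr (mpow (P * X * P) r) ≤ rtr (P * mpow X r) := by
  rcases hr.eq_or_lt with rfl | hr
  · have : (P * X * P).PosSemidef := by
      have := hX.mul_mul_conjTranspose_same P
      rwa [hP.eq] at this
    rw [mpow_one this, mpow_one hX, rtr_mul_comm, ← Matrix.mul_assoc, hPP]
  set Z := P * X * P with hZ
  have hZp : Z.PosSemidef := by
    have := hX.mul_mul_conjTranspose_same P
    rwa [hP.eq] at this
  have hPZ : P * Z = Z := by rw [hZ, ← Matrix.mul_assoc, ← Matrix.mul_assoc, hPP]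
  have hZP : Z * P = Z := by rw [hZ, Matrix.mul_assoc, hPP]
  have hmZ : ∀ s, mpow Z s * P = mpow Z s := by
    intro s
    have : mpow Z s = mpow Z (s - 1) * Z := by rw [mpow_mul_self hZp, sub_add_cancel]
    rw [this, Matrix.mul_assoc, hZP]
  have hPm : ∀ s, P * mpow Z s = mpow Z s := by
    intro s
    have := congrArg Matrix.conjTranspose (hmZ s)
    rwa [Matrix.conjTranspose_mul, hP.eq, (mpow_isHermitian Z s).eq] at this
  obtain ⟨z, x, w, hw, -, -, h, hz, hx⟩ := exists_overlap hZp.isHermitian hX.isHermitian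
  have hr0 : r ≠ 0 := by positivity
  -- `Z` lives on the range of `P`, so under the trace one factor `Z` of the power may be replaced
  -- by `X`. Young's inequality on the eigenvalues then separates `Z` from `X`.
  have h1 : rtr (mpow Z r) = rtr (mpow Z (r - 1) * X) := by
    have e : mpow Z r = mpow Z (r - 1) * (P * X * P) := by
      conv_lhs => rw [← sub_add_cancel r 1, ← mpow_mul_mpow hZp, mpow_one hZp]
    rw [e, ← Matrix.mul_assoc, rtr_mul_comm, ← Matrix.mul_assoc, ← Matrix.mul_assoc, hPm, hmZ]
  have h2 : rtr (mpow Z (r - 1) * X) ≤ (1 - 1 / r) * rtr (mpow Z r) +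
      1 / r * rtr (mpow Z 0 * mpow X r) := by
    have e1 := h (spow (r - 1)) (fun x => x)
    rw [cfc_id_eq hX.isHermitian] at e1
    simp only [mpow_eq]
    rw [e1, h, rtr_mpow_eq_sum h hX.isHermitian, Finset.mul_sum, Finset.mul_sum,
      ← Finset.sum_add_distrib]
    refine Finset.sum_le_sum fun i _ => ?_
    rw [Finset.mul_sum, Finset.mul_sum, ← Finset.sum_add_distrib]
    refine Finset.sum_le_sum fun j _ => ?_
    have hw' := hw i j
    have hx' := hx hX j
    rcases (hz hZp i).eq_or_lt with h' | h'
    · simp [← h']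
    · rw [spow_of_pos _ h', spow_of_pos _ h', spow_of_pos _ h', spow_of_ne hr0, Real.rpow_zero,
        one_mul]
      have hpq : (r / (r - 1)).HolderConjugate r := by
        rw [Real.holderConjugate_iff]
        refine ⟨by rw [lt_div_iff₀ (by linarith)]; linarith, ?_⟩
        have : r - 1 ≠ 0 := by linarith
        field_simp; ring
      have hy := Real.young_inequality_of_nonneg (Real.rpow_nonneg h'.le (r - 1)) hx' hpq
      have hrr : r - 1 ≠ 0 := by linarith
      rw [← Real.rpow_mul h'.le, mul_div_cancel₀ r hrr] at hy
      have e : z i ^ r / (r / (r - 1)) = (1 - 1 / r) * z i ^ r := by field_simp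
      rw [e] at hy
      calc _ ≤ ((1 - 1 / r) * z i ^ r + x j ^ r / r) * w i j := by gcongr
        _ = _ := by ring
  -- The support of `Z` lies in the range of `P`, so `P - mpow Z 0` is again a projection.
  have h3 : rtr (mpow Z 0 * mpow X r) ≤ rtr (P * mpow X r) := by
    apply rtr_mul_le_mul_right (mpow_posSemidef hX r)
    have e : P - mpow Z 0 = (P - mpow Z 0) * (P - mpow Z 0)ᴴ := by
      rw [Matrix.conjTranspose_sub, hP.eq, (mpow_isHermitian Z 0).eq, Matrix.mul_sub,
        Matrix.sub_mul, Matrix.sub_mul, hPP, hmZ, hPm, mpow_mul_mpow hZp, add_zero, sub_self,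
        sub_zero]
    rw [e]
    exact Matrix.posSemidef_self_mul_conjTranspose _
  rw [← h1] at h2
  have h4 : 1 / r * rtr (mpow Z r) ≤ 1 / r * rtr (mpow Z 0 * mpow X r) := by linarith
  exact (le_of_mul_le_mul_left h4 (by positivity)).trans h3

/-- The square root is operator monotone. -/
theorem mpow_half_mono {A B : Matrix n n ℂ} (hA : A.PosSemidef) (hB : B.PosSemidef)
    (h : (A - B).PosSemidef) : (mpow A (1 / 2) - mpow B (1 / 2)).PosSemidef := by
  have hD : (mpow A (1 / 2) - mpow B (1 / 2)).IsHermitian :=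
    (mpow_isHermitian A _).sub (mpow_isHermitian B _)
  rw [hD.posSemidef_iff_eigenvalues_nonneg]
  intro i
  by_contra! hlt
  simp only [Pi.zero_apply] at hlt
  set v : n → ℂ := ⇑(hD.eigenvectorBasis i)
  set l := hD.eigenvalues i
  have hv : (mpow A (1 / 2) - mpow B (1 / 2)) *ᵥ v = l • v := hD.mulVec_eigenvectorBasis i
  -- Let $D=\sqrt A-\sqrt B$ and $Dv=lv$ with $l<0$. The identity gives $0\le\langle
  -- v,(A-B)v\rangle=l(\langle v,\sqrt A\,v\rangle+\langle v,\sqrt B\,v\rangle)$; hence $\sqrt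
  -- A\,v=\sqrt B\,v=0$, so $Dv=0$ and $v=0$.
  have e : A - B = mpow A (1 / 2) * (mpow A (1 / 2) - mpow B (1 / 2)) +
      (mpow A (1 / 2) - mpow B (1 / 2)) * mpow B (1 / 2) := by
    rw [Matrix.mul_sub, Matrix.sub_mul, mpow_half_mul_self hA, mpow_half_mul_self hB]
    abel
  have hv' : star v ᵥ* (mpow A (1 / 2) - mpow B (1 / 2)) = l • star v := by
    have := congrArg star hv
    rw [Matrix.star_mulVec, hD.eq] at this
    rw [this]
    ext; simp
  have h1 := h.dotProduct_mulVec_nonneg v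
  rw [e, Matrix.add_mulVec, dotProduct_add, ← Matrix.mulVec_mulVec, ← Matrix.mulVec_mulVec, hv,
    Matrix.dotProduct_mulVec (star v) (mpow A (1 / 2) - mpow B (1 / 2)), hv', Matrix.mulVec_smul,
    dotProduct_smul, smul_dotProduct, ← smul_add] at h1
  have ha := (mpow_posSemidef hA (1 / 2)).dotProduct_mulVec_nonneg v
  have hb := (mpow_posSemidef hB (1 / 2)).dotProduct_mulVec_nonneg v
  have h2 : star v ⬝ᵥ mpow A (1 / 2) *ᵥ v + star v ⬝ᵥ mpow B (1 / 2) *ᵥ v = 0 := by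
    refine le_antisymm ?_ (add_nonneg ha hb)
    have := smul_nonneg (a := -l⁻¹) (by rw [neg_nonneg]; exact (inv_lt_zero.2 hlt).le) h1
    rw [smul_smul, neg_mul, inv_mul_cancel₀ hlt.ne, neg_one_smul, neg_nonneg] at this
    exact this
  obtain ⟨h3, h4⟩ := (add_eq_zero_iff_of_nonneg ha hb).1 h2
  rw [(mpow_posSemidef hA _).dotProduct_mulVec_zero_iff] at h3
  rw [(mpow_posSemidef hB _).dotProduct_mulVec_zero_iff] at h4
  rw [Matrix.sub_mulVec, h3, h4, sub_self] at hv
  have h5 : v = 0 := by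
    have := congrArg (fun u => l⁻¹ • u) hv.symm
    simpa [smul_smul, inv_mul_cancel₀ hlt.ne] using this
  have h6 := hD.eigenvectorBasis.orthonormal.ne_zero i
  apply h6
  ext j
  exact congrFun h5 j

end TraceInequalities

/-! ### Partial traces and supports -/

section PartialTrace

variable {X S : Type*} [Fintype X] [DecidableEq X] [Fintype S] [DecidableEq S]

theorem trFst_apply (M : Matrix (X × S) (X × S) ℂ) (i j : S) :
    trFst M i j = ∑ k, M (k, i) (k, j) := rfl

theorem one_kron_posSemidef {σ : Matrix S S ℂ} (hσ : σ.PosSemidef) :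
    ((1 : Matrix X X ℂ) ⊗ₖ σ).PosSemidef := Matrix.PosSemidef.one.kronecker hσ

theorem one_kron_mul (A B : Matrix S S ℂ) :
    ((1 : Matrix X X ℂ) ⊗ₖ A) * ((1 : Matrix X X ℂ) ⊗ₖ B) = (1 : Matrix X X ℂ) ⊗ₖ (A * B) := by
  rw [← Matrix.mul_kronecker_mul, Matrix.mul_one]

theorem trFst_mul_one_kron (M : Matrix (X × S) (X × S) ℂ) (A : Matrix S S ℂ) :
    trFst (M * ((1 : Matrix X X ℂ) ⊗ₖ A)) = trFst M * A := by
  ext i j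
  rw [Matrix.mul_apply, trFst_apply]
  simp only [trFst_apply, Finset.sum_mul]
  rw [Finset.sum_comm]
  refine Finset.sum_congr rfl fun k _ => ?_
  rw [Matrix.mul_apply, Fintype.sum_prod_type, Finset.sum_eq_single k]
  · simp
  · intro x _ h
    simp [h]
  · simp

theorem rtr_trFst (M : Matrix (X × S) (X × S) ℂ) : rtr (trFst M) = rtr M := by
  rw [rtr, rtr, Matrix.trace, Matrix.trace, Fintype.sum_prod_type, Finset.sum_comm]
  rfl

theorem rtr_mul_one_kron (M : Matrix (X × S) (X × S) ℂ) (A : Matrix S S ℂ) :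
    rtr (M * ((1 : Matrix X X ℂ) ⊗ₖ A)) = rtr (trFst M * A) := by
  rw [← trFst_mul_one_kron, rtr_trFst]

theorem trFst_eq_sum (M : Matrix (X × S) (X × S) ℂ) :
    trFst M = ∑ k : X, M.submatrix (fun i => (k, i)) (fun i => (k, i)) := by
  ext i j
  rw [Matrix.sum_apply]
  rfl

theorem trFst_posSemidef {M : Matrix (X × S) (X × S) ℂ} (hM : M.PosSemidef) :
    (trFst M).PosSemidef := by
  rw [trFst_eq_sum]
  exact Matrix.posSemidef_sum _ fun k _ => hM.submatrix _

/-- The trace is the squared Hilbert–Schmidt norm of $\sqrt A\sqrt B$. -/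
theorem mul_eq_zero_of_rtr_eq_zero {n : Type*} [Fintype n] [DecidableEq n] {A B : Matrix n n ℂ}
    (hA : A.PosSemidef) (hB : B.PosSemidef) (h : rtr (A * B) = 0) : A * B = 0 := by
  set W := mpow A (1 / 2) * mpow B (1 / 2)
  have h1 : rtr (W * Wᴴ) = 0 := by
    rw [← h, Matrix.conjTranspose_mul, (mpow_isHermitian A _).eq, (mpow_isHermitian B _).eq,
      Matrix.mul_assoc, rtr_mul_comm, ← Matrix.mul_assoc, Matrix.mul_assoc,
      Matrix.mul_assoc, mpow_half_mul_self hA, ← Matrix.mul_assoc, mpow_half_mul_self hB,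
      rtr_mul_comm]
  rw [rtr_eq_zero_iff (Matrix.posSemidef_self_mul_conjTranspose _),
    Matrix.self_mul_conjTranspose_eq_zero] at h1
  calc A * B = mpow A (1 / 2) * W * mpow B (1 / 2) := by
        conv_lhs => rw [← mpow_half_mul_self hA, ← mpow_half_mul_self hB]
        simp only [W, Matrix.mul_assoc]
    _ = 0 := by rw [h1]; simp

theorem mpow_ne_zero {n : Type*} [Fintype n] [DecidableEq n] {A : Matrix n n ℂ}
    (hA : A.PosSemidef) (h : A ≠ 0) (p : ℝ) : mpow A p ≠ 0 := by
  intro h'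
  apply h
  rw [← mpow_one hA, ← add_sub_cancel p 1, ← mpow_mul_mpow hA, h', Matrix.zero_mul]

theorem rtr_mpow_pos {n : Type*} [Fintype n] [DecidableEq n] {A : Matrix n n ℂ}
    (hA : A.PosSemidef) (h : A ≠ 0) (p : ℝ) : 0 < rtr (mpow A p) :=
  rtr_pos (mpow_posSemidef hA p) (mpow_ne_zero hA h p)

/-- Otherwise $AB^p=0$, and multiplication by $B^{-p}$ gives $A=0$. This makes the arguments of the
logarithms positive. -/
theorem rtr_mul_mpow_pos {n : Type*} [Fintype n] [DecidableEq n] {A B : Matrix n n ℂ}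
    (hA : A.PosSemidef) (hB : B.PosSemidef) (h : A ≠ 0) (hAB : SuppLE A B) (p : ℝ) :
    0 < rtr (A * mpow B p) := by
  refine lt_of_le_of_ne (rtr_mul_nonneg hA (mpow_posSemidef hB p)) fun h0 => h ?_
  have h1 := mul_eq_zero_of_rtr_eq_zero hA (mpow_posSemidef hB p) h0.symm
  rw [← hAB.mul_mpow_zero hB, ← add_neg_cancel p, ← mpow_mul_mpow hB, ← Matrix.mul_assoc, h1,
    Matrix.zero_mul]

/-- The weight of `ρ` on the kernel of $\mathbb I\otimes\sigma$ equals the weight of its marginal on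
the kernel of `σ`, and a positive operator with zero weight on a projection is annihilated by it. -/
theorem suppLE_one_kron_iff {ρ : Matrix (X × S) (X × S) ℂ} (hρ : ρ.PosSemidef)
    {σ : Matrix S S ℂ} (hσ : σ.PosSemidef) :
    SuppLE ρ ((1 : Matrix X X ℂ) ⊗ₖ σ) ↔ SuppLE (trFst ρ) σ := by
  rw [suppLE_iff (one_kron_posSemidef hσ), suppLE_iff hσ, mpow_one_kron hσ.isHermitian]
  constructor
  · intro h
    rw [← trFst_mul_one_kron, h]
  · intro h
    have hP : (1 - mpow σ 0).PosSemidef := by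
      have e : 1 - mpow σ 0 = (1 - mpow σ 0) * (1 - mpow σ 0)ᴴ := by
        rw [Matrix.conjTranspose_sub, Matrix.conjTranspose_one, (mpow_isHermitian σ 0).eq,
          Matrix.mul_sub, Matrix.mul_one, Matrix.sub_mul, Matrix.one_mul, mpow_mul_mpow hσ,
          add_zero, sub_self, sub_zero]
      rw [e]
      exact Matrix.posSemidef_self_mul_conjTranspose _
    have h1 : rtr (ρ * ((1 : Matrix X X ℂ) ⊗ₖ (1 - mpow σ 0))) = 0 := by
      rw [rtr_mul_one_kron, Matrix.mul_sub, h, Matrix.mul_one, sub_self, rtr_zero]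
    have h2 := mul_eq_zero_of_rtr_eq_zero hρ (one_kron_posSemidef hP) h1
    have e : (1 : Matrix X X ℂ) ⊗ₖ (1 - mpow σ 0) = 1 - (1 : Matrix X X ℂ) ⊗ₖ mpow σ 0 := by
      rw [← Matrix.one_kronecker_one (m := X) (n := S), eq_sub_iff_add_eq, ← Matrix.kronecker_add,
        sub_add_cancel]
    rw [e, Matrix.mul_sub, Matrix.mul_one, sub_eq_zero] at h2
    exact h2.symm

theorem suppLE_one_kron_trFst {ρ : Matrix (X × S) (X × S) ℂ} (hρ : ρ.PosSemidef) :
    SuppLE ρ ((1 : Matrix X X ℂ) ⊗ₖ trFst ρ) :=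
  (suppLE_one_kron_iff hρ (trFst_posSemidef hρ)).2 fun _ h => h

theorem trFst_ne_zero {ρ : Matrix (X × S) (X × S) ℂ} (hρ : ρ.PosSemidef) (h : ρ ≠ 0) :
    trFst ρ ≠ 0 := by
  rw [Ne, ← rtr_eq_zero_iff (trFst_posSemidef hρ), rtr_trFst, rtr_eq_zero_iff hρ]
  exact h

end PartialTrace

/-! ### Conditional entropies and Sibson's identity -/

section Entropies

variable {X S : Type*} [Fintype X] [DecidableEq X] [Fintype S] [DecidableEq S]
  {ρ : Matrix (X × S) (X × S) ℂ} {σ : Matrix S S ℂ}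

theorem petzDiv_of_ne {a : ℝ} (ha : a ≠ 1) (hρ : ρ.PosSemidef) (hσ : σ.PosSemidef)
    (h : SuppLE (trFst ρ) σ) : petzDiv a ρ ((1 : Matrix X X ℂ) ⊗ₖ σ) =
      ((1 / (a - 1) * Real.logb 2 (rtr (trFst (mpow ρ a) * mpow σ (1 - a))) : ℝ) : EReal) := by
  rw [petzDiv, if_pos ((suppLE_one_kron_iff hρ hσ).2 h), if_neg ha,
    mpow_one_kron hσ.isHermitian, rtr_mul_one_kron]

theorem sandDiv_of_ne {a : ℝ} (ha : a ≠ 1) (hρ : ρ.PosSemidef) (hσ : σ.PosSemidef)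
    (h : SuppLE (trFst ρ) σ) : sandDiv a ρ ((1 : Matrix X X ℂ) ⊗ₖ σ) =
      ((1 / (a - 1) * Real.logb 2 (rtr (mpow (((1 : Matrix X X ℂ) ⊗ₖ mpow σ ((1 - a) / (2 * a))) *
        ρ * ((1 : Matrix X X ℂ) ⊗ₖ mpow σ ((1 - a) / (2 * a)))) a)) : ℝ) : EReal) := by
  rw [sandDiv, if_pos ((suppLE_one_kron_iff hρ hσ).2 h), if_neg ha,
    mpow_one_kron hσ.isHermitian]

theorem petzDiv_one (hρ : ρ.PosSemidef) (hσ : σ.PosSemidef)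
    (h : SuppLE (trFst ρ) σ) : petzDiv 1 ρ ((1 : Matrix X X ℂ) ⊗ₖ σ) =
      ((rtr (ρ * mlog ρ) - rtr (trFst ρ * mlog σ) : ℝ) : EReal) := by
  rw [petzDiv, if_pos ((suppLE_one_kron_iff hρ hσ).2 h), if_pos rfl,
    mlog_one_kron hσ.isHermitian, Matrix.mul_sub, rtr_sub, rtr_mul_one_kron]

theorem sandDiv_one_eq {n : Type*} [Fintype n] [DecidableEq n] (ρ σ : Matrix n n ℂ) :
    sandDiv 1 ρ σ = petzDiv 1 ρ σ := by
  simp [sandDiv, petzDiv]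

theorem petzDiv_of_not {a : ℝ} (hρ : ρ.PosSemidef) (hσ : σ.PosSemidef)
    (h : ¬ SuppLE (trFst ρ) σ) : petzDiv a ρ ((1 : Matrix X X ℂ) ⊗ₖ σ) = ⊤ := by
  rw [petzDiv, if_neg (mt (suppLE_one_kron_iff hρ hσ).1 h)]

theorem sandDiv_of_not {a : ℝ} (hρ : ρ.PosSemidef) (hσ : σ.PosSemidef)
    (h : ¬ SuppLE (trFst ρ) σ) : sandDiv a ρ ((1 : Matrix X X ℂ) ⊗ₖ σ) = ⊤ := by
  rw [sandDiv, if_neg (mt (suppLE_one_kron_iff hρ hσ).1 h)]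

theorem suppLE_refl {n : Type*} [Fintype n] (A : Matrix n n ℂ) : SuppLE A A := fun _ h => h

theorem petzDown_of_ne {a : ℝ} (ha : a ≠ 1) (hρ : ρ.PosSemidef) : petzDown a ρ =
    ((1 / (1 - a) * Real.logb 2 (rtr (trFst (mpow ρ a) * mpow (trFst ρ) (1 - a))) : ℝ) :
      EReal) := by
  rw [petzDown, petzDiv_of_ne ha hρ (trFst_posSemidef hρ) (suppLE_refl _), ← EReal.coe_neg,
    ← neg_sub a 1, one_div_neg_eq_neg_one_div, neg_mul, EReal.coe_neg]

theorem sandDown_of_ne {a : ℝ} (ha : a ≠ 1) (hρ : ρ.PosSemidef) : sandDown a ρ =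
    ((1 / (1 - a) * Real.logb 2 (rtr (mpow (((1 : Matrix X X ℂ) ⊗ₖ
      mpow (trFst ρ) ((1 - a) / (2 * a))) * ρ * ((1 : Matrix X X ℂ) ⊗ₖ
      mpow (trFst ρ) ((1 - a) / (2 * a)))) a)) : ℝ) : EReal) := by
  rw [sandDown, sandDiv_of_ne ha hρ (trFst_posSemidef hρ) (suppLE_refl _), ← EReal.coe_neg,
    ← neg_sub a 1, one_div_neg_eq_neg_one_div, neg_mul, EReal.coe_neg]

theorem petzDown_one (hρ : ρ.PosSemidef) : petzDown 1 ρ =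
    ((rtr (trFst ρ * mlog (trFst ρ)) - rtr (ρ * mlog ρ) : ℝ) : EReal) := by
  rw [petzDown, petzDiv_one hρ (trFst_posSemidef hρ) (suppLE_refl _), ← EReal.coe_neg, neg_sub]

theorem sandDown_one (ρ : Matrix (X × S) (X × S) ℂ) : sandDown 1 ρ = petzDown 1 ρ := by
  rw [sandDown, petzDown, sandDiv_one_eq]

theorem sandUp_one (ρ : Matrix (X × S) (X × S) ℂ) : sandUp 1 ρ = petzUp 1 ρ := by
  simp only [sandUp, petzUp, sandDiv_one_eq]

theorem isState_trFst (hρ : IsState ρ) : IsState (trFst ρ) := by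
  rw [isState_iff] at hρ ⊢
  exact ⟨trFst_posSemidef hρ.1, by rw [rtr_trFst, hρ.2]⟩

/-- For a normalised state the supremum at order one is attained at the marginal. -/
theorem petzUp_one (hρ : IsState ρ) : petzUp 1 ρ = petzDown 1 ρ := by
  apply le_antisymm
  · refine iSup₂_le fun σ hσ => ?_
    by_cases h : SuppLE (trFst ρ) σ
    · rw [petzDown_one hρ.1, petzDiv_one hρ.1 hσ.1 h, ← EReal.coe_neg, EReal.coe_le_coe_iff]
      have h1 := rtr_relEntropy_nonneg (trFst_posSemidef hρ.1) hσ.1 h (by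
        rw [(isState_iff.1 (isState_trFst hρ)).2, (isState_iff.1 hσ).2])
      rw [Matrix.mul_sub, rtr_sub] at h1
      linarith
    · rw [petzDiv_of_not hρ.1 hσ.1 h]; simp
  · exact le_iSup₂_of_le (trFst ρ) (isState_trFst hρ) le_rfl

/-- Normalisation of a power. -/
theorem isState_normalize {n : Type*} [Fintype n] [DecidableEq n] {A : Matrix n n ℂ}
    (hA : A.PosSemidef) (h : A ≠ 0) : IsState ((rtr A)⁻¹ • A) := by
  rw [isState_iff]
  have := rtr_pos hA h
  exact ⟨hA.smul (by positivity), by rw [rtr_smul, inv_mul_cancel₀ this.ne']⟩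

theorem suppLE_smul {n : Type*} [Fintype n] (A : Matrix n n ℂ) {c : ℝ} (hc : c ≠ 0) :
    SuppLE A (c • A) := by
  intro v hv
  rw [Matrix.smul_mulVec] at hv
  exact (smul_eq_zero.1 hv).resolve_left hc

theorem suppLE_trFst_mpow (hρ : ρ.PosSemidef) (b : ℝ) :
    SuppLE (trFst ρ) (trFst (mpow ρ b)) := by
  have hb := mpow_posSemidef hρ b
  rw [← suppLE_one_kron_iff hρ (trFst_posSemidef hb)]
  exact (suppLE_self_mpow hρ b).trans (suppLE_one_kron_trFst hb)

theorem suppLE_mpow_trFst (hρ : ρ.PosSemidef) (b : ℝ) :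
    SuppLE (trFst (mpow ρ b)) (trFst ρ) := by
  have hb := mpow_posSemidef hρ b
  rw [← suppLE_one_kron_iff hb (trFst_posSemidef hρ)]
  exact (suppLE_mpow_self hρ b).trans (suppLE_one_kron_trFst hρ)

/-- Sibson's identity: closed form and maximiser of the optimised Petz–Rényi entropy. -/
theorem petzUp_closed_form {b : ℝ} (hb0 : 0 < b) (hb1 : b ≠ 1) (hρ : ρ.PosSemidef) (hne : ρ ≠ 0) :
    petzUp b ρ = ((b / (1 - b) * Real.logb 2 (rtr (mpow (trFst (mpow ρ b)) (1 / b))) : ℝ) :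
      EReal) ∧
    IsState ((rtr (mpow (trFst (mpow ρ b)) (1 / b)))⁻¹ • mpow (trFst (mpow ρ b)) (1 / b)) ∧
    petzUp b ρ = -petzDiv b ρ ((1 : Matrix X X ℂ) ⊗ₖ
      ((rtr (mpow (trFst (mpow ρ b)) (1 / b)))⁻¹ • mpow (trFst (mpow ρ b)) (1 / b))) := by
  have hb := mpow_posSemidef hρ b
  set Q := trFst (mpow ρ b) with hQ
  have hQp : Q.PosSemidef := trFst_posSemidef hb
  have hQ0 : Q ≠ 0 := trFst_ne_zero hb (mpow_ne_zero hρ hne b)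
  set x := rtr (mpow Q (1 / b)) with hx
  have hx0 : 0 < x := rtr_mpow_pos hQp hQ0 _
  have hstate : IsState (x⁻¹ • mpow Q (1 / b)) :=
    isState_normalize (mpow_posSemidef hQp _) (mpow_ne_zero hQp hQ0 _)
  have hsupp : SuppLE (trFst ρ) (x⁻¹ • mpow Q (1 / b)) :=
    ((suppLE_trFst_mpow hρ b).trans (suppLE_self_mpow hQp _)).trans
      (suppLE_smul _ (inv_ne_zero hx0.ne'))
  -- At the candidate, $\mathrm{tr}\,Q\sigma^{1-b}=x^{b-1}\,\mathrm{tr}\,Q^{1/b}=x^b$.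
  have hval : -petzDiv b ρ ((1 : Matrix X X ℂ) ⊗ₖ (x⁻¹ • mpow Q (1 / b))) =
      ((b / (1 - b) * Real.logb 2 x : ℝ) : EReal) := by
    rw [petzDiv_of_ne hb1 hρ hstate.1 hsupp, ← EReal.coe_neg, ← hQ,
      mpow_smul (mpow_posSemidef hQp _) (inv_nonneg.2 hx0.le), mpow_mpow hQp, Matrix.mul_smul,
      rtr_smul, self_mul_mpow hQp, show 1 / b * (1 - b) + 1 = 1 / b by field_simp; ring, ← hx,
      spow_of_pos _ (inv_pos.2 hx0), Real.inv_rpow hx0.le, ← Real.rpow_neg hx0.le, neg_sub]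
    have : x ^ (b - 1) * x = x ^ b := by
      nth_rw 2 [← Real.rpow_one x]
      rw [← Real.rpow_add hx0, sub_add_cancel]
    rw [this, Real.logb_rpow_eq_mul_logb_of_pos hx0]
    congr 1
    have h1 : b - 1 ≠ 0 := sub_ne_zero.2 hb1
    have h2 : 1 - b ≠ 0 := sub_ne_zero.2 hb1.symm
    field_simp
    ring
  have hle : petzUp b ρ ≤ ((b / (1 - b) * Real.logb 2 x : ℝ) : EReal) := by
    refine iSup₂_le fun σ hσ => ?_
    by_cases h : SuppLE (trFst ρ) σ
    swap
    · rw [petzDiv_of_not hρ hσ.1 h]; simp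
    have hσ1 := (isState_iff.1 hσ).2
    have hQσ : SuppLE Q σ := (suppLE_mpow_trFst hρ b).trans h
    have hpos : 0 < rtr (Q * mpow σ (1 - b)) := rtr_mul_mpow_pos hQp hσ.1 hQ0 hQσ _
    rw [petzDiv_of_ne hb1 hρ hσ.1 h, ← EReal.coe_neg, EReal.coe_le_coe_iff, ← hQ, ← neg_mul,
      ← one_div_neg_eq_neg_one_div, neg_sub, div_mul_eq_mul_div, div_mul_eq_mul_div, one_mul,
      ← Real.logb_rpow_eq_mul_logb_of_pos hx0]
    -- For $b<1$, Hölder with exponents $1/b$, $1/(1-b)$ gives $\mathrm{tr}\,Q\sigma^{1-b}\le x^b$.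
    -- For $b>1$, reverse Hölder of order $1/b$ gives the opposite inequality, and so does the sign
    -- of $1-b$.
    rcases lt_or_gt_of_ne hb1 with hlt | hgt
    · have h1b : 0 < 1 - b := by linarith
      apply div_le_div_of_nonneg_right _ h1b.le
      apply Real.logb_le_logb_of_le one_lt_two hpos
      have := rtr_mul_le_holder hQp (mpow_posSemidef hσ.1 (1 - b)) (p := 1 / b)
        (q := 1 / (1 - b)) (by
          rw [Real.holderConjugate_iff]
          exact ⟨by rw [lt_div_iff₀ hb0]; linarith, by simp⟩)
      rwa [mpow_mpow hσ.1, mul_one_div_cancel h1b.ne', mpow_one hσ.1, hσ1, Real.one_rpow, mul_one,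
        one_div_one_div] at this
    · have h1b : 1 - b < 0 := by linarith
      apply (div_le_div_right_of_neg h1b).2
      apply Real.logb_le_logb_of_le one_lt_two (by positivity)
      have := rtr_mpow_le_reverse_holder hQp hσ.1 hQσ (b := 1 / b) (by positivity)
        (by rw [div_lt_one hb0]; exact hgt)
      rw [hσ1, Real.one_rpow, mul_one, ← hx,
        show -((1 - 1 / b) / (1 / b)) = 1 - b by field_simp; ring] at this
      calc x ^ b ≤ (rtr (Q * mpow σ (1 - b)) ^ (1 / b)) ^ b :=
            Real.rpow_le_rpow hx0.le this hb0.le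
        _ = _ := by rw [← Real.rpow_mul hpos.le, one_div_mul_cancel hb0.ne', Real.rpow_one]
  have heq : petzUp b ρ = ((b / (1 - b) * Real.logb 2 x : ℝ) : EReal) := by
    apply le_antisymm hle
    rw [← hval]
    exact le_iSup₂_of_le _ hstate le_rfl
  exact ⟨heq, hstate, by rw [heq, hval]⟩

end Entropies

/-! ### Marginals of a tripartite pure state; duality of the entropies with closed forms -/

section Purification

variable {Y C E : Type*} [Fintype Y] [DecidableEq Y] [Fintype C] [DecidableEq C]
  [Fintype E] [DecidableEq E]

/-- The vector `φ` as a matrix from `E` to `YC`. -/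
def vecMat (φ : (Y × C) × E → ℂ) : Matrix (Y × C) E ℂ := Matrix.of fun i e => φ (i, e)

/-- The marginal on `YC` of the pure state `|φ⟩⟨φ|`. -/
noncomputable def marg (φ : (Y × C) × E → ℂ) : Matrix (Y × C) (Y × C) ℂ := vecMat φ * (vecMat φ)ᴴ

/-- The vector `φ` with the systems `C` and `E` exchanged. -/
def swapCE (φ : (Y × C) × E → ℂ) : (Y × E) × C → ℂ := fun i => φ ((i.1.1, i.2), i.1.2)

/-- The marginal on `E` of the operator `S_C |φ⟩⟨φ|`. -/
noncomputable def margE (φ : (Y × C) × E → ℂ) (S : Matrix C C ℂ) : Matrix E E ℂ :=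
  ((vecMat φ)ᴴ * ((1 : Matrix Y Y ℂ) ⊗ₖ S) * vecMat φ)ᵀ

theorem swapCE_swapCE (φ : (Y × C) × E → ℂ) : swapCE (swapCE φ) = φ := rfl

theorem trSnd_vecMulVec (φ : (Y × C) × E → ℂ) :
    trSnd (Matrix.vecMulVec φ (star φ)) = marg φ := by
  ext i j
  rfl

theorem trMid_vecMulVec (φ : (Y × C) × E → ℂ) :
    trMid (Matrix.vecMulVec φ (star φ)) = marg (swapCE φ) := by
  ext i j
  rfl

theorem marg_posSemidef (φ : (Y × C) × E → ℂ) : (marg φ).PosSemidef :=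
  Matrix.posSemidef_self_mul_conjTranspose _

theorem margE_apply (φ : (Y × C) × E → ℂ) (S : Matrix C C ℂ) (e e' : E) :
    margE φ S e e' = ∑ y, ∑ c, ∑ c', star (φ ((y, c), e')) * S c c' * φ ((y, c'), e) := by
  simp only [margE, Matrix.transpose_apply, Matrix.mul_assoc]
  rw [Matrix.mul_apply, Fintype.sum_prod_type]
  refine Finset.sum_congr rfl fun y _ => Finset.sum_congr rfl fun c _ => ?_
  rw [Matrix.mul_apply, Fintype.sum_prod_type, Finset.mul_sum, Finset.sum_eq_single y]
  · rw [Finset.mul_sum]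
    refine Finset.sum_congr rfl fun c' _ => ?_
    simp [vecMat, Matrix.conjTranspose_apply, mul_assoc]
  · intro y' _ h
    simp [Ne.symm h]
  · simp

theorem margE_posSemidef (φ : (Y × C) × E → ℂ) {S : Matrix C C ℂ} (hS : S.PosSemidef) :
    (margE φ S).PosSemidef :=
  ((one_kron_posSemidef hS).conjTranspose_mul_mul_same (vecMat φ)).transpose

theorem margE_add (φ : (Y × C) × E → ℂ) (S T : Matrix C C ℂ) :
    margE φ (S + T) = margE φ S + margE φ T := by
  rw [margE, Matrix.kronecker_add, Matrix.mul_add, Matrix.add_mul, Matrix.transpose_add]; rfl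

theorem margE_smul (φ : (Y × C) × E → ℂ) (c : ℝ) (S : Matrix C C ℂ) :
    margE φ (c • S) = c • margE φ S := by
  rw [margE, Matrix.kronecker_smul, Matrix.mul_smul, Matrix.smul_mul, Matrix.transpose_smul]; rfl

/-- Both sides are $\langle\phi|\mathbb I_Y\otimes S\otimes T|\phi\rangle$. This form, symmetric in
the parties `C` and `E`, lies behind the duality relations. -/
theorem rtr_margE_mul_comm (φ : (Y × C) × E → ℂ) (S : Matrix C C ℂ) (T : Matrix E E ℂ) :
    rtr (margE φ S * T) = rtr (margE (swapCE φ) T * S) := by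
  have hsum : ∀ f : E → E → Y → C → C → ℂ, ∑ e, ∑ e', ∑ y, ∑ c, ∑ c', f e e' y c c' =
      ∑ c, ∑ c', ∑ y, ∑ e, ∑ e', f e' e y c' c := by
    intro f
    have h1 : ∑ e, ∑ e', ∑ y, ∑ c, ∑ c', f e e' y c c' =
        ∑ p : E × E × Y × C × C, f p.1 p.2.1 p.2.2.1 p.2.2.2.1 p.2.2.2.2 := by
      simp only [Fintype.sum_prod_type]
    have h2 : ∑ c, ∑ c', ∑ y, ∑ e, ∑ e', f e' e y c' c =
        ∑ p : C × C × Y × E × E, f p.2.2.2.2 p.2.2.2.1 p.2.2.1 p.2.1 p.1 := by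
      simp only [Fintype.sum_prod_type]
    rw [h1, h2]
    exact Fintype.sum_equiv ⟨fun p => (p.2.2.2.2, p.2.2.2.1, p.2.2.1, p.2.1, p.1),
      fun p => (p.2.2.2.2, p.2.2.2.1, p.2.2.1, p.2.1, p.1), fun _ => rfl, fun _ => rfl⟩ _ _
      fun _ => rfl
  rw [rtr, rtr]
  congr 1
  simp only [Matrix.trace, Matrix.diag_apply, Matrix.mul_apply, margE_apply, Finset.sum_mul]
  rw [hsum]
  refine Finset.sum_congr rfl fun c _ => Finset.sum_congr rfl fun c' _ =>
    Finset.sum_congr rfl fun y _ => Finset.sum_congr rfl fun e _ => Finset.sum_congr rfl fun e' _ => ?_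
  simp only [swapCE]
  ring

theorem trFst_marg (φ : (Y × C) × E → ℂ) : trFst (marg φ) = margE (swapCE φ) 1 := by
  ext c c'
  rw [margE_apply, trFst_apply]
  refine Finset.sum_congr rfl fun y _ => ?_
  simp only [marg, Matrix.mul_apply, Matrix.one_apply, mul_ite, ite_mul, mul_one, mul_zero,
    zero_mul, Finset.sum_ite_eq, Finset.mem_univ, if_true]
  refine Finset.sum_congr rfl fun e _ => ?_
  rw [mul_comm]; rfl

theorem vecMat_conjTranspose_mul (φ : (Y × C) × E → ℂ) :
    (vecMat φ)ᴴ * vecMat φ = (trFst (marg (swapCE φ)))ᵀ := by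
  rw [trFst_marg, swapCE_swapCE, margE, Matrix.transpose_transpose, Matrix.one_kronecker_one,
    Matrix.mul_one]

/-- $(\Phi\Phi^\dagger)^a=\Phi(\Phi^\dagger\Phi)^{a-1}\Phi^\dagger$, and cyclicity leaves
$\Phi^\dagger(\mathbb I\otimes S)\Phi$, which is `margE φ S` up to a transpose. -/
theorem rtr_mpow_marg_mul (φ : (Y × C) × E → ℂ) (a : ℝ) (S : Matrix C C ℂ) :
    rtr (mpow (marg φ) a * ((1 : Matrix Y Y ℂ) ⊗ₖ S)) =
      rtr (margE φ S * mpow (trFst (marg (swapCE φ))) (a - 1)) := by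
  rw [marg, mpow_mul_conjTranspose, vecMat_conjTranspose_mul,
    mpow_transpose (trFst_posSemidef (marg_posSemidef _)).isHermitian,
    Matrix.mul_assoc (_ * _), rtr_mul_comm, ← Matrix.mul_assoc, ← rtr_transpose,
    Matrix.transpose_mul, Matrix.transpose_transpose, rtr_mul_comm]
  rfl

/-- The operator is $XX^\dagger$ with $X=(\mathbb I\otimes s)\Phi$; the other product $X^\dagger X$
is the transpose of `margE φ (s * s)`. -/
theorem rtr_mpow_conj_marg (φ : (Y × C) × E → ℂ) (a : ℝ) {s : Matrix C C ℂ}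
    (hs : s.IsHermitian) :
    rtr (mpow (((1 : Matrix Y Y ℂ) ⊗ₖ s) * marg φ * ((1 : Matrix Y Y ℂ) ⊗ₖ s)) a) =
      rtr (mpow (margE φ (s * s)) a) := by
  have hs' : ((1 : Matrix Y Y ℂ) ⊗ₖ s)ᴴ = (1 : Matrix Y Y ℂ) ⊗ₖ s := by
    rw [Matrix.conjTranspose_kronecker, hs.eq, Matrix.conjTranspose_one]
  have e1 : ((1 : Matrix Y Y ℂ) ⊗ₖ s) * marg φ * ((1 : Matrix Y Y ℂ) ⊗ₖ s) =
      (((1 : Matrix Y Y ℂ) ⊗ₖ s) * vecMat φ) * (((1 : Matrix Y Y ℂ) ⊗ₖ s) * vecMat φ)ᴴ := by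
    rw [Matrix.conjTranspose_mul, hs', marg]; simp only [Matrix.mul_assoc]
  have e2 : margE φ (s * s) =
      ((((1 : Matrix Y Y ℂ) ⊗ₖ s) * vecMat φ)ᴴ * (((1 : Matrix Y Y ℂ) ⊗ₖ s) * vecMat φ))ᵀ := by
    rw [Matrix.conjTranspose_mul, hs', margE, ← one_kron_mul]; simp only [Matrix.mul_assoc]
  rw [e1, rtr_mpow_mul_conjTranspose, e2,
    mpow_transpose (Matrix.isHermitian_conjTranspose_mul_self _), rtr_transpose]

/-- By $\Phi(\Phi^\dagger\Phi)^r\Phi^\dagger=(\Phi\Phi^\dagger)^{r+1}$: weighting `E` by a power of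
its own marginal raises the exponent on `YC` by one. -/
theorem margE_mpow (φ : (Y × C) × E → ℂ) (r : ℝ) :
    margE (swapCE φ) (mpow (trFst (marg (swapCE φ))) r) = trFst (mpow (marg φ) (r + 1)) := by
  have h : mpow (marg φ) (r + 1) =
      vecMat φ * (mpow (trFst (marg (swapCE φ))) r)ᵀ * (vecMat φ)ᴴ := by
    rw [← mpow_transpose (trFst_posSemidef (marg_posSemidef _)).isHermitian,
      ← vecMat_conjTranspose_mul, marg, mpow_mul_conjTranspose, add_sub_cancel_right]
  rw [h]
  ext c c'
  rw [margE_apply, trFst_apply]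
  refine Finset.sum_congr rfl fun y _ => ?_
  simp only [Matrix.mul_apply, Finset.sum_mul]
  refine Finset.sum_congr rfl fun e _ => Finset.sum_congr rfl fun e' _ => ?_
  simp only [vecMat, swapCE, Matrix.of_apply, Matrix.conjTranspose_apply, Matrix.transpose_apply]
  ring

theorem rtr_marg_swap (φ : (Y × C) × E → ℂ) : rtr (marg (swapCE φ)) = rtr (marg φ) := by
  have h := rtr_margE_mul_comm φ 1 1
  rw [Matrix.mul_one, Matrix.mul_one, ← trFst_marg, rtr_trFst] at h
  rw [← h, ← swapCE_swapCE φ, ← trFst_marg, swapCE_swapCE, rtr_trFst]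

theorem marg_swap_ne_zero {φ : (Y × C) × E → ℂ} (h : marg φ ≠ 0) : marg (swapCE φ) ≠ 0 := by
  rwa [Ne, ← rtr_eq_zero_iff (marg_posSemidef _), rtr_marg_swap, rtr_eq_zero_iff (marg_posSemidef _)]

theorem mul_mlog_self {n : Type*} [Fintype n] [DecidableEq n] {M : Matrix n n ℂ}
    (hM : M.IsHermitian) : M * mlog M = cfc (fun x : ℝ => x * Real.logb 2 x) M := by
  rw [← cfc_mul_cfc hM (fun x => x), cfc_id_eq hM]
  rfl

/-- The two marginals of a pure state have the same entropy. -/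
theorem rtr_marg_mul_mlog (φ : (Y × C) × E → ℂ) : rtr (marg φ * mlog (marg φ)) =
    rtr (trFst (marg (swapCE φ)) * mlog (trFst (marg (swapCE φ)))) := by
  have h := (trFst_posSemidef (marg_posSemidef (swapCE φ))).isHermitian
  rw [mul_mlog_self (marg_posSemidef φ).isHermitian, mul_mlog_self h, marg,
    rtr_cfc_mul_conjTranspose _ (by simp), vecMat_conjTranspose_mul, cfc_transpose _ h,
    rtr_transpose]

/-- For $a\ne1$ both traces are $\langle\phi|\rho_C^{a-1}\otimes\rho_E^{1-a}|\phi\rangle$ and the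
prefactors are opposite. At $a=1$ each side is a difference of entropies of marginals, and
complementary marginals have equal entropy. -/
theorem petzDown_duality (φ : (Y × C) × E → ℂ) {a b : ℝ} (hab : a + b = 2) :
    petzDown a (marg (swapCE φ)) + petzDown b (marg φ) = 0 := by
  by_cases ha : a = 1
  · have hb : b = 1 := by linarith
    subst ha hb
    rw [petzDown_one (marg_posSemidef _), petzDown_one (marg_posSemidef _), ← EReal.coe_add,
      rtr_marg_mul_mlog φ, rtr_marg_mul_mlog (swapCE φ), swapCE_swapCE]
    simp
  · have hb : b ≠ 1 := fun h => ha (by linarith)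
    rw [petzDown_of_ne ha (marg_posSemidef _), petzDown_of_ne hb (marg_posSemidef _),
      ← rtr_mul_one_kron, ← rtr_mul_one_kron, rtr_mpow_marg_mul, rtr_mpow_marg_mul, swapCE_swapCE,
      rtr_margE_mul_comm, ← EReal.coe_add, ← EReal.coe_zero, EReal.coe_eq_coe_iff]
    rw [swapCE_swapCE, show 1 - b = a - 1 by linarith, show b - 1 = 1 - a by linarith,
      show 1 - a = -(a - 1) by ring, one_div_neg_eq_neg_one_div]
    ring

/-- Since $(1-a)/a+1=1/a=b$, the sandwiched trace at the marginal is
$\mathrm{tr}\,(\mathrm{tr}_Y\rho_{YC}^{b})^{1/b}$, Sibson's closed form. At $a=1$ the optimum is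
located by Klein's inequality, which compares operators of equal trace; this is where normalisation
enters. -/
theorem sandDown_petzUp_duality (φ : (Y × C) × E → ℂ) (hφ : marg φ ≠ 0) {a b : ℝ} (ha : 0 < a)
    (hab : a * b = 1) (h1 : a = 1 → rtr (marg φ) = 1) :
    sandDown a (marg (swapCE φ)) + petzUp b (marg φ) = 0 := by
  by_cases ha1 : a = 1
  · have hb : b = 1 := by rw [ha1] at hab; linarith
    subst hb
    have hs : IsState (marg φ) := isState_iff.2 ⟨marg_posSemidef φ, h1 ha1⟩
    subst ha1
    rw [petzUp_one hs, sandDown_one, petzDown_duality φ (by norm_num)]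
  · have hb : b = 1 / a := by field_simp; linarith
    have hb0 : 0 < b := by rw [hb]; positivity
    have hb1 : b ≠ 1 := fun h => ha1 (by rw [h] at hab; linarith)
    have hP := trFst_posSemidef (marg_posSemidef (swapCE φ))
    rw [(petzUp_closed_form hb0 hb1 (marg_posSemidef φ) hφ).1,
      sandDown_of_ne ha1 (marg_posSemidef _), rtr_mpow_conj_marg _ _ (mpow_isHermitian _ _),
      mpow_mul_mpow hP, margE_mpow, ← EReal.coe_add, ← EReal.coe_zero, EReal.coe_eq_coe_iff]
    have e1 : (1 - a) / (2 * a) + (1 - a) / (2 * a) + 1 = b := by rw [hb]; field_simp; ring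
    have e2 : 1 / b = a := by rw [hb]; simp
    have e3 : b / (1 - b) = - (1 / (1 - a)) := by
      have h3 : 1 - a ≠ 0 := sub_ne_zero.2 (Ne.symm ha1)
      have h4 : a - 1 ≠ 0 := sub_ne_zero.2 ha1
      rw [hb]; field_simp; ring
    rw [e1, e2, e3]
    ring

end Purification

/-! ### Powers of subnormalised states as convex sets -/

section SchattenBalls

variable {n : Type*} [Fintype n] [DecidableEq n]

theorem mpow_one_right {A : Matrix n n ℂ} (hA : A.PosSemidef) {p q : ℝ} (h : p * q = 1) :
    mpow (mpow A p) q = A := by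
  rw [mpow_mpow hA, h, mpow_one hA]

/-- Monotonicity of `M ↦ tr M^b` for `0 < b < 1`. -/
theorem rtr_mpow_mono {M N : Matrix n n ℂ} (hM : M.PosSemidef) (h : (N - M).PosSemidef) {b : ℝ}
    (hb0 : 0 < b) (hb1 : b < 1) : rtr (mpow M b) ≤ rtr (mpow N b) := by
  have hN : N.PosSemidef := by simpa using h.add hM
  have hNb := mpow_posSemidef hN b
  have h1 := rtr_mpow_le_reverse_holder hM hNb
    ((suppLE_of_le hM h).trans (suppLE_self_mpow hN b)) hb0 hb1
  have h2 := rtr_mul_le_mul_right (mpow_posSemidef hNb (-((1 - b) / b))) h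
  rw [mpow_mpow hN, self_mul_mpow hN, show b * (-((1 - b) / b)) + 1 = b by field_simp; ring] at h2
  rw [mpow_mpow hN] at h1
  have h0 := rtr_nonneg hNb
  calc _ ≤ _ := h1
    _ ≤ rtr (mpow N b) ^ b * rtr (mpow N b) ^ (1 - b) := by
        gcongr
        exact rtr_mul_nonneg hM (mpow_posSemidef hN _)
    _ = _ := by rw [← Real.rpow_add_of_nonneg h0 hb0.le (by linarith)]; simp

/-- Subadditivity $(x+\delta)^b\le x^b+\delta^b$ on the eigenvalues. It bounds the cost of making an
operator positive definite. -/
theorem rtr_mpow_add_smul_one_le {M : Matrix n n ℂ} (hM : M.PosSemidef) {b δ : ℝ}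
    (hb0 : 0 < b) (hb1 : b < 1) (hδ : 0 < δ) :
    rtr (mpow (M + δ • (1 : Matrix n n ℂ)) b) ≤ rtr (mpow M b) + Fintype.card n * δ ^ b := by
  have hs : M + δ • (1 : Matrix n n ℂ) = cfc (fun x : ℝ => x + δ) M := by
    obtain ⟨U, d, hU, hU', hf', hd, h0, -⟩ := exists_diagonalization hM.isHermitian
    have e1 : δ • (1 : Matrix n n ℂ) = U * Matrix.diagonal (fun _ => (δ : ℂ)) * Uᴴ := by
      have : Matrix.diagonal (fun _ : n => (δ : ℂ)) = δ • (1 : Matrix n n ℂ) := by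
        rw [← Matrix.diagonal_one, ← Matrix.diagonal_smul]; congr 1; ext; simp
      rw [this, Matrix.mul_smul, Matrix.smul_mul, Matrix.mul_one, hU']
    rw [hf', e1]
    nth_rw 1 [hd]
    rw [← Matrix.add_mul, ← Matrix.mul_add, Matrix.diagonal_add]
    simp
  have h1 : ∀ (M : Matrix n n ℂ) (hM : M.IsHermitian) (f g : ℝ → ℝ),
      cfc f M + cfc g M = cfc (fun x => f x + g x) M := by
    intro M hM f g
    obtain ⟨U, d, hU, hU', hf', hd, h0, -⟩ := exists_diagonalization hM
    rw [hf', hf', hf', ← Matrix.add_mul, ← Matrix.mul_add, Matrix.diagonal_add]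
    simp
  have h2 : rtr (cfc (fun _ : ℝ => δ ^ b) M) = Fintype.card n * δ ^ b := by
    obtain ⟨U, d, hU, hU', hf', hd, h0, -⟩ := exists_diagonalization hM.isHermitian
    rw [hf', rtr_mul_comm, ← Matrix.mul_assoc, hU, Matrix.one_mul, rtr, Matrix.trace_diagonal]
    simp
  rw [hs, mpow_eq, cfc_cfc hM.isHermitian, ← h2, mpow_eq, ← rtr_add, h1 _ hM.isHermitian]
  have h3 : (cfc (fun x => spow b x + δ ^ b) M - cfc (fun x => spow b (x + δ)) M).PosSemidef := by
    have : cfc (fun x => spow b x + δ ^ b) M - cfc (fun x => spow b (x + δ)) M =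
        cfc (fun x => spow b x + δ ^ b - spow b (x + δ)) M := by
      rw [sub_eq_iff_eq_add, h1 _ hM.isHermitian]
      simp
    rw [this]
    refine cfc_posSemidef hM fun x hx => ?_
    rw [spow_of_ne hb0.ne', spow_of_ne hb0.ne', sub_nonneg]
    exact Real.rpow_add_le_add_rpow hx hδ.le hb0.le hb1.le
  have := rtr_nonneg h3
  rw [rtr_sub] at this
  linarith

/-- The positive part of the unit ball dual to the Schatten norm of order `a`. -/
def dualBall (n : Type*) [Fintype n] [DecidableEq n] (a : ℝ) : Set (Matrix n n ℂ) :=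
  {T | T.PosSemidef ∧ ∀ Z : Matrix n n ℂ, Z.PosSemidef → rtr (mpow Z a) ≤ 1 → rtr (T * Z) ≤ 1}

/-- The positive definite operators with expectation at least one against every positive operator
whose quasi-norm of order `b` is at least one. -/
def dualCoball (n : Type*) [Fintype n] [DecidableEq n] (b : ℝ) : Set (Matrix n n ℂ) :=
  {S | S.PosDef ∧ ∀ Z : Matrix n n ℂ, Z.PosSemidef → 1 ≤ rtr (mpow Z b) → 1 ≤ rtr (S * Z)}

theorem convex_dualBall (a : ℝ) : Convex ℝ (dualBall n a) := by
  intro S hS T hT s t hs ht hst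
  refine ⟨(hS.1.smul hs).add (hT.1.smul ht), fun Z hZ hZ1 => ?_⟩
  have h1 := hS.2 Z hZ hZ1
  have h2 := hT.2 Z hZ hZ1
  rw [Matrix.add_mul, rtr_add, Matrix.smul_mul, Matrix.smul_mul, rtr_smul, rtr_smul]
  nlinarith

theorem convex_dualCoball (b : ℝ) : Convex ℝ (dualCoball n b) := by
  rw [convex_iff_forall_pos]
  intro S hS T hT s t hs ht hst
  refine ⟨(hS.1.smul hs).add (hT.1.smul ht), fun Z hZ hZ1 => ?_⟩
  have h1 := hS.2 Z hZ hZ1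
  have h2 := hT.2 Z hZ hZ1
  rw [Matrix.add_mul, rtr_add, Matrix.smul_mul, Matrix.smul_mul, rtr_smul, rtr_smul]
  nlinarith

theorem continuous_rtr : Continuous (rtr : Matrix n n ℂ → ℝ) :=
  Complex.continuous_re.comp continuous_id.matrix_trace

theorem isClosed_dualBall (a : ℝ) : IsClosed (dualBall n a) := by
  have e : dualBall n a = {T : Matrix n n ℂ | Tᴴ = T} ∩
      (⋂ v : n → ℂ, {T : Matrix n n ℂ | 0 ≤ star v ⬝ᵥ T *ᵥ v}) ∩
      ⋂ (Z : Matrix n n ℂ) (_ : Z.PosSemidef) (_ : rtr (mpow Z a) ≤ 1),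
        {T : Matrix n n ℂ | rtr (T * Z) ≤ 1} := by
    ext T
    simp only [dualBall, Set.mem_ofPred_eq, Set.mem_inter_iff, Set.mem_iInter,
      Matrix.posSemidef_iff_dotProduct_mulVec, Matrix.IsHermitian]
  rw [e]
  refine (IsClosed.inter ?_ ?_).inter ?_
  · exact isClosed_eq continuous_id.matrix_conjTranspose continuous_id
  · refine isClosed_iInter fun v => isClosed_le continuous_const ?_
    exact continuous_const.dotProduct (continuous_id.matrix_mulVec continuous_const)
  · refine isClosed_iInter fun Z => isClosed_iInter fun _ => isClosed_iInter fun _ =>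
      isClosed_le ?_ continuous_const
    exact continuous_rtr.comp (continuous_id.matrix_mul continuous_const)

theorem norm_entry_le_rtr {T : Matrix n n ℂ} (hT : T.PosSemidef) (i j : n) :
    ‖T i j‖ ≤ rtr T := by
  obtain ⟨U, d, hU, hU', hf', hd, h0, -⟩ := exists_diagonalization hT.isHermitian
  have hent : ∀ i k, ‖U i k‖ ≤ 1 := fun i k =>
    entry_norm_bound_of_unitary (Matrix.mem_unitaryGroup_iff.2 hU') i k
  have htr : rtr T = ∑ k, d k := by
    rw [hd, rtr_mul_comm, ← Matrix.mul_assoc, hU, Matrix.one_mul, rtr, Matrix.trace_diagonal]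
    simp
  have hij : T i j = ∑ k, U i k * d k * star (U j k) := by
    conv_lhs => rw [hd]
    rw [Matrix.mul_apply]
    simp [Matrix.mul_diagonal, Matrix.conjTranspose_apply]
  rw [hij, htr]
  refine (norm_sum_le _ _).trans (Finset.sum_le_sum fun k _ => ?_)
  rw [norm_mul, norm_mul, norm_star, Complex.norm_real, Real.norm_of_nonneg (h0 hT k)]
  have h1 := hent i k
  have h2 := hent j k
  have h3 := h0 hT k
  calc ‖U i k‖ * d k * ‖U j k‖ ≤ 1 * d k * 1 := by gcongr
    _ = d k := by ring

/-- Testing against a multiple of the identity bounds the trace, and the trace of a positive matrix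
bounds all its entries. -/
theorem isCompact_dualBall {a : ℝ} (ha : a ≠ 0) : IsCompact (dualBall n a) := by
  cases isEmpty_or_nonempty n
  · exact (Set.subsingleton_of_subsingleton).isCompact
  have hcard : (0 : ℝ) < Fintype.card n := by exact_mod_cast Fintype.card_pos
  set K := (Fintype.card n : ℝ)
  obtain ⟨z, hz0, hz⟩ : ∃ z : ℝ, 0 < z ∧
      ∀ T ∈ dualBall n a, rtr T ≤ z := by
    have h1 : 0 < rtr (mpow (1 : Matrix n n ℂ) a) :=
      rtr_mpow_pos Matrix.PosSemidef.one (one_ne_zero' (Matrix n n ℂ)) a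
    set y := rtr (mpow (1 : Matrix n n ℂ) a)
    refine ⟨(y ^ (-(1 / a)))⁻¹, by positivity, fun T hT => ?_⟩
    have h2 := hT.2 (y ^ (-(1 / a)) • (1 : Matrix n n ℂ))
      (Matrix.PosSemidef.one.smul (by positivity)) (by
        rw [mpow_smul Matrix.PosSemidef.one (by positivity), rtr_smul, spow_of_pos _ (by positivity),
          ← Real.rpow_mul h1.le, neg_mul, one_div_mul_cancel ha, Real.rpow_neg_one,
          inv_mul_cancel₀ h1.ne'])
    rw [Matrix.mul_smul, Matrix.mul_one, rtr_smul] at h2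
    rw [← one_div, le_div_iff₀ (by positivity), mul_comm]
    exact h2
  have hK : IsCompact {T : Matrix n n ℂ | ∀ i j, T i j ∈ Metric.closedBall (0 : ℂ) z} := by
    have e : {T : n → n → ℂ | ∀ i j, T i j ∈ Metric.closedBall (0 : ℂ) z} = Set.pi Set.univ
        fun _ : n => Set.pi Set.univ fun _ : n => Metric.closedBall (0 : ℂ) z := by
      ext T
      simp [Set.mem_pi]
    have : IsCompact {T : n → n → ℂ | ∀ i j, T i j ∈ Metric.closedBall (0 : ℂ) z} := by
      rw [e]
      exact isCompact_univ_pi fun _ => isCompact_univ_pi fun _ => isCompact_closedBall _ _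
    exact this
  refine hK.of_isClosed_subset (isClosed_dualBall a) fun T hT i j => ?_
  rw [mem_closedBall_zero_iff]
  exact (norm_entry_le_rtr hT.1 i j).trans (hz T hT)

theorem posDef_ne_zero [Nonempty n] {M : Matrix n n ℂ} (hM : M.PosDef) : M ≠ 0 := by
  rintro rfl
  simpa using hM.trace_pos

/-- Hölder with exponents $a/(a-1)$ and $a$. With the converse `rtr_mpow_le_one_of_mem_dualBall`,
the convex set `dualBall` consists exactly of the powers $\tau^{(a-1)/a}$ of subnormalised states.
-/
theorem mpow_mem_dualBall {a : ℝ} (ha : 1 < a) {τ : Matrix n n ℂ} (hτ : τ.PosSemidef)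
    (h1 : rtr τ ≤ 1) : mpow τ ((a - 1) / a) ∈ dualBall n a := by
  have hc : 0 < (a - 1) / a := div_pos (by linarith) (by linarith)
  refine ⟨mpow_posSemidef hτ _, fun Z hZ hZ1 => ?_⟩
  have h := rtr_mul_le_holder (mpow_posSemidef hτ ((a - 1) / a)) hZ (p := a / (a - 1)) (q := a) (by
    rw [Real.holderConjugate_iff]
    have : a - 1 ≠ 0 := by linarith
    refine ⟨by rw [lt_div_iff₀ (by linarith)]; linarith, by field_simp; ring⟩)
  rw [mpow_one_right hτ (by have : a - 1 ≠ 0 := by linarith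
                            field_simp)] at h
  refine h.trans (mul_le_one₀ (Real.rpow_le_one (rtr_nonneg hτ) h1 ?_)
    (Real.rpow_nonneg (rtr_nonneg (mpow_posSemidef hZ a)) _)
    (Real.rpow_le_one (rtr_nonneg (mpow_posSemidef hZ a)) hZ1 (by positivity)))
  rw [one_div_div]; exact hc.le

/-- Reverse Hölder. Positive definiteness of `σ` keeps the negative power from being truncated to a
support. -/
theorem mpow_mem_dualCoball {b : ℝ} (hb0 : 0 < b) (hb1 : b < 1) {σ : Matrix n n ℂ}
    (hσ : σ.PosDef) (h1 : rtr σ ≤ 1) : mpow σ (-((1 - b) / b)) ∈ dualCoball n b := by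
  refine ⟨mpow_posDef hσ _, fun Z hZ hZ1 => ?_⟩
  have h := rtr_mpow_le_reverse_holder hZ hσ.posSemidef (suppLE_posDef hσ) hb0 hb1
  have h2 : rtr σ ^ (1 - b) ≤ 1 :=
    Real.rpow_le_one (rtr_nonneg hσ.posSemidef) h1 (by linarith)
  have h3 : 0 ≤ rtr (Z * mpow σ (-((1 - b) / b))) :=
    rtr_mul_nonneg hZ (mpow_posSemidef hσ.posSemidef _)
  have h4 : 1 ≤ rtr (Z * mpow σ (-((1 - b) / b))) ^ b :=
    hZ1.trans (h.trans (mul_le_of_le_one_right (by positivity) h2))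
  rw [rtr_mul_comm]
  by_contra! hlt
  exact absurd h4 (not_le.2 (Real.rpow_lt_one h3 hlt hb0))

/-- Test against the equality case of Hölder, the multiple of $T^{1/(a-1)}$ with
$\mathrm{tr}\,Z^a=1$. The result is $x^{1-1/a}\le1$. -/
theorem rtr_mpow_le_one_of_mem_dualBall {a : ℝ} (ha : 1 < a) {T : Matrix n n ℂ}
    (hT : T ∈ dualBall n a) : rtr (mpow T (a / (a - 1))) ≤ 1 := by
  have ha' : a - 1 ≠ 0 := by linarith
  have ha0 : a ≠ 0 := by linarith
  by_cases h0 : T = 0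
  · rw [h0]
    have : mpow (0 : Matrix n n ℂ) (a / (a - 1)) = 0 := by
      rw [← sub_add_cancel (a / (a - 1)) 1, ← mpow_mul_self Matrix.PosSemidef.zero,
        Matrix.mul_zero]
    rw [this, rtr_zero]
    exact zero_le_one
  set x := rtr (mpow T (a / (a - 1))) with hx
  have hx0 : 0 < x := rtr_mpow_pos hT.1 h0 _
  have h := hT.2 (x ^ (-(1 / a)) • mpow T (1 / (a - 1)))
    ((mpow_posSemidef hT.1 _).smul (by positivity)) (by
      rw [mpow_smul (mpow_posSemidef hT.1 _) (by positivity), rtr_smul, mpow_mpow hT.1,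
        spow_of_pos _ (by positivity), ← Real.rpow_mul hx0.le, neg_mul, one_div_mul_cancel ha0,
        Real.rpow_neg_one, one_div_mul_eq_div, ← hx, inv_mul_cancel₀ hx0.ne'])
  rw [Matrix.mul_smul, rtr_smul, self_mul_mpow hT.1,
    show 1 / (a - 1) + 1 = a / (a - 1) by field_simp; ring, ← hx] at h
  by_contra! hlt
  have h2 : x ^ (-(1 / a)) * x = x ^ (1 - 1 / a) := by
    nth_rw 2 [← Real.rpow_one x]
    rw [← Real.rpow_add hx0]; ring_nf
  rw [h2] at h
  refine absurd h (not_le.2 (Real.one_lt_rpow hlt ?_))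
  rw [sub_pos, div_lt_one (by linarith)]; exact ha

/-- Test against the equality case of reverse Hölder, a multiple of $S^{-1/(1-b)}$. The result is
$1\le x^{1-1/b}$ with a negative exponent. -/
theorem rtr_mpow_le_one_of_mem_dualCoball {b : ℝ} (hb0 : 0 < b) (hb1 : b < 1) {S : Matrix n n ℂ}
    (hS : S ∈ dualCoball n b) : rtr (mpow S (-(b / (1 - b)))) ≤ 1 := by
  have hb' : 1 - b ≠ 0 := by linarith
  have hSp := hS.1.posSemidef
  by_contra! hlt
  set x := rtr (mpow S (-(b / (1 - b)))) with hx
  have hx0 : 0 < x := by linarith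
  have h := hS.2 (x ^ (-(1 / b)) • mpow S (-(1 / (1 - b))))
    ((mpow_posSemidef hSp _).smul (by positivity)) (by
      rw [mpow_smul (mpow_posSemidef hSp _) (by positivity), rtr_smul, mpow_mpow hSp,
        spow_of_pos _ (by positivity), ← Real.rpow_mul hx0.le, neg_mul, one_div_mul_cancel hb0.ne',
        Real.rpow_neg_one, neg_mul, one_div_mul_eq_div, ← hx, inv_mul_cancel₀ hx0.ne'])
  rw [Matrix.mul_smul, rtr_smul, self_mul_mpow hSp,
    show -(1 / (1 - b)) + 1 = -(b / (1 - b)) by field_simp; ring, ← hx] at h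
  have h2 : x ^ (-(1 / b)) * x = x ^ (1 - 1 / b) := by
    nth_rw 2 [← Real.rpow_one x]
    rw [← Real.rpow_add hx0]; ring_nf
  rw [h2] at h
  refine absurd h (not_le.2 (Real.rpow_lt_one_of_one_lt_of_neg hlt ?_))
  rw [sub_neg, lt_div_iff₀ hb0]; linarith

end SchattenBalls

/-! ### Duality of the optimised sandwiched entropies by minimax -/

section SandwichedDuality

variable {Y C E : Type*} [Fintype Y] [DecidableEq Y] [Fintype C] [DecidableEq C]
  [Fintype E] [DecidableEq E]

/-- The kernel projection of $\rho_E$ has zero expectation in $\phi$, so its counterpart on `C` is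
zero and its pairing with any positive `S` vanishes. -/
theorem suppLE_margE {φ : (Y × C) × E → ℂ} {S : Matrix C C ℂ} (hS : S.PosSemidef) :
    SuppLE (margE φ S) (trFst (marg (swapCE φ))) := by
  rw [trFst_marg, swapCE_swapCE]
  have hP := margE_posSemidef φ (Matrix.PosSemidef.one (n := C) (R := ℂ))
  rw [suppLE_iff hP]
  have hQ : (1 - mpow (margE φ 1) 0).PosSemidef := by
    have e : 1 - mpow (margE φ 1) 0 = (1 - mpow (margE φ 1) 0) * (1 - mpow (margE φ 1) 0)ᴴ := by
      rw [Matrix.conjTranspose_sub, Matrix.conjTranspose_one, (mpow_isHermitian _ 0).eq,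
        Matrix.mul_sub, Matrix.mul_one, Matrix.sub_mul, Matrix.one_mul, mpow_mul_mpow hP,
        add_zero, sub_self, sub_zero]
    rw [e]
    exact Matrix.posSemidef_self_mul_conjTranspose _
  have h0 : margE (swapCE φ) (1 - mpow (margE φ 1) 0) = 0 := by
    rw [← rtr_eq_zero_iff (margE_posSemidef _ hQ), ← Matrix.mul_one (margE _ _),
      ← rtr_margE_mul_comm, Matrix.mul_sub, Matrix.mul_one, mul_mpow_zero hP, sub_self, rtr_zero]
  have h1 := mul_eq_zero_of_rtr_eq_zero (margE_posSemidef φ hS) hQ (by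
    rw [rtr_margE_mul_comm, h0, Matrix.zero_mul, rtr_zero])
  rw [Matrix.mul_sub, Matrix.mul_one, sub_eq_zero] at h1
  exact h1.symm

theorem margE_ne_zero {φ : (Y × C) × E → ℂ} (hφ : marg φ ≠ 0) {τ : Matrix C C ℂ}
    (hτ : τ.PosSemidef) (h : SuppLE (trFst (marg φ)) τ) (p : ℝ) : margE φ (mpow τ p) ≠ 0 := by
  have h1 := rtr_mul_mpow_pos (trFst_posSemidef (marg_posSemidef φ)) hτ
    (trFst_ne_zero (marg_posSemidef φ) hφ) h p
  rw [trFst_marg, rtr_margE_mul_comm, swapCE_swapCE, Matrix.mul_one] at h1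
  intro h0
  rw [h0, rtr_zero] at h1
  exact lt_irrefl _ h1

theorem neg_sandDiv_marg {φ : (Y × C) × E → ℂ} {b : ℝ} (hb : b ≠ 1) (hb0 : b ≠ 0)
    {τ : Matrix C C ℂ} (hτ : τ.PosSemidef) (h : SuppLE (trFst (marg φ)) τ) :
    -sandDiv b (marg φ) ((1 : Matrix Y Y ℂ) ⊗ₖ τ) =
      ((1 / (1 - b) * Real.logb 2 (rtr (mpow (margE φ (mpow τ ((1 - b) / b))) b)) : ℝ) :
        EReal) := by
  rw [sandDiv_of_ne hb (marg_posSemidef φ) hτ h, rtr_mpow_conj_marg _ _ (mpow_isHermitian _ _),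
    mpow_mul_mpow hτ, ← EReal.coe_neg, ← neg_mul, ← one_div_neg_eq_neg_one_div, neg_sub,
    show (1 - b) / (2 * b) + (1 - b) / (2 * b) = (1 - b) / b by field_simp; ring]

/-- Weak duality. -/
theorem rtr_margE_weak_duality {φ : (Y × C) × E → ℂ} {a b c : ℝ} (ha : 1 < a)
    (hb : b = a / (2 * a - 1)) (hc : c = (a - 1) / a) {σ : Matrix E E ℂ} (hσ : IsState σ)
    (hsσ : SuppLE (trFst (marg (swapCE φ))) σ) {τ : Matrix C C ℂ} (hτ : IsState τ) :
    rtr (mpow (margE φ (mpow τ c)) b) ^ (1 / b) ≤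
      rtr (mpow (margE (swapCE φ) (mpow σ (-c))) a) ^ (1 / a) := by
  have ha2 : 0 < 2 * a - 1 := by linarith
  have hb0 : 0 < b := by rw [hb]; exact div_pos (by linarith) ha2
  have hb1 : b < 1 := by rw [hb, div_lt_one ha2]; linarith
  have hcb : (1 - b) / b = c := by
    have := ha2.ne'
    rw [hb, hc, one_sub_div this, div_div_div_cancel_right₀ this]
    congr 1; ring
  have hτc := mpow_posSemidef hτ.1 c
  have hM := margE_posSemidef φ hτc
  -- The pairing $\langle\phi|\tau^c\otimes\sigma^{-c}|\phi\rangle$ is bounded below by reverse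
  -- Hölder when read on `E`, and above by Hölder (`h2`) when read on `C`.
  have h1 := rtr_mpow_le_reverse_holder hM hσ.1 ((suppLE_margE hτc).trans hsσ) hb0 hb1
  rw [hcb, (isState_iff.1 hσ).2, Real.one_rpow, mul_one, rtr_margE_mul_comm] at h1
  have hN := margE_posSemidef (swapCE φ) (mpow_posSemidef hσ.1 (-c))
  have hac : a - 1 ≠ 0 := by linarith
  have h2 := rtr_mul_le_holder hN hτc (p := a) (q := 1 / c) (by
    rw [Real.holderConjugate_iff, hc]
    refine ⟨ha, by field_simp; ring⟩)
  rw [mpow_one_right hτ.1 (mul_one_div_cancel (by rw [hc]; positivity)), (isState_iff.1 hτ).2,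
    Real.one_rpow, mul_one] at h2
  have h0 := rtr_mul_nonneg hN hτc
  calc _ ≤ (rtr (margE (swapCE φ) (mpow σ (-c)) * mpow τ c) ^ b) ^ (1 / b) :=
        Real.rpow_le_rpow (rtr_nonneg (mpow_posSemidef hM b)) h1 (by positivity)
    _ = _ := by rw [← Real.rpow_mul h0, mul_one_div_cancel hb0.ne', Real.rpow_one]
    _ ≤ _ := h2

theorem posDef_add_smul_one {n : Type*} [Fintype n] [DecidableEq n] {M : Matrix n n ℂ}
    (hM : M.PosSemidef) {δ : ℝ} (hδ : 0 < δ) : (M + δ • (1 : Matrix n n ℂ)).PosDef :=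
  Matrix.PosDef.posSemidef_add hM (Matrix.PosDef.one.smul hδ)

theorem margE_smul_sub_posSemidef {φ : (Y × C) × E → ℂ} {S T : Matrix C C ℂ}
    (h : (T - S).PosSemidef) : (margE φ T - margE φ S).PosSemidef := by
  have : margE φ T = margE φ (T - S) + margE φ S := by rw [← margE_add, sub_add_cancel]
  rw [this, add_sub_cancel_right]
  exact margE_posSemidef φ h

/-- The bound `v` for the values at positive definite states extends to the dual ball. -/
theorem rtr_mpow_margE_le_of_mem_dualBall [Nonempty C] {φ : (Y × C) × E → ℂ} {a b c v : ℝ}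
    (ha : 1 < a) (hb : b = a / (2 * a - 1)) (hc : c = (a - 1) / a)
    (hv : ∀ τ : Matrix C C ℂ, IsState τ → τ.PosDef →
      rtr (mpow (margE φ (mpow τ c)) b) ≤ v) {T : Matrix C C ℂ} (hT : T ∈ dualBall C a) :
    rtr (mpow (margE φ T) b) ≤ v := by
  have ha2 : 0 < 2 * a - 1 := by linarith
  have hb0 : 0 < b := by rw [hb]; exact div_pos (by linarith) ha2
  have hb1 : b < 1 := by rw [hb, div_lt_one ha2]; linarith
  have hc0 : 0 < c := by rw [hc]; exact div_pos (by linarith) (by linarith)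
  have hone : (1 : Matrix C C ℂ) ≠ 0 := one_ne_zero
  -- The maximally mixed state: mixing its power into `T` gives a positive definite element of the
  -- convex ball.
  set u : Matrix C C ℂ := (rtr (1 : Matrix C C ℂ))⁻¹ • 1
  have hu : IsState u := isState_normalize Matrix.PosSemidef.one hone
  have hupd : u.PosDef :=
    Matrix.PosDef.one.smul (inv_pos.2 (rtr_pos Matrix.PosSemidef.one hone))
  have hU : mpow u c ∈ dualBall C a := by
    rw [hc]; exact mpow_mem_dualBall ha hu.1 (isState_iff.1 hu).2.le
  have hs : ∀ s : ℝ, 0 < s → s < 1 → (1 - s) ^ b * rtr (mpow (margE φ T) b) ≤ v := by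
    intro s hs0 hs1
    set R := (1 - s) • T + s • mpow u c with hR
    have hRm : R ∈ dualBall C a :=
      convex_dualBall a hT hU (by linarith) hs0.le (by ring)
    have hRpd : R.PosDef :=
      Matrix.PosDef.posSemidef_add (hT.1.smul (by linarith)) ((mpow_posDef hupd c).smul hs0)
    set τ := mpow R (a / (a - 1))
    have hτpd : τ.PosDef := mpow_posDef hRpd _
    have hτ1 : rtr τ ≤ 1 := rtr_mpow_le_one_of_mem_dualBall ha hRm
    have hac : a - 1 ≠ 0 := by linarith
    have hτ0 : 0 < rtr τ :=
      rtr_mpow_pos hRpd.posSemidef (posDef_ne_zero hRpd) _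
    have hτs : IsState ((rtr τ)⁻¹ • τ) := by
      rw [isState_iff, rtr_smul, inv_mul_cancel₀ hτ0.ne']
      exact ⟨hτpd.posSemidef.smul (inv_nonneg.2 hτ0.le), rfl⟩
    have h1 := hv _ hτs (hτpd.smul (inv_pos.2 hτ0))
    have hτR : mpow τ c = R :=
      mpow_one_right hRpd.posSemidef (by rw [hc]; field_simp)
    rw [mpow_smul hτpd.posSemidef (inv_nonneg.2 hτ0.le), hτR, spow_of_pos _ (inv_pos.2 hτ0)] at h1
    -- Normalising `τ` multiplies its power `R` by $(\mathrm{tr}\,\tau)^{-c}\ge1$. The result still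
    -- dominates $(1-s)T$, and monotonicity of $\mathrm{tr}\,M^b$ transfers the bound.
    have hk : 1 ≤ (rtr τ)⁻¹ ^ c := Real.one_le_rpow ((one_le_inv₀ hτ0).2 hτ1) hc0.le
    have hle : ((rtr τ)⁻¹ ^ c • R - (1 - s) • T).PosSemidef := by
      have : (rtr τ)⁻¹ ^ c • R - (1 - s) • T = ((rtr τ)⁻¹ ^ c - 1) • R + s • mpow u c := by
        have : R - (1 - s) • T = s • mpow u c := by rw [hR, add_sub_cancel_left]
        rw [sub_smul _ 1 R, one_smul, ← this]; abel
      rw [this]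
      exact (hRpd.posSemidef.smul (by linarith)).add ((mpow_posSemidef hu.1 c).smul hs0.le)
    have h2 := rtr_mpow_mono (margE_posSemidef φ (hT.1.smul (sub_nonneg.2 hs1.le)))
      (margE_smul_sub_posSemidef hle) hb0 hb1
    rw [margE_smul φ (1 - s), mpow_smul (margE_posSemidef φ hT.1) (by linarith), rtr_smul,
      spow_of_ne hb0.ne'] at h2
    exact h2.trans h1
  have hlim : Filter.Tendsto (fun s : ℝ => (1 - s) ^ b * rtr (mpow (margE φ T) b))
      (nhdsWithin 0 (Set.Ioi 0)) (nhds ((1 - 0) ^ b * rtr (mpow (margE φ T) b))) := by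
    apply Filter.Tendsto.mono_left _ nhdsWithin_le_nhds
    apply ContinuousAt.tendsto
    have : ContinuousAt (fun s : ℝ => (1 - s) ^ b) 0 :=
      (continuousAt_const.sub continuousAt_id).rpow_const (Or.inr hb0.le)
    exact this.mul continuousAt_const
  rw [sub_zero, Real.one_rpow, one_mul] at hlim
  refine le_of_tendsto hlim ?_
  filter_upwards [Ioo_mem_nhdsGT (zero_lt_one' ℝ)] with s hs'
  exact hs s hs'.1 hs'.2

/-- Strong duality, from the minimax theorem for the bilinear form `tr (margE φ T * S)`. -/
theorem exists_rtr_margE_le [Nonempty C] [Nonempty E] {φ : (Y × C) × E → ℂ} {a b c v v' : ℝ}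
    (ha : 1 < a) (hb : b = a / (2 * a - 1)) (hc : c = (a - 1) / a)
    (hv : ∀ τ : Matrix C C ℂ, IsState τ → τ.PosDef →
      rtr (mpow (margE φ (mpow τ c)) b) ≤ v) (hvv' : v ^ (1 / b) < v') :
    ∃ σ : Matrix E E ℂ, IsState σ ∧ σ.PosDef ∧
      rtr (mpow (margE (swapCE φ) (mpow σ (-c))) a) ^ (1 / a) ≤ v' := by
  have ha2 : 0 < 2 * a - 1 := by linarith
  have ha0 : 0 < a := by linarith
  have hac : a - 1 ≠ 0 := by linarith
  have hb0 : 0 < b := by rw [hb]; exact div_pos (by linarith) ha2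
  have hb1 : b < 1 := by rw [hb, div_lt_one ha2]; linarith
  have hc0 : 0 < c := by rw [hc]; exact div_pos (by linarith) (by linarith)
  have hcb : (1 - b) / b = c := by
    have := ha2.ne'
    rw [hb, hc, one_sub_div this, div_div_div_cancel_right₀ this]
    congr 1; ring
  have hbc : b / (1 - b) = 1 / c := by rw [← hcb, one_div_div]
  have hcont1 : ∀ S : Matrix E E ℂ, Continuous fun T : Matrix C C ℂ => -rtr (margE φ T * S) := by
    intro S
    have : (fun T : Matrix C C ℂ => -rtr (margE φ T * S)) =
        fun T => -rtr (margE (swapCE φ) S * T) := by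
      ext T; rw [rtr_margE_mul_comm]
    rw [this]
    exact (continuous_rtr.comp (continuous_const.matrix_mul continuous_id)).neg
  have hcont2 : ∀ T : Matrix C C ℂ, Continuous fun S : Matrix E E ℂ => -rtr (margE φ T * S) :=
    fun T => (continuous_rtr.comp (continuous_const.matrix_mul continuous_id)).neg
  have hopen : ∀ S : Matrix E E ℂ, IsOpen {T : Matrix C C ℂ | -v' < -rtr (margE φ T * S)} :=
    fun S => isOpen_lt continuous_const (hcont1 S)
  have hzero : (0 : Matrix C C ℂ) ∈ dualBall C a :=
    ⟨Matrix.PosSemidef.zero, fun Z _ _ => by rw [Matrix.zero_mul, rtr_zero]; exact zero_le_one⟩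
  have hne : (dualBall C a).Nonempty := ⟨0, hzero⟩
  have hex : ∀ T ∈ dualBall C a, ∃ S ∈ dualCoball E b, -v' < -rtr (margE φ T * S) := by
    intro T hT
    have hM := margE_posSemidef φ hT.1
    have h1 := rtr_mpow_margE_le_of_mem_dualBall ha hb hc hv hT
    -- The strict gap between $v^{1/b}$ and `v'` pays for a shift by $\delta$, after which negative
    -- powers of the operator are true inverses.
    obtain ⟨δ, hδ0, hδ⟩ : ∃ δ : ℝ, 0 < δ ∧ (v + Fintype.card E * δ ^ b) ^ (1 / b) < v' := by
      have hlim : Filter.Tendsto (fun δ : ℝ => (v + Fintype.card E * δ ^ b) ^ (1 / b))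
          (nhdsWithin 0 (Set.Ioi 0)) (nhds ((v + Fintype.card E * (0 : ℝ) ^ b) ^ (1 / b))) := by
        apply Filter.Tendsto.mono_left _ nhdsWithin_le_nhds
        apply ContinuousAt.tendsto
        refine ContinuousAt.rpow_const ?_ (Or.inr (by positivity))
        exact continuousAt_const.add (continuousAt_const.mul
          (continuousAt_id.rpow_const (Or.inr hb0.le)))
      rw [Real.zero_rpow hb0.ne', mul_zero, add_zero] at hlim
      obtain ⟨δ, h2, h3⟩ := ((hlim.eventually (gt_mem_nhds hvv')).and self_mem_nhdsWithin).exists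
      exact ⟨δ, h3, h2⟩
    set Mδ := margE φ T + δ • (1 : Matrix E E ℂ)
    have hMδ : Mδ.PosDef := posDef_add_smul_one hM hδ0
    set y := rtr (mpow Mδ b) with hy
    have hy0 : 0 < y := rtr_mpow_pos hMδ.posSemidef (posDef_ne_zero hMδ) _
    have hy1 : y ≤ v + Fintype.card E * δ ^ b :=
      (rtr_mpow_add_smul_one_le hM hb0 hb1 hδ0).trans (by linarith)
    -- The equality case of reverse Hölder:
    -- $\mathrm{tr}\,M_\delta\sigma^{-c}=(\mathrm{tr}\,M_\delta^b)^{1/b}$.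
    set σ := y⁻¹ • mpow Mδ b with hσ
    have hσpd : σ.PosDef := (mpow_posDef hMδ b).smul (inv_pos.2 hy0)
    refine ⟨mpow σ (-c), ?_, ?_⟩
    · rw [← hcb]
      refine mpow_mem_dualCoball hb0 hb1 hσpd ?_
      rw [hσ, rtr_smul, ← hy, inv_mul_cancel₀ hy0.ne']
    · have h2 : rtr (margE φ T * mpow σ (-c)) ≤ rtr (Mδ * mpow σ (-c)) := by
        apply rtr_mul_le_mul_right (mpow_posSemidef hσpd.posSemidef _)
        simp only [Mδ, add_sub_cancel_left]
        exact Matrix.PosSemidef.one.smul hδ0.le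
      have h3 : rtr (Mδ * mpow σ (-c)) = y ^ (1 / b) := by
        rw [hσ, mpow_smul (mpow_posSemidef hMδ.posSemidef b) (inv_nonneg.2 hy0.le), Matrix.mul_smul,
          rtr_smul, mpow_mpow hMδ.posSemidef, self_mul_mpow hMδ.posSemidef,
          show b * -c + 1 = b by rw [← hcb]; field_simp; ring, ← hy, spow_of_pos _ (inv_pos.2 hy0),
          Real.inv_rpow hy0.le, ← Real.rpow_neg hy0.le, neg_neg]
        nth_rw 2 [← Real.rpow_one y]
        rw [← Real.rpow_add hy0, ← hcb]
        congr 1; field_simp; ring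
      have h4 : y ^ (1 / b) ≤ (v + Fintype.card E * δ ^ b) ^ (1 / b) :=
        Real.rpow_le_rpow hy0.le hy1 (by positivity)
      linarith
  -- Compactness of the ball reduces the pointwise choices to finitely many `S`, the input of the
  -- finite form of Sion's theorem.
  obtain ⟨s, hsY, hs⟩ : ∃ s : Finset (Matrix E E ℂ), ↑s ⊆ dualCoball E b ∧
      ∀ T ∈ dualBall C a, ∃ S ∈ (s : Set (Matrix E E ℂ)), -v' < -rtr (margE φ T * S) := by
    choose! f hf hf' using hex
    obtain ⟨t, ht⟩ := (isCompact_dualBall ha0.ne').elim_finite_subcover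
      (fun T : dualBall C a => {T' : Matrix C C ℂ | -v' < -rtr (margE φ T' * f T.1)})
      (fun T => hopen _) (fun T hT => Set.mem_iUnion.2 ⟨⟨T, hT⟩, hf' T hT⟩)
    classical
    refine ⟨t.image fun T => f T.1, ?_, fun T hT => ?_⟩
    · intro S hS
      simp only [Finset.coe_image, Set.mem_image] at hS
      obtain ⟨T, -, rfl⟩ := hS
      exact hf T.1 T.2
    · obtain ⟨T', hT', h⟩ := Set.mem_iUnion₂.1 (ht hT)
      exact ⟨f T'.1, Finset.mem_coe.2 (Finset.mem_image_of_mem _ hT'), h⟩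
  have hlin1 : ∀ S : Matrix E E ℂ, IsLinearMap ℝ fun T : Matrix C C ℂ => -rtr (margE φ T * S) :=
    fun S => ⟨fun T T' => by rw [margE_add, Matrix.add_mul, rtr_add]; ring,
      fun r T => by rw [margE_smul, Matrix.smul_mul, rtr_smul, smul_eq_mul]; ring⟩
  have hlin2 : ∀ T : Matrix C C ℂ, IsLinearMap ℝ fun S : Matrix E E ℂ => -rtr (margE φ T * S) :=
    fun T => ⟨fun S S' => by rw [Matrix.mul_add, rtr_add]; ring,
      fun r S => by rw [Matrix.mul_smul, rtr_smul, smul_eq_mul]; ring⟩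
  -- The pairing carries a minus sign because the theorem yields a single `S` keeping the function
  -- above a level for all `T`, whereas the pairing must stay below `v'`.
  obtain ⟨S, hS, hST⟩ := Sion.exists_lt_iInf_of_lt_iInf_of_finite
    (X := dualBall C a) (Y := dualCoball E b) (f := fun T S => -rtr (margE φ T * S)) hne
    (isCompact_dualBall ha0.ne') (fun S _ => (hcont1 S).lowerSemicontinuous.lowerSemicontinuousOn _)
    (fun S _ => (((hlin1 S).mk' _).convexOn (convex_dualBall a)).quasiconvexOn)
    (convex_dualCoball b)
    (fun T _ => (hcont2 T).upperSemicontinuous.upperSemicontinuousOn _)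
    (fun T _ => (((hlin2 T).mk' _).concaveOn (convex_dualCoball b)).quasiconcaveOn)
    (convex_dualBall a) s.finite_toSet hsY hs
  have hSp := hS.1.posSemidef
  set σ := mpow S (-(b / (1 - b))) with hσ
  have hσpd : σ.PosDef := mpow_posDef hS.1 _
  have hσ1 : rtr σ ≤ 1 := rtr_mpow_le_one_of_mem_dualCoball hb0 hb1 hS
  have hσ0 : 0 < rtr σ := rtr_pos hσpd.posSemidef (posDef_ne_zero hσpd)
  refine ⟨(rtr σ)⁻¹ • σ, ?_, hσpd.smul (inv_pos.2 hσ0), ?_⟩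
  · rw [isState_iff, rtr_smul, inv_mul_cancel₀ hσ0.ne']
    exact ⟨hσpd.posSemidef.smul (inv_nonneg.2 hσ0.le), rfl⟩
  have hσS : mpow σ (-c) = S := mpow_one_right hSp (by rw [hbc]; field_simp)
  have hM := margE_posSemidef (swapCE φ) hSp
  have hN0 := rtr_nonneg (mpow_posSemidef hM a)
  have hv'0 : 0 < v' := by
    have := hST 0 hzero
    rw [show margE φ 0 = 0 by simpa using margE_smul φ 0 0, Matrix.zero_mul, rtr_zero] at this
    linarith
  have hle : rtr (mpow (margE (swapCE φ) S) a) ^ (1 / a) ≤ v' := by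
    set M := margE (swapCE φ) S
    set N := rtr (mpow M a) with hN
    rcases hN0.eq_or_lt with h0 | h0
    · rw [← h0, Real.zero_rpow (by positivity)]; exact hv'0.le
    -- The equality case of Hölder: at this `T` the pairing equals the Schatten norm of order `a`.
    have hT : mpow (N⁻¹ • mpow M a) c ∈ dualBall C a := by
      rw [hc]
      refine mpow_mem_dualBall ha ((mpow_posSemidef hM a).smul (inv_nonneg.2 h0.le)) ?_
      rw [rtr_smul, ← hN, inv_mul_cancel₀ h0.ne']
    have h1 := hST _ hT
    rw [rtr_margE_mul_comm, mpow_smul (mpow_posSemidef hM a) (inv_nonneg.2 h0.le), Matrix.mul_smul,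
      rtr_smul, mpow_mpow hM, self_mul_mpow hM, show a * c + 1 = a by rw [hc]; field_simp; ring,
      ← hN, spow_of_pos _ (inv_pos.2 h0), Real.inv_rpow h0.le, ← Real.rpow_neg h0.le] at h1
    have h2 : N ^ (-c) * N = N ^ (1 / a) := by
      nth_rw 2 [← Real.rpow_one N]
      rw [← Real.rpow_add h0, hc]
      congr 1; field_simp; ring
    rw [h2] at h1
    linarith
  -- Normalising `σ` multiplies $\sigma^{-c}$ by $(\mathrm{tr}\,\sigma)^{c}\le1$, which can only
  -- lower the norm.
  refine le_trans ?_ hle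
  rw [mpow_smul hσpd.posSemidef (inv_nonneg.2 hσ0.le), hσS, margE_smul,
    mpow_smul hM (spow_nonneg _ (inv_nonneg.2 hσ0.le)), rtr_smul]
  refine Real.rpow_le_rpow (mul_nonneg (spow_nonneg _ (spow_nonneg _ (inv_nonneg.2 hσ0.le))) hN0)
    (mul_le_of_le_one_left hN0 ?_) (by positivity)
  rw [spow_of_pos _ (inv_pos.2 hσ0), spow_of_ne ha0.ne', Real.inv_rpow hσ0.le,
    ← Real.rpow_neg hσ0.le, neg_neg]
  exact Real.rpow_le_one (by positivity) (Real.rpow_le_one hσ0.le hσ1 hc0.le) ha0.le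

/-- The value at order `a` is $-\frac1c\log\inf_\sigma\sup_\tau$ of the pairing and the value at
order `b` is $\frac1c\log\sup_\tau\inf_\sigma$, so duality is a minimax equality. The real witness
`r` records that both are finite. -/
theorem sandUp_duality_of_one_lt {φ : (Y × C) × E → ℂ} (hφ : marg φ ≠ 0) {a b : ℝ} (ha : 1 < a)
    (hb : b = a / (2 * a - 1)) :
    ∃ r : ℝ, sandUp a (marg (swapCE φ)) = r ∧ sandUp b (marg φ) = ((-r : ℝ) : EReal) := by
  have ha2 : 0 < 2 * a - 1 := by linarith
  have ha0 : 0 < a := by linarith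
  have hb0 : 0 < b := by rw [hb]; exact div_pos ha0 ha2
  have hb1 : b < 1 := by rw [hb, div_lt_one ha2]; linarith
  obtain ⟨c, hc⟩ : ∃ c, c = (a - 1) / a := ⟨_, rfl⟩
  have hc0 : 0 < c := by rw [hc]; exact div_pos (by linarith) ha0
  have hcb : (1 - b) / b = c := by
    have := ha2.ne'
    rw [hb, hc, one_sub_div this, div_div_div_cancel_right₀ this]
    congr 1; ring
  have hca : (1 - a) / a = -c := by rw [hc, ← neg_div, neg_sub]
  have hφ' := marg_swap_ne_zero hφ
  have hP := marg_posSemidef φ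
  have hP' := marg_posSemidef (swapCE φ)
  have hneC := trFst_ne_zero hP hφ
  have hneE := trFst_ne_zero hP' hφ'
  have : Nonempty C := by
    by_contra h
    rw [not_nonempty_iff] at h
    exact hneC (Subsingleton.elim _ _)
  have : Nonempty E := by
    by_contra h
    rw [not_nonempty_iff] at h
    exact hneE (Subsingleton.elim _ _)
  set NA : Matrix E E ℂ → ℝ := fun σ => rtr (mpow (margE (swapCE φ) (mpow σ (-c))) a) with hNA
  set NB : Matrix C C ℂ → ℝ := fun τ => rtr (mpow (margE φ (mpow τ c)) b) with hNB
  have valA : ∀ σ : Matrix E E ℂ, IsState σ → SuppLE (trFst (marg (swapCE φ))) σ →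
      0 < NA σ ∧ -sandDiv a (marg (swapCE φ)) ((1 : Matrix Y Y ℂ) ⊗ₖ σ) =
        ((-(1 / c * Real.logb 2 (NA σ ^ (1 / a))) : ℝ) : EReal) := by
    intro σ hσ hs
    have hpos : 0 < NA σ := rtr_mpow_pos (margE_posSemidef _ (mpow_posSemidef hσ.1 _))
      (margE_ne_zero hφ' hσ.1 hs _) _
    refine ⟨hpos, ?_⟩
    rw [neg_sandDiv_marg ha.ne' ha0.ne' hσ.1 hs, hca, Real.logb_rpow_eq_mul_logb_of_pos hpos, hNA]
    congr 1
    have h1 : 1 - a ≠ 0 := by linarith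
    have h2 : a - 1 ≠ 0 := by linarith
    rw [hc]
    field_simp
    ring
  have valB : ∀ τ : Matrix C C ℂ, IsState τ → SuppLE (trFst (marg φ)) τ →
      0 < NB τ ∧ -sandDiv b (marg φ) ((1 : Matrix Y Y ℂ) ⊗ₖ τ) =
        ((1 / c * Real.logb 2 (NB τ ^ (1 / b)) : ℝ) : EReal) := by
    intro τ hτ hs
    have hpos : 0 < NB τ := rtr_mpow_pos (margE_posSemidef _ (mpow_posSemidef hτ.1 _))
      (margE_ne_zero hφ hτ.1 hs _) _
    refine ⟨hpos, ?_⟩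
    rw [neg_sandDiv_marg hb1.ne hb0.ne' hτ.1 hs, hcb, Real.logb_rpow_eq_mul_logb_of_pos hpos, hNB]
    congr 1
    have h1 : 1 - b ≠ 0 := by linarith
    rw [← hcb]
    field_simp
  set A := sandUp a (marg (swapCE φ)) with hA
  set B := sandUp b (marg φ) with hB
  obtain ⟨a0, ha0A⟩ : ∃ r : ℝ, (r : EReal) ≤ A := by
    have hs : SuppLE (trFst (marg (swapCE φ)))
        ((rtr (trFst (marg (swapCE φ))))⁻¹ • trFst (marg (swapCE φ))) :=
      suppLE_smul _ (inv_ne_zero (rtr_pos (trFst_posSemidef hP') hneE).ne')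
    have hst := isState_normalize (trFst_posSemidef hP') hneE
    exact ⟨_, (valA _ hst hs).2.symm.le.trans (le_iSup₂_of_le _ hst le_rfl)⟩
  obtain ⟨b0, hb0B⟩ : ∃ r : ℝ, (r : EReal) ≤ B := by
    have hs : SuppLE (trFst (marg φ)) ((rtr (trFst (marg φ)))⁻¹ • trFst (marg φ)) :=
      suppLE_smul _ (inv_ne_zero (rtr_pos (trFst_posSemidef hP) hneC).ne')
    have hst := isState_normalize (trFst_posSemidef hP) hneC
    exact ⟨_, (valB _ hst hs).2.symm.le.trans (le_iSup₂_of_le _ hst le_rfl)⟩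
  have hweak : B ≤ -A := by
    refine iSup₂_le fun τ hτ => ?_
    by_cases hsτ : SuppLE (trFst (marg φ)) τ
    swap
    · rw [sandDiv_of_not hP hτ.1 hsτ]; simp
    rw [EReal.le_neg]
    refine iSup₂_le fun σ hσ => ?_
    by_cases hsσ : SuppLE (trFst (marg (swapCE φ))) σ
    swap
    · rw [sandDiv_of_not hP' hσ.1 hsσ]; simp
    obtain ⟨h1, h2⟩ := valA σ hσ hsσ
    obtain ⟨h3, h4⟩ := valB τ hτ hsτ
    rw [h2, h4, ← EReal.coe_neg, EReal.coe_le_coe_iff, neg_le_neg_iff]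
    gcongr
    · exact one_lt_two
    · exact rtr_margE_weak_duality ha hb hc hσ hsσ hτ
  -- For $B<r_0<r$, the level $v^{1/b}=2^{cr_0}$ bounds all values at positive definite states, and
  -- $v'=2^{cr}$ provides the strict gap for the minimax lemma.
  have hstrong : -A ≤ B := by
    refine EReal.le_of_forall_lt_iff_le.1 fun r hr => ?_
    obtain ⟨r0, h1, h2⟩ := EReal.lt_iff_exists_real_btwn.1 hr
    rw [EReal.coe_lt_coe_iff] at h2
    obtain ⟨σ, hσ, hσpd, hle⟩ := exists_rtr_margE_le (φ := φ) (v := ((2 : ℝ) ^ (c * r0)) ^ b)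
      (v' := (2 : ℝ) ^ (c * r)) ha hb hc (by
        intro τ hτ hτpd
        obtain ⟨h3, h4⟩ := valB τ hτ (suppLE_posDef hτpd)
        have h5 : ((1 / c * Real.logb 2 (NB τ ^ (1 / b)) : ℝ) : EReal) ≤ r0 := by
          rw [← h4]
          exact (le_iSup₂_of_le (f := fun (σ : Matrix C C ℂ) (_ : IsState σ) =>
            -sandDiv b (marg φ) ((1 : Matrix Y Y ℂ) ⊗ₖ σ)) τ hτ le_rfl).trans h1.le
        rw [EReal.coe_le_coe_iff, one_div_mul_eq_div, div_le_iff₀ hc0, mul_comm,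
          Real.logb_le_iff_le_rpow one_lt_two (by positivity)] at h5
        have := Real.rpow_le_rpow (by positivity) h5 hb0.le
        rwa [← Real.rpow_mul h3.le, one_div_mul_cancel hb0.ne', Real.rpow_one] at this) (by
        rw [← Real.rpow_mul (by positivity), mul_one_div_cancel hb0.ne', Real.rpow_one]
        exact Real.rpow_lt_rpow_of_exponent_lt one_lt_two (by gcongr))
    obtain ⟨h3, h4⟩ := valA σ hσ (suppLE_posDef hσpd)
    rw [EReal.neg_le]
    refine le_trans ?_ (le_iSup₂_of_le σ hσ le_rfl)
    rw [h4, ← EReal.coe_neg, EReal.coe_le_coe_iff, neg_le_neg_iff, one_div_mul_eq_div,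
      div_le_iff₀ hc0, mul_comm, Real.logb_le_iff_le_rpow one_lt_two (by positivity)]
    exact hle
  have heq : B = -A := le_antisymm hweak hstrong
  induction hAr : A using EReal.rec with
  | bot => rw [hAr] at ha0A; simp at ha0A
  | top => rw [heq, hAr] at hb0B; simp at hb0B
  | coe r => exact ⟨r, rfl, by rw [heq, hAr, EReal.coe_neg]⟩

/-- Away from $a=b=1$ exactly one order exceeds one; for $a<1$ the parties `C` and `E` are
exchanged. -/
theorem sandUp_duality {φ : (Y × C) × E → ℂ} (hφ : marg φ ≠ 0) {a b : ℝ} (ha : 1 / 2 ≤ a)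
    (hb : 1 / 2 ≤ b) (hab : 1 / a + 1 / b = 2) (h1 : a = 1 → rtr (marg φ) = 1) :
    sandUp a (marg (swapCE φ)) + sandUp b (marg φ) = 0 := by
  have ha0 : 0 < a := by linarith
  have hb0 : 0 < b := by linarith
  have hmul : a + b = 2 * a * b := by field_simp at hab; linarith
  rcases lt_trichotomy a 1 with hlt | rfl | hgt
  · have hb1 : 1 < b := by
      have h2 : 1 < 1 / a := by rw [lt_div_iff₀ ha0]; linarith
      have h3 : 1 / b < 1 := by linarith
      rwa [div_lt_one hb0] at h3
    obtain ⟨r, h2, h3⟩ := sandUp_duality_of_one_lt (marg_swap_ne_zero hφ) hb1 (b := a) (by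
      rw [eq_div_iff (by linarith)]; linarith)
    rw [swapCE_swapCE] at h2
    rw [h2, h3, ← EReal.coe_add]
    simp
  · have hb1 : b = 1 := by linarith
    have hs : IsState (marg φ) := isState_iff.2 ⟨marg_posSemidef φ, h1 rfl⟩
    have hs' : IsState (marg (swapCE φ)) :=
      isState_iff.2 ⟨marg_posSemidef _, by rw [rtr_marg_swap, h1 rfl]⟩
    rw [hb1, sandUp_one, sandUp_one, petzUp_one hs, petzUp_one hs', petzDown_duality φ (by norm_num)]
  · obtain ⟨r, h2, h3⟩ := sandUp_duality_of_one_lt hφ hgt (b := b) (by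
      rw [eq_div_iff (by linarith)]; linarith)
    rw [h2, h3, ← EReal.coe_add]
    simp

end SandwichedDuality

/-! ### Tensor powers and additivity -/

section TensorPowers

variable {I J : Type*} [Fintype I] [DecidableEq I] [Fintype J] [DecidableEq J]

/-- The `k`-fold tensor power of a matrix. -/
def piPow (k : ℕ) (M : Matrix I J ℂ) : Matrix (Fin k → I) (Fin k → J) ℂ :=
  Matrix.of fun i j => ∏ t, M (i t) (j t)

theorem piPow_mul {K : Type*} [Fintype K] [DecidableEq K] (k : ℕ) (M : Matrix I J ℂ)
    (N : Matrix J K ℂ) : piPow k (M * N) = piPow k M * piPow k N := by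
  ext i j
  rw [Matrix.mul_apply]
  simp only [piPow, Matrix.of_apply, Matrix.mul_apply]
  rw [Finset.prod_univ_sum, Fintype.piFinset_univ]
  exact Finset.sum_congr rfl fun l _ => Finset.prod_mul_distrib

theorem piPow_conjTranspose (k : ℕ) (M : Matrix I J ℂ) : piPow k Mᴴ = (piPow k M)ᴴ := by
  ext i j
  simp [piPow, Matrix.conjTranspose_apply]

theorem piPow_diagonal (k : ℕ) (d : I → ℂ) :
    piPow k (Matrix.diagonal d) = Matrix.diagonal fun i => ∏ t, d (i t) := by
  ext i j
  rw [Matrix.diagonal_apply]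
  simp only [piPow, Matrix.of_apply, Matrix.diagonal_apply]
  split_ifs with h
  · simp [h]
  · obtain ⟨t, ht⟩ := Function.ne_iff.1 h
    exact Finset.prod_eq_zero (Finset.mem_univ t) (if_neg ht)

theorem piPow_one (k : ℕ) : piPow k (1 : Matrix I I ℂ) = 1 := by
  rw [← Matrix.diagonal_one, piPow_diagonal]
  simp

theorem trace_piPow (k : ℕ) (M : Matrix I I ℂ) : (piPow k M).trace = M.trace ^ k := by
  rw [Matrix.trace, Matrix.trace, ← Fin.prod_const, Finset.prod_univ_sum, Fintype.piFinset_univ]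
  rfl

/-- A tensor power of a diagonalisation is a diagonalisation, and `spow` is multiplicative on
nonnegative reals, zero included. -/
theorem mpow_piPow (k : ℕ) {M : Matrix I I ℂ} (hM : M.PosSemidef) (p : ℝ) :
    mpow (piPow k M) p = piPow k (mpow M p) := by
  obtain ⟨U, d, hU, hU', hf', hd, h0, -⟩ := exists_diagonalization hM.isHermitian
  have hiso : (piPow k U)ᴴ * piPow k U = 1 := by
    rw [← piPow_conjTranspose, ← piPow_mul, hU, piPow_one]
  have e : ∀ d : I → ℝ, piPow k (U * Matrix.diagonal (fun i => (d i : ℂ)) * Uᴴ) =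
      piPow k U * Matrix.diagonal (fun i => ((∏ t, d (i t) : ℝ) : ℂ)) * (piPow k U)ᴴ := by
    intro d
    rw [piPow_mul, piPow_mul, piPow_diagonal, piPow_conjTranspose]
    simp
  have e2 : mpow M p = U * Matrix.diagonal (fun i => ((spow p (d i) : ℝ) : ℂ)) * Uᴴ := hf' _
  rw [e2, e]
  nth_rw 1 [hd]
  rw [e, mpow_conj_isometry hiso (isHermitian_diagonal_ofReal _), mpow_diagonal]
  congr 3
  ext i
  congr 1
  induction (Finset.univ : Finset (Fin k)) using Finset.induction_on with
  | empty => simp [spow]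
  | insert t s ht ih =>
    rw [Finset.prod_insert ht, Finset.prod_insert ht,
      mul_spow p (h0 hM _) (Finset.prod_nonneg fun _ _ => h0 hM _), ih]

theorem piPow_posSemidef (k : ℕ) {M : Matrix I I ℂ} (hM : M.PosSemidef) :
    (piPow k M).PosSemidef := by
  have : M = mpow M (1 / 2) * (mpow M (1 / 2))ᴴ := by
    rw [(mpow_isHermitian M _).eq, mpow_half_mul_self hM]
  rw [this, piPow_mul, piPow_conjTranspose]
  exact Matrix.posSemidef_self_mul_conjTranspose _

theorem rtr_piPow (k : ℕ) {M : Matrix I I ℂ} (hM : M.PosSemidef) :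
    rtr (piPow k M) = rtr M ^ k := by
  rw [rtr, trace_piPow, trace_eq_rtr hM, ← Complex.ofReal_pow, Complex.ofReal_re]

/-- The trace of a product of two positive operators is real, so taking real parts commutes with the
`k`-th power. -/
theorem rtr_piPow_mul (k : ℕ) {M N : Matrix I I ℂ} (hM : M.PosSemidef) (hN : N.PosSemidef) :
    rtr (piPow k (M * N)) = rtr (M * N) ^ k := by
  have h : (M * N).trace = (mpow N (1 / 2) * M * (mpow N (1 / 2))ᴴ).trace := by
    conv_lhs => rw [← mpow_half_mul_self hN]
    rw [(mpow_isHermitian N _).eq, ← Matrix.mul_assoc, Matrix.trace_mul_comm, Matrix.mul_assoc]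
  have h2 := trace_eq_rtr (hM.mul_mul_conjTranspose_same (mpow N (1 / 2)))
  rw [rtr, rtr, trace_piPow, h, h2, ← Complex.ofReal_pow, Complex.ofReal_re, Complex.ofReal_re]

variable {X S : Type*} [Fintype X] [DecidableEq X] [Fintype S] [DecidableEq S]

/-- Regrouping a tuple of pairs. -/
def pairEquiv (X S : Type*) (k : ℕ) : (Fin k → X) × (Fin k → S) ≃ (Fin k → X × S) :=
  (Equiv.arrowProdEquivProdArrow (Fin k) (fun _ => X) (fun _ => S)).symm

theorem iidPow_eq (k : ℕ) (ρ : Matrix (X × S) (X × S) ℂ) :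
    iidPow k ρ = (piPow k ρ).submatrix (pairEquiv X S k) (pairEquiv X S k) := rfl

theorem iidPow_mul (k : ℕ) (ρ τ : Matrix (X × S) (X × S) ℂ) :
    iidPow k (ρ * τ) = iidPow k ρ * iidPow k τ := by
  rw [iidPow_eq, iidPow_eq, iidPow_eq, Matrix.submatrix_mul_equiv, piPow_mul]

theorem iidPow_posSemidef (k : ℕ) {ρ : Matrix (X × S) (X × S) ℂ} (hρ : ρ.PosSemidef) :
    (iidPow k ρ).PosSemidef := (piPow_posSemidef k hρ).submatrix _

theorem rtr_iidPow (k : ℕ) {ρ : Matrix (X × S) (X × S) ℂ} (hρ : ρ.PosSemidef) :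
    rtr (iidPow k ρ) = rtr ρ ^ k := by
  rw [iidPow_eq, rtr_submatrix_equiv, rtr_piPow k hρ]

theorem mpow_iidPow (k : ℕ) {ρ : Matrix (X × S) (X × S) ℂ} (hρ : ρ.PosSemidef) (p : ℝ) :
    mpow (iidPow k ρ) p = iidPow k (mpow ρ p) := by
  rw [iidPow_eq, mpow_submatrix_equiv (piPow_posSemidef k hρ).isHermitian, mpow_piPow k hρ]
  rfl

theorem iidPow_one_kron (k : ℕ) (σ : Matrix S S ℂ) :
    iidPow k ((1 : Matrix X X ℂ) ⊗ₖ σ) = (1 : Matrix (Fin k → X) (Fin k → X) ℂ) ⊗ₖ piPow k σ := by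
  rw [← piPow_one]
  ext i j
  exact Finset.prod_mul_distrib

theorem trFst_iidPow (k : ℕ) (ρ : Matrix (X × S) (X × S) ℂ) :
    trFst (iidPow k ρ) = piPow k (trFst ρ) := by
  ext i j
  change _ = ∏ t, ∑ x, ρ (x, i t) (x, j t)
  rw [Finset.prod_univ_sum, Fintype.piFinset_univ]
  rfl

theorem isState_piPow (k : ℕ) {σ : Matrix S S ℂ} (hσ : IsState σ) : IsState (piPow k σ) := by
  rw [isState_iff] at hσ ⊢
  exact ⟨piPow_posSemidef k hσ.1, by rw [rtr_piPow k hσ.1, hσ.2, one_pow]⟩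

theorem isState_iidPow (k : ℕ) {ρ : Matrix (X × S) (X × S) ℂ} (hρ : IsState ρ) :
    IsState (iidPow k ρ) := by
  rw [isState_iff] at hρ ⊢
  exact ⟨iidPow_posSemidef k hρ.1, by rw [rtr_iidPow k hρ.1, hρ.2, one_pow]⟩

theorem iidPow_ne_zero (k : ℕ) {ρ : Matrix (X × S) (X × S) ℂ} (hρ : ρ.PosSemidef) (h : ρ ≠ 0) :
    iidPow k ρ ≠ 0 := by
  rw [Ne, ← rtr_eq_zero_iff (iidPow_posSemidef k hρ), rtr_iidPow k hρ]
  exact pow_ne_zero _ (rtr_pos hρ h).ne'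

theorem petzDown_iidPow (k : ℕ) {a : ℝ} (ha : a ≠ 1) {ρ : Matrix (X × S) (X × S) ℂ}
    (hρ : ρ.PosSemidef) : petzDown a (iidPow k ρ) = ((k : ℝ) : EReal) * petzDown a ρ := by
  have h1 := trFst_posSemidef (mpow_posSemidef hρ a)
  have h2 := mpow_posSemidef (trFst_posSemidef hρ) (1 - a)
  rw [petzDown_of_ne ha hρ, petzDown_of_ne ha (iidPow_posSemidef k hρ), mpow_iidPow k hρ,
    trFst_iidPow, trFst_iidPow, mpow_piPow k (trFst_posSemidef hρ), ← piPow_mul,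
    rtr_piPow_mul k h1 h2, Real.logb_pow, ← EReal.coe_mul]
  congr 1; ring

theorem conj_one_kron_posSemidef {ρ : Matrix (X × S) (X × S) ℂ} (hρ : ρ.PosSemidef)
    {s : Matrix S S ℂ} (hs : s.IsHermitian) :
    (((1 : Matrix X X ℂ) ⊗ₖ s) * ρ * ((1 : Matrix X X ℂ) ⊗ₖ s)).PosSemidef := by
  have := hρ.mul_mul_conjTranspose_same ((1 : Matrix X X ℂ) ⊗ₖ s)
  rwa [Matrix.conjTranspose_kronecker, hs.eq, Matrix.conjTranspose_one] at this

theorem rtr_mpow_conj_iidPow (k : ℕ) {ρ : Matrix (X × S) (X × S) ℂ} (hρ : ρ.PosSemidef)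
    {s : Matrix S S ℂ} (hs : s.IsHermitian) (a : ℝ) :
    rtr (mpow (((1 : Matrix (Fin k → X) (Fin k → X) ℂ) ⊗ₖ piPow k s) * iidPow k ρ *
      ((1 : Matrix (Fin k → X) (Fin k → X) ℂ) ⊗ₖ piPow k s)) a) =
    rtr (mpow (((1 : Matrix X X ℂ) ⊗ₖ s) * ρ * ((1 : Matrix X X ℂ) ⊗ₖ s)) a) ^ k := by
  have h := conj_one_kron_posSemidef hρ hs
  rw [← iidPow_one_kron, ← iidPow_mul, ← iidPow_mul, mpow_iidPow k h,
    rtr_iidPow k (mpow_posSemidef h a)]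

theorem sandDown_iidPow (k : ℕ) {a : ℝ} (ha : a ≠ 1) {ρ : Matrix (X × S) (X × S) ℂ}
    (hρ : ρ.PosSemidef) : sandDown a (iidPow k ρ) = ((k : ℝ) : EReal) * sandDown a ρ := by
  rw [sandDown_of_ne ha hρ, sandDown_of_ne ha (iidPow_posSemidef k hρ), trFst_iidPow,
    mpow_piPow k (trFst_posSemidef hρ), rtr_mpow_conj_iidPow k hρ (mpow_isHermitian _ _),
    Real.logb_pow, ← EReal.coe_mul]
  congr 1; ring

theorem petzUp_iidPow (k : ℕ) {a : ℝ} (ha0 : 0 < a) (ha : a ≠ 1) {ρ : Matrix (X × S) (X × S) ℂ}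
    (hρ : ρ.PosSemidef) (hne : ρ ≠ 0) :
    petzUp a (iidPow k ρ) = ((k : ℝ) : EReal) * petzUp a ρ := by
  have h1 := trFst_posSemidef (mpow_posSemidef hρ a)
  rw [(petzUp_closed_form ha0 ha hρ hne).1,
    (petzUp_closed_form ha0 ha (iidPow_posSemidef k hρ) (iidPow_ne_zero k hρ hne)).1,
    mpow_iidPow k hρ, trFst_iidPow, mpow_piPow k h1, rtr_piPow k (mpow_posSemidef h1 _),
    Real.logb_pow, ← EReal.coe_mul]
  congr 1; ring

theorem suppLE_piPow (k : ℕ) {ρ σ : Matrix S S ℂ} (hσ : σ.PosSemidef) (h : SuppLE ρ σ) :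
    SuppLE (piPow k ρ) (piPow k σ) := by
  rw [suppLE_iff hσ] at h
  rw [suppLE_iff (piPow_posSemidef k hσ), mpow_piPow k hσ, ← piPow_mul, h]

theorem neg_sandDiv_iidPow (k : ℕ) {a : ℝ} (ha : a ≠ 1) {ρ : Matrix (X × S) (X × S) ℂ}
    (hρ : ρ.PosSemidef) {σ : Matrix S S ℂ} (hσ : σ.PosSemidef) (h : SuppLE (trFst ρ) σ) :
    -sandDiv a (iidPow k ρ) ((1 : Matrix (Fin k → X) (Fin k → X) ℂ) ⊗ₖ piPow k σ) =
      ((k : ℝ) : EReal) * -sandDiv a ρ ((1 : Matrix X X ℂ) ⊗ₖ σ) := by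
  rw [sandDiv_of_ne ha hρ hσ h, sandDiv_of_ne ha (iidPow_posSemidef k hρ) (piPow_posSemidef k hσ)
    (by rw [trFst_iidPow]; exact suppLE_piPow k hσ h), mpow_piPow k hσ,
    rtr_mpow_conj_iidPow k hρ (mpow_isHermitian _ _), Real.logb_pow, ← EReal.coe_neg,
    ← EReal.coe_neg, ← EReal.coe_mul]
  congr 1; ring

/-- Superadditivity of the optimised sandwiched entropy under tensor powers. -/
theorem sandUp_iidPow_ge (k : ℕ) {a : ℝ} (ha : a ≠ 1) {ρ : Matrix (X × S) (X × S) ℂ}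
    (hρ : ρ.PosSemidef) (hne : ρ ≠ 0) {r s : ℝ} (hr : sandUp a ρ = r)
    (hs : sandUp a (iidPow k ρ) = s) : k * r ≤ s := by
  have h1 : ∀ σ : Matrix S S ℂ, IsState σ → SuppLE (trFst ρ) σ →
      ((k : ℝ) : EReal) * -sandDiv a ρ ((1 : Matrix X X ℂ) ⊗ₖ σ) ≤ s := by
    intro σ hσ h
    rw [← neg_sandDiv_iidPow k ha hρ hσ.1 h, ← hs]
    exact le_iSup₂_of_le (f := fun (σ : Matrix (Fin k → S) (Fin k → S) ℂ) (_ : IsState σ) =>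
      -sandDiv a (iidPow k ρ) ((1 : Matrix (Fin k → X) (Fin k → X) ℂ) ⊗ₖ σ)) (piPow k σ)
      (isState_piPow k hσ) le_rfl
  -- Without copies one cannot divide by `k`; a single admissible state already gives $0\le s$.
  rcases k.eq_zero_or_pos with rfl | hk
  · have h2 := h1 _ (isState_normalize (trFst_posSemidef hρ) (trFst_ne_zero hρ hne))
      (suppLE_smul _ (inv_ne_zero (rtr_pos (trFst_posSemidef hρ) (trFst_ne_zero hρ hne)).ne'))
    simp only [CharP.cast_eq_zero, EReal.coe_zero, zero_mul] at h2 ⊢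
    exact_mod_cast h2
  · have hk' : (0 : ℝ) < k := by exact_mod_cast hk
    have h2 : sandUp a ρ ≤ ((s / k : ℝ) : EReal) := by
      refine iSup₂_le fun σ hσ => ?_
      by_cases h : SuppLE (trFst ρ) σ
      · have h3 := h1 σ hσ h
        rw [sandDiv_of_ne ha hρ hσ.1 h, ← EReal.coe_neg] at h3 ⊢
        rw [← EReal.coe_mul, EReal.coe_le_coe_iff] at h3
        rw [EReal.coe_le_coe_iff, le_div_iff₀ hk', mul_comm]
        exact h3
      · rw [sandDiv_of_not hρ hσ.1 h]; simp
    rw [hr, EReal.coe_le_coe_iff, le_div_iff₀ hk'] at h2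
    linarith

variable {Y C E : Type*} [Fintype Y] [DecidableEq Y] [Fintype C] [DecidableEq C]
  [Fintype E] [DecidableEq E]

/-- The `k`-fold tensor power of a tripartite vector. -/
def piVec (k : ℕ) (φ : (Y × C) × E → ℂ) :
    ((Fin k → Y) × (Fin k → C)) × (Fin k → E) → ℂ :=
  fun i => ∏ t, φ ((i.1.1 t, i.1.2 t), i.2 t)

theorem marg_piVec (k : ℕ) (φ : (Y × C) × E → ℂ) : marg (piVec k φ) = iidPow k (marg φ) := by
  have : vecMat (piVec k φ) = (piPow k (vecMat φ)).submatrix (pairEquiv Y C k) id := rfl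
  rw [marg, this, iidPow_eq, marg, piPow_mul, piPow_conjTranspose]
  rfl

theorem swapCE_piVec (k : ℕ) (φ : (Y × C) × E → ℂ) : swapCE (piVec k φ) = piVec k (swapCE φ) := rfl

/-- Additivity of the optimised sandwiched entropy, through the duality relation. -/
theorem sandUp_iidPow_duality (k : ℕ) {φ : (Y × C) × E → ℂ} (hφ : marg φ ≠ 0) {a b : ℝ}
    (ha : 1 < a) (hb : b = a / (2 * a - 1)) :
    sandUp a (iidPow k (marg (swapCE φ))) = -(((k : ℝ) : EReal) * sandUp b (marg φ)) := by
  have hb1 : b ≠ 1 := by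
    have : 0 < 2 * a - 1 := by linarith
    rw [hb, Ne, div_eq_one_iff_eq this.ne']
    linarith
  obtain ⟨r, h1, h2⟩ := sandUp_duality_of_one_lt hφ ha hb
  obtain ⟨s, h3, h4⟩ := sandUp_duality_of_one_lt (φ := piVec k φ)
    (by rw [marg_piVec]; exact iidPow_ne_zero k (marg_posSemidef φ) hφ) ha hb
  rw [swapCE_piVec, marg_piVec] at h3
  rw [marg_piVec] at h4
  -- Superadditivity at order `a` gives $kr\le s$; at the dual order it gives $-kr\le-s$, the
  -- missing subadditivity.
  have h5 := sandUp_iidPow_ge k ha.ne' (marg_posSemidef _) (marg_swap_ne_zero hφ) h1 h3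
  have h6 := sandUp_iidPow_ge k hb1 (marg_posSemidef _) hφ h2 h4
  rw [h3, h2, ← EReal.coe_mul, ← EReal.coe_neg, EReal.coe_eq_coe_iff]
  linarith

end TensorPowers

/-! ### Fidelity and states below a given operator -/

section Smoothing

variable {n : Type*} [Fintype n] [DecidableEq n]

theorem cfc_posSemidef_of_nonneg {M : Matrix n n ℂ} (hM : M.IsHermitian) {f : ℝ → ℝ}
    (hf : ∀ x, 0 ≤ f x) : (cfc f M).PosSemidef := by
  obtain ⟨U, d, -, -, hf', -⟩ := exists_diagonalization hM
  rw [hf']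
  exact posSemidef_conj_diagonal U fun i => hf _

theorem cfc_sub_cfc {M : Matrix n n ℂ} (hM : M.IsHermitian) (f g : ℝ → ℝ) :
    cfc f M - cfc g M = cfc (fun x => f x - g x) M := by
  obtain ⟨U, d, -, -, hf', -⟩ := exists_diagonalization hM
  rw [hf', hf', hf', ← Matrix.sub_mul, ← Matrix.mul_sub, Matrix.diagonal_sub]
  simp

theorem one_sub_projection_posSemidef {P : Matrix n n ℂ} (hP : P.IsHermitian) (hPP : P * P = P) :
    (1 - P).PosSemidef := by
  have h : (1 - P) = (1 - P) * (1 - P)ᴴ := by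
    rw [Matrix.conjTranspose_sub, hP.eq, Matrix.conjTranspose_one, Matrix.sub_mul, Matrix.mul_sub,
      Matrix.mul_sub, hPP]
    simp
  rw [h]
  exact Matrix.posSemidef_self_mul_conjTranspose _

theorem one_sub_mpow_zero_posSemidef {M : Matrix n n ℂ} (hM : M.PosSemidef) :
    (1 - mpow M 0).PosSemidef :=
  one_sub_projection_posSemidef (mpow_isHermitian M 0) (by rw [mpow_mul_mpow hM, add_zero])

/-- The trace norm dominates the real part of the trace. -/
theorem rtr_le_rtr_mpow_half (X : Matrix n n ℂ) : rtr X ≤ rtr (mpow (X * Xᴴ) (1 / 2)) := by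
  have hM := Matrix.posSemidef_self_mul_conjTranspose X
  set M := X * Xᴴ with hMd
  set H := mpow M (1 / 2) with hH
  -- $X=HW$ is the polar decomposition, with $HWW^\dagger=H$. Expanding
  -- $0\le\mathrm{tr}\,H(1-W)(1-W)^\dagger$ gives $\mathrm{Re}\,\mathrm{tr}\,X\le\mathrm{tr}\,H$.
  set W := mpow M (-(1 / 2)) * X with hW
  have hHW : H * W = X := by
    rw [hH, hW, ← Matrix.mul_assoc, mpow_mul_mpow hM, add_neg_cancel]
    have h1 : (X - mpow M 0 * X) * (X - mpow M 0 * X)ᴴ = 0 := by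
      rw [Matrix.conjTranspose_sub, Matrix.conjTranspose_mul, (mpow_isHermitian M 0).eq,
        Matrix.sub_mul, Matrix.mul_sub, Matrix.mul_sub, ← Matrix.mul_assoc, ← hMd,
        Matrix.mul_assoc _ X, ← hMd, mpow_zero_mul hM, mul_mpow_zero hM,
        Matrix.mul_assoc _ X, ← Matrix.mul_assoc X, ← hMd, mul_mpow_zero hM, mpow_zero_mul hM]
      simp
    exact (sub_eq_zero.1 (Matrix.self_mul_conjTranspose_eq_zero.1 h1)).symm
  have hHH : H * (W * Wᴴ) = H := by
    rw [← Matrix.mul_assoc, hHW, hW, Matrix.conjTranspose_mul, (mpow_isHermitian M _).eq,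
      ← Matrix.mul_assoc, ← hMd, self_mul_mpow hM, hH]
    norm_num
  have h0 := rtr_mul_nonneg (mpow_posSemidef hM (1 / 2))
    (Matrix.posSemidef_self_mul_conjTranspose (1 - W))
  have h1 : rtr (H * Wᴴ) = rtr (H * W) := by
    rw [← rtr_conjTranspose, Matrix.conjTranspose_mul, Matrix.conjTranspose_conjTranspose,
      (mpow_isHermitian M _).eq, rtr_mul_comm]
  rw [Matrix.conjTranspose_sub, Matrix.conjTranspose_one, Matrix.sub_mul, Matrix.mul_sub,
    Matrix.mul_sub, ← hH, Matrix.mul_sub, Matrix.mul_sub, Matrix.mul_sub, rtr_sub, rtr_sub,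
    rtr_sub, hHH, Matrix.mul_one, Matrix.one_mul, Matrix.mul_one, Matrix.mul_one, h1, hHW] at h0
  linarith

theorem fidelity_mono {ρ τ τ' : Matrix n n ℂ} (hτ : τ.PosSemidef)
    (hτ' : τ'.PosSemidef) (h : (τ' - τ).PosSemidef) : fidelity ρ τ ≤ fidelity ρ τ' := by
  have conj : ∀ T : Matrix n n ℂ, T.PosSemidef →
      (mpow ρ (1 / 2) * T * mpow ρ (1 / 2)).PosSemidef := fun T hT => by
    have := hT.mul_mul_conjTranspose_same (mpow ρ (1 / 2))
    rwa [(mpow_isHermitian ρ _).eq] at this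
  have h1 := rtr_nonneg (mpow_half_mono (conj _ hτ') (conj _ hτ)
    (by rw [← Matrix.sub_mul, ← Matrix.mul_sub]; exact conj _ h))
  rw [rtr_sub] at h1
  unfold fidelity
  linarith

/-- If `ρ ≤ L + Δ` then some state below `L` is close to `ρ`. -/
theorem exists_state_le_of_le_add {ρ L D : Matrix n n ℂ} (hρ : IsState ρ) (hL : L.PosSemidef)
    (hD : D.PosSemidef) (h : (L + D - ρ).PosSemidef) (hL1 : 1 ≤ rtr L) :
    ∃ τ, IsState τ ∧ (L - τ).PosSemidef ∧ 1 - rtr D ≤ fidelity ρ τ := by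
  rw [isState_iff] at hρ
  have hN : (L + D).PosSemidef := hL.add hD
  set N := L + D with hNd
  have hNL : (N - L).PosSemidef := by rw [hNd, add_sub_cancel_left]; exact hD
  have hLN : SuppLE L N := suppLE_of_le hL hNL
  have hLhN : mpow L (1 / 2) * mpow N 0 = mpow L (1 / 2) :=
    ((suppLE_mpow_self hL _).trans hLN).mul_mpow_zero hN
  -- A contraction with $GNG^\dagger=L$: it maps $\rho\le N$ to $\tau_0=G\rho G^\dagger\le L$ and
  -- does not increase the trace.
  set G := mpow L (1 / 2) * mpow N (-(1 / 2)) with hG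
  have hGh : Gᴴ = mpow N (-(1 / 2)) * mpow L (1 / 2) := by
    rw [hG, Matrix.conjTranspose_mul, (mpow_isHermitian N _).eq, (mpow_isHermitian L _).eq]
  have hGNG : G * N * Gᴴ = L := by
    have e : mpow N (-(1 / 2)) * N * mpow N (-(1 / 2)) = mpow N 0 := by
      rw [mpow_mul_self hN, mpow_mul_mpow hN]; norm_num
    calc G * N * Gᴴ = mpow L (1 / 2) * (mpow N (-(1 / 2)) * N * mpow N (-(1 / 2))) *
          mpow L (1 / 2) := by rw [hGh, hG]; simp only [Matrix.mul_assoc]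
      _ = L := by rw [e, hLhN, mpow_half_mul_self hL]
  have hGG : (1 - Gᴴ * G).PosSemidef := by
    have e : Gᴴ * G = mpow N (-(1 / 2)) * L * mpow N (-(1 / 2)) := by
      rw [hGh, hG]
      calc _ = mpow N (-(1 / 2)) * (mpow L (1 / 2) * mpow L (1 / 2)) * mpow N (-(1 / 2)) := by
            simp only [Matrix.mul_assoc]
        _ = _ := by rw [mpow_half_mul_self hL]
    have e2 : mpow N 0 = mpow N (-(1 / 2)) * N * mpow N (-(1 / 2)) := by
      rw [mpow_mul_self hN, mpow_mul_mpow hN]; norm_num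
    have h2 := hNL.mul_mul_conjTranspose_same (mpow N (-(1 / 2)))
    rw [(mpow_isHermitian N _).eq, Matrix.mul_sub, Matrix.sub_mul, ← e, ← e2] at h2
    simpa using (one_sub_mpow_zero_posSemidef hN).add h2
  set τ₀ := G * ρ * Gᴴ with hτ₀
  have hτ₀p : τ₀.PosSemidef := hρ.1.mul_mul_conjTranspose_same G
  have hτ₀L : (L - τ₀).PosSemidef := by
    rw [← hGNG, hτ₀, ← Matrix.sub_mul, ← Matrix.mul_sub]
    exact h.mul_mul_conjTranspose_same G
  have hτ₀1 : rtr τ₀ ≤ 1 := by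
    have := rtr_mul_le_mul_left hρ.1 (C := 1) (B := Gᴴ * G) hGG
    rw [Matrix.mul_one, hρ.2] at this
    rwa [hτ₀, rtr_mul_comm, ← Matrix.mul_assoc, rtr_mul_comm]
  have hF : 1 - rtr D ≤ fidelity ρ τ₀ := by
    -- The left side is the real trace of $\sqrt\rho\,G\sqrt\rho$, whose trace norm is the fidelity
    -- of $\rho$ and $\tau_0$.
    have h1 : rtr (ρ * G) ≤ fidelity ρ τ₀ := by
      have e : mpow ρ (1 / 2) * τ₀ * mpow ρ (1 / 2) =
          (mpow ρ (1 / 2) * G * mpow ρ (1 / 2)) * (mpow ρ (1 / 2) * G * mpow ρ (1 / 2))ᴴ := by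
        simp only [Matrix.conjTranspose_mul, (mpow_isHermitian ρ _).eq]
        calc _ = mpow ρ (1 / 2) * G * ρ * Gᴴ * mpow ρ (1 / 2) := by
              rw [hτ₀]; simp only [Matrix.mul_assoc]
          _ = mpow ρ (1 / 2) * G * (mpow ρ (1 / 2) * mpow ρ (1 / 2)) * Gᴴ * mpow ρ (1 / 2) := by
              rw [mpow_half_mul_self hρ.1]
          _ = _ := by simp only [Matrix.mul_assoc]
      unfold fidelity
      rw [e]
      refine le_trans (le_of_eq ?_) (rtr_le_rtr_mpow_half _)
      rw [rtr_mul_comm (mpow ρ (1 / 2) * G), ← Matrix.mul_assoc (mpow ρ (1 / 2)),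
        mpow_half_mul_self hρ.1]
    -- $2-G-G^\dagger=(1-G)^\dagger(1-G)+(1-G^\dagger G)\ge0$. Pairing with $N-\rho\ge0$ gives
    -- $1-\mathrm{Re}\,\mathrm{tr}\,\rho G\le\mathrm{tr}\,N-\mathrm{Re}\,\mathrm{tr}\,NG$, and
    -- $\mathrm{tr}\,NG=\mathrm{tr}\sqrt N\sqrt L\ge\mathrm{tr}\,L$ because $\sqrt N\ge\sqrt L$.
    have h2 : ((1 + 1 : Matrix n n ℂ) - G - Gᴴ).PosSemidef := by
      have := (Matrix.posSemidef_conjTranspose_mul_self (1 - G)).add hGG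
      convert this using 1
      rw [Matrix.conjTranspose_sub, Matrix.conjTranspose_one, Matrix.sub_mul, Matrix.mul_sub,
        Matrix.mul_sub]
      simp only [Matrix.one_mul, Matrix.mul_one]
      abel
    have h3 := rtr_mul_nonneg h h2
    have sym : ∀ K : Matrix n n ℂ, K.PosSemidef → rtr (K * Gᴴ) = rtr (K * G) := fun K hK => by
      rw [← rtr_conjTranspose, Matrix.conjTranspose_mul, Matrix.conjTranspose_conjTranspose,
        hK.isHermitian.eq, rtr_mul_comm]
    have h4 : rtr L ≤ rtr (N * G) := by
      have e : rtr (N * G) = rtr (mpow N (1 / 2) * mpow L (1 / 2)) := by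
        rw [hG, rtr_mul_comm, Matrix.mul_assoc, mpow_mul_self hN, rtr_mul_comm]
        norm_num
      have := rtr_mul_le_mul_right (mpow_posSemidef hL (1 / 2)) (mpow_half_mono hN hL hNL)
      rwa [mpow_half_mul_self hL, ← e] at this
    simp only [Matrix.sub_mul, Matrix.mul_sub, Matrix.mul_add, Matrix.mul_one, rtr_sub, rtr_add,
      sym N hN, sym ρ hρ.1, hρ.2] at h3
    have h5 : rtr N = rtr L + rtr D := rtr_add _ _
    linarith
  obtain h1 | h1 := hτ₀1.eq_or_lt
  · exact ⟨τ₀, isState_iff.2 ⟨hτ₀p, h1⟩, hτ₀L, hF⟩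
  -- Move $\tau_0$ towards $L$ until the trace is one; $c\le1$ since $\mathrm{tr}\,L\ge1$, and the
  -- fidelity does not decrease.
  set c := (1 - rtr τ₀) / (rtr L - rtr τ₀) with hc
  have hpos : 0 < rtr L - rtr τ₀ := by linarith
  have hc0 : 0 ≤ c := div_nonneg (by linarith) hpos.le
  have hc1 : c ≤ 1 := (div_le_one hpos).2 (by linarith)
  have hτp : (τ₀ + c • (L - τ₀)).PosSemidef := hτ₀p.add (hτ₀L.smul hc0)
  refine ⟨τ₀ + c • (L - τ₀), isState_iff.2 ⟨hτp, ?_⟩, ?_, hF.trans (fidelity_mono hτ₀p hτp ?_)⟩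
  · rw [rtr_add, rtr_smul, rtr_sub, hc]
    field_simp
    ring
  · have : L - (τ₀ + c • (L - τ₀)) = (1 - c) • (L - τ₀) := by
      rw [sub_smul, one_smul]; abel
    rw [this]
    exact hτ₀L.smul (by linarith)
  · rw [add_sub_cancel_left]
    exact hτ₀L.smul hc0

/-- $M\le c$ gives $M^2\le cM\le c^2$, hence $\|Mv\|\le c\|v\|$. -/
theorem opNorm_le_of_le {M : Matrix n n ℂ} (hM : M.PosSemidef) {c : ℝ} (hc : 0 ≤ c)
    (h : (c • (1 : Matrix n n ℂ) - M).PosSemidef) : opNorm M ≤ c := by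
  have h2 : ((c ^ 2) • (1 : Matrix n n ℂ) - Mᴴ * M).PosSemidef := by
    have h3 := h.mul_mul_conjTranspose_same (mpow M (1 / 2))
    rw [(mpow_isHermitian M _).eq, Matrix.mul_sub, Matrix.sub_mul, Matrix.mul_smul,
      Matrix.smul_mul, Matrix.mul_one, mpow_half_mul_self hM] at h3
    have e : mpow M (1 / 2) * M * mpow M (1 / 2) = M * M := by
      rw [mpow_mul_self hM, mpow_mul_mpow hM]
      conv_rhs => rw [← mpow_one hM, mpow_mul_mpow hM]
      norm_num
    rw [e] at h3
    have h4 := (h.smul hc).add h3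
    rw [hM.isHermitian.eq]
    convert h4 using 1
    rw [smul_sub, smul_smul, pow_two]
    abel
  unfold opNorm
  refine ContinuousLinearMap.opNorm_le_bound _ hc fun v => ?_
  have h3 := h2.dotProduct_mulVec_nonneg v.ofLp
  rw [Matrix.sub_mulVec, dotProduct_sub, Matrix.smul_mulVec, Matrix.one_mulVec,
    ← Matrix.mulVec_mulVec, Matrix.dotProduct_mulVec, Matrix.vecMul_conjTranspose,
    star_star] at h3
  have hn : ∀ w : EuclideanSpace ℂ n, ((‖w‖ ^ 2 : ℝ) : ℂ) = star w.ofLp ⬝ᵥ w.ofLp := fun w => by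
    rw [EuclideanSpace.norm_sq_eq, dotProduct]
    push_cast
    refine Finset.sum_congr rfl fun i _ => ?_
    rw [Pi.star_apply, ← Complex.ofReal_pow, ← Complex.normSq_eq_norm_sq,
      Complex.normSq_eq_conj_mul_self]
    rfl
  have h4 : (Matrix.toEuclideanCLM (n := n) (𝕜 := ℂ) M v).ofLp = M *ᵥ v.ofLp := by
    simp
  rw [dotProduct_smul, ← hn, ← h4, ← hn, Complex.real_smul, ← Complex.ofReal_mul,
    ← Complex.ofReal_sub, Complex.zero_le_real, ← mul_pow, sub_nonneg] at h3
  exact le_of_sq_le_sq h3 (by positivity)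

theorem opNorm_pos {M : Matrix n n ℂ} (hM : M ≠ 0) : 0 < opNorm M := by
  unfold opNorm
  rw [norm_pos_iff]
  exact (map_ne_zero_iff _ (Matrix.toEuclideanCLM (n := n) (𝕜 := ℂ)).injective).2 hM

end Smoothing

/-! ### Lower bounds on the smooth min-entropy -/

section MinEntropy

variable {X S : Type*} [Fintype X] [DecidableEq X] [Fintype S] [DecidableEq S]

theorem sqrt_one_sub_sq_lt_one {ε : ℝ} (h0 : 0 < ε) : √(1 - ε ^ 2) < 1 := by
  rw [Real.sqrt_lt' one_pos]
  nlinarith [sq_pos_of_pos h0]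

theorem sqrt_one_sub_sq_le_of_le {F ε : ℝ} (h0 : 0 < ε) (h : √(1 - ε ^ 2) ≤ F) :
    √(1 - F ^ 2) ≤ ε := by
  rw [Real.sqrt_le_left h0.le]
  have h1 : 1 - ε ^ 2 ≤ F ^ 2 := by
    by_cases h2 : 0 ≤ 1 - ε ^ 2
    · calc _ = √(1 - ε ^ 2) ^ 2 := (Real.sq_sqrt h2).symm
        _ ≤ _ := pow_le_pow_left₀ (Real.sqrt_nonneg _) h 2
    · nlinarith [sq_nonneg F]
  linarith

/-- A bound on the weights that projectors give to `ρ` in terms of the weights that they give to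
`𝕀 ⊗ σ` yields a lower bound on the smooth min-entropy. -/
theorem le_hMinSmooth_of_projection_bound {ρ : Matrix (X × S) (X × S) ℂ} (hρ : IsState ρ)
    {σ : Matrix S S ℂ} (hσ : IsState σ) {a Q ε : ℝ} (ha : 1 < a) (hQ : 0 < Q)
    (h : ∀ P : Matrix (X × S) (X × S) ℂ, P.IsHermitian → P * P = P →
      rtr (P * ρ) ≤ Q ^ (1 / a) * rtr (P * ((1 : Matrix X X ℂ) ⊗ₖ σ)) ^ ((a - 1) / a))
    (hε : 0 < ε) :
    ((-(1 / (a - 1) * Real.logb 2 Q) : ℝ) : EReal) - ((gFun ε / (a - 1) : ℝ) : EReal) ≤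
      hMinSmooth ε ρ := by
  have hρ' := isState_iff.1 hρ
  have hσ1 : ((1 : Matrix X X ℂ) ⊗ₖ σ).PosSemidef := one_kron_posSemidef hσ.1
  set δ := 1 - √(1 - ε ^ 2) with hδ
  have hδ0 : 0 < δ := by have := sqrt_one_sub_sq_lt_one hε; linarith
  have hδ1 : δ ≤ 1 := by have := Real.sqrt_nonneg (1 - ε ^ 2); linarith
  have ha1 : 0 < a - 1 := by linarith
  have ha0 : 0 < a := by linarith
  -- Chosen so that $\log c=(\log Q+g(\epsilon))/(a-1)$, the negative of the claimed bound.
  set c := (Q / δ) ^ (1 / (a - 1)) with hc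
  have hc0 : 0 < c := Real.rpow_pos_of_pos (by positivity) _
  have hca : c ^ (a - 1) = Q / δ := by
    rw [hc, ← Real.rpow_mul (by positivity), one_div_mul_cancel ha1.ne', Real.rpow_one]
  set L := c • ((1 : Matrix X X ℂ) ⊗ₖ σ) with hL
  have hLp : L.PosSemidef := hσ1.smul hc0.le
  have hM : (ρ - L).IsHermitian := hρ.1.isHermitian.sub hLp.isHermitian
  set D := cfc (fun x : ℝ => max x 0) (ρ - L) with hD
  set P := cfc (fun x : ℝ => if 0 < x then (1 : ℝ) else 0) (ρ - L) with hP
  have hDp : D.PosSemidef := cfc_posSemidef_of_nonneg hM fun x => le_max_right _ _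
  have hPp : P.PosSemidef := cfc_posSemidef_of_nonneg hM fun x => by split_ifs <;> norm_num
  have hPP : P * P = P := by
    rw [hP, cfc_mul_cfc hM]
    congr 1
    ext x
    split_ifs <;> norm_num
  have hDP : D = P * (ρ - L) := by
    have e := cfc_mul_cfc hM (fun x : ℝ => if 0 < x then (1 : ℝ) else 0) (fun x => x)
    rw [cfc_id_eq hM] at e
    rw [hP, e, hD]
    congr 1
    ext x
    split_ifs with hx
    · simp [hx.le]
    · simp [not_lt.1 hx]
  have hle : (L + D - ρ).PosSemidef := by
    have : L + D - ρ = cfc (fun x : ℝ => max x 0 - x) (ρ - L) := by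
      rw [← cfc_sub_cfc hM, cfc_id_eq hM, ← hD]; abel
    rw [this]
    exact cfc_posSemidef_of_nonneg hM fun x => sub_nonneg.2 (le_max_left _ _)
  have hDle : rtr D ≤ δ := by
    have hD0 := rtr_nonneg hDp
    have hb := h P hPp.isHermitian hPP
    set q := rtr (P * ((1 : Matrix X X ℂ) ⊗ₖ σ)) with hq
    have hq0 : 0 ≤ q := rtr_mul_nonneg hPp hσ1
    have hDe : rtr D = rtr (P * ρ) - c * q := by
      rw [hDP, Matrix.mul_sub, rtr_sub, hL, Matrix.mul_smul, rtr_smul]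
    set p := rtr (P * ρ) with hp
    have hcq : c * q ≤ p := by linarith
    -- From $cq\le p$: $p^a\le Qq^{a-1}\le Q(p/c)^{a-1}=\delta\,p^{a-1}$, so $p\le\delta$; and
    -- $\mathrm{tr}\,D=p-cq\le p$.
    suffices p ≤ δ by nlinarith
    obtain hp0 | hp0 := (rtr_mul_nonneg hPp hρ.1).eq_or_lt
    · linarith
    rw [← hp] at hp0
    have h1 : p ^ a ≤ Q * q ^ (a - 1) := by
      calc p ^ a ≤ (Q ^ (1 / a) * q ^ ((a - 1) / a)) ^ a :=
            Real.rpow_le_rpow hp0.le hb ha0.le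
        _ = _ := by
            rw [Real.mul_rpow (by positivity) (by positivity), ← Real.rpow_mul hQ.le,
              ← Real.rpow_mul hq0, one_div_mul_cancel ha0.ne', div_mul_cancel₀ _ ha0.ne',
              Real.rpow_one]
    have h2 : q ^ (a - 1) * (Q / δ) ≤ p ^ (a - 1) := by
      rw [← hca, ← Real.mul_rpow hq0 hc0.le]
      exact Real.rpow_le_rpow (by positivity) (by linarith) ha1.le
    have h3 : p ^ a = p ^ (a - 1) * p := by
      rw [← Real.rpow_add_one hp0.ne']; ring_nf
    have h4 : p ^ (a - 1) * p ≤ p ^ (a - 1) * δ := by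
      rw [← h3]
      calc p ^ a ≤ Q * q ^ (a - 1) := h1
        _ = (q ^ (a - 1) * (Q / δ)) * δ := by field_simp
        _ ≤ _ := mul_le_mul_of_nonneg_right h2 hδ0.le
    exact le_of_mul_le_mul_left h4 (Real.rpow_pos_of_pos hp0 _)
  have hL1 : 1 ≤ rtr L := by
    -- The projection bound at `P = 1` gives $1\le Qt^{a-1}\le(Q/\delta)t^{a-1}=(ct)^{a-1}$.
    have hb := h 1 Matrix.isHermitian_one (Matrix.one_mul 1)
    rw [Matrix.one_mul, Matrix.one_mul, hρ'.2] at hb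
    set t := rtr ((1 : Matrix X X ℂ) ⊗ₖ σ) with ht
    have ht0 : 0 ≤ t := rtr_nonneg hσ1
    have h1 : 1 ≤ Q * t ^ (a - 1) := by
      calc (1 : ℝ) = 1 ^ a := (Real.one_rpow a).symm
        _ ≤ (Q ^ (1 / a) * t ^ ((a - 1) / a)) ^ a := Real.rpow_le_rpow zero_le_one hb ha0.le
        _ = _ := by
            rw [Real.mul_rpow (by positivity) (by positivity), ← Real.rpow_mul hQ.le,
              ← Real.rpow_mul ht0, one_div_mul_cancel ha0.ne', div_mul_cancel₀ _ ha0.ne',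
              Real.rpow_one]
    have h2 : 1 ≤ (c * t) ^ (a - 1) := by
      rw [Real.mul_rpow hc0.le ht0, hca, div_mul_eq_mul_div, le_div_iff₀ hδ0]
      linarith
    rw [hL, rtr_smul]
    by_contra hlt
    exact absurd h2 (not_le.2 (Real.rpow_lt_one (by positivity) (not_le.1 hlt) ha1))
  obtain ⟨τ, hτ, hτL, hF⟩ := exists_state_le_of_le_add hρ hLp hDp hle hL1
  have hs : SuppLE τ ((1 : Matrix X X ℂ) ⊗ₖ σ) := by
    refine (suppLE_of_le hτ.1 hτL).trans ?_
    intro v hv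
    rw [hL, Matrix.smul_mulVec, hv, smul_zero]
  refine le_trans ?_ (le_iSup₂_of_le τ σ (le_iSup_of_le
    ⟨hτ, sqrt_one_sub_sq_le_of_le hε (by linarith), hσ, hs⟩ le_rfl))
  rw [← EReal.coe_sub, EReal.coe_le_coe_iff]
  set Z := (1 : Matrix X X ℂ) ⊗ₖ mpow σ (-1 / 2) with hZ
  have hZe : Z = mpow ((1 : Matrix X X ℂ) ⊗ₖ σ) (-1 / 2) := (mpow_one_kron hσ.1.isHermitian _).symm
  have hZh : Z.IsHermitian := by rw [hZe]; exact mpow_isHermitian _ _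
  have hmono : ∀ T : Matrix (X × S) (X × S) ℂ, T.PosSemidef → (Z * T * Z).PosSemidef :=
    fun T hT => by
      have := hT.mul_mul_conjTranspose_same Z
      rwa [hZh.eq] at this
  have hZne : Z * τ * Z ≠ 0 := by
    intro h0
    have e1 : mpow ((1 : Matrix X X ℂ) ⊗ₖ σ) (1 / 2) * Z = mpow ((1 : Matrix X X ℂ) ⊗ₖ σ) 0 := by
      rw [hZe, mpow_mul_mpow hσ1]; norm_num
    have e2 : Z * mpow ((1 : Matrix X X ℂ) ⊗ₖ σ) (1 / 2) = mpow ((1 : Matrix X X ℂ) ⊗ₖ σ) 0 := by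
      rw [hZe, mpow_mul_mpow hσ1]; norm_num
    have e3 : τ = 0 := by
      calc τ = mpow ((1 : Matrix X X ℂ) ⊗ₖ σ) 0 * τ * mpow ((1 : Matrix X X ℂ) ⊗ₖ σ) 0 := by
            rw [hs.mpow_zero_mul hσ1 hτ.1.isHermitian, hs.mul_mpow_zero hσ1]
        _ = mpow ((1 : Matrix X X ℂ) ⊗ₖ σ) (1 / 2) * (Z * τ * Z) *
            mpow ((1 : Matrix X X ℂ) ⊗ₖ σ) (1 / 2) := by
            rw [← e1]; nth_rewrite 2 [e1]; rw [← e2]; simp only [Matrix.mul_assoc]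
        _ = 0 := by rw [h0]; simp
    have := hτ.2
    rw [e3] at this
    simp at this
  have hop : opNorm (Z * τ * Z) ≤ c := by
    refine opNorm_le_of_le (hmono τ hτ.1) hc0.le ?_
    have e : Z * L * Z = c • mpow ((1 : Matrix X X ℂ) ⊗ₖ σ) 0 := by
      rw [hL, Matrix.mul_smul, Matrix.smul_mul, hZe, mpow_mul_self hσ1, mpow_mul_mpow hσ1]
      norm_num
    have h1 := hmono _ hτL
    rw [Matrix.mul_sub, Matrix.sub_mul, e] at h1
    have h2 := ((one_sub_mpow_zero_posSemidef hσ1).smul hc0.le).add h1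
    rw [smul_sub] at h2
    simpa using h2
  have hlog : Real.logb 2 c = 1 / (a - 1) * Real.logb 2 Q + gFun ε / (a - 1) := by
    rw [hc, Real.logb_rpow_eq_mul_logb_of_pos (by positivity), Real.logb_div hQ.ne' hδ0.ne', gFun]
    ring
  have := Real.logb_le_logb_of_le (b := 2) (by norm_num) (opNorm_pos hZne) hop
  linarith

/-- Cauchy–Schwarz: $\mathrm{tr}\,(Z^\dagger+tW)^\dagger(Z^\dagger+tW)$ is a nonnegative quadratic
in the real variable $t$, so its discriminant is at most zero. -/
theorem rtr_mul_sq_le {n : Type*} [Fintype n] [DecidableEq n] (Z W : Matrix n n ℂ) :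
    rtr (Z * W) ^ 2 ≤ rtr (Z * Zᴴ) * rtr (Wᴴ * W) := by
  have h : ∀ t : ℝ, 0 ≤ rtr (Wᴴ * W) * (t * t) + (2 * rtr (Z * W)) * t + rtr (Z * Zᴴ) := by
    intro t
    have h0 := rtr_nonneg (Matrix.posSemidef_conjTranspose_mul_self (Zᴴ + t • W))
    have e : rtr (Wᴴ * Zᴴ) = rtr (Z * W) := by
      rw [← Matrix.conjTranspose_mul, rtr_conjTranspose]
    have e2 : (t • W)ᴴ = t • Wᴴ := by
      rw [Matrix.conjTranspose_smul, star_trivial]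
    rw [Matrix.conjTranspose_add, e2, Matrix.conjTranspose_conjTranspose, Matrix.add_mul,
      Matrix.mul_add, Matrix.mul_add, rtr_add, rtr_add, rtr_add, Matrix.smul_mul,
      Matrix.smul_mul, Matrix.mul_smul, Matrix.mul_smul, rtr_smul, rtr_smul, rtr_smul, rtr_smul,
      e] at h0
    linarith
  have := discrim_le_zero h
  unfold discrim at this
  nlinarith

/-- Projector weights are controlled by the sandwiched divergence of order `a > 1`. -/
theorem rtr_projection_mul_le_sandwiched {n : Type*} [Fintype n] [DecidableEq n]
    {ρ σ P : Matrix n n ℂ} (hρ : ρ.PosSemidef) (hσ : σ.PosSemidef) (h : SuppLE ρ σ)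
    (hP : P.IsHermitian) (hPP : P * P = P) {a : ℝ} (ha : 1 < a) :
    rtr (P * ρ) ≤ rtr (mpow (mpow σ ((1 - a) / (2 * a)) * ρ * mpow σ ((1 - a) / (2 * a))) a) ^
      (1 / a) * rtr (P * σ) ^ ((a - 1) / a) := by
  have ha0 : a ≠ 0 := by positivity
  have ha1 : a - 1 ≠ 0 := by linarith
  set s := (a - 1) / (2 * a) with hs
  have hs' : (1 - a) / (2 * a) = -s := by rw [hs]; ring
  rw [hs']
  set T := mpow σ (-s) * ρ * mpow σ (-s) with hT
  have hTp : T.PosSemidef := by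
    have := hρ.mul_mul_conjTranspose_same (mpow σ (-s))
    rwa [(mpow_isHermitian σ _).eq] at this
  have e : ρ = mpow σ s * T * mpow σ s := by
    calc ρ = mpow σ 0 * ρ * mpow σ 0 := by
          rw [h.mpow_zero_mul hσ hρ.isHermitian, h.mul_mpow_zero hσ]
      _ = (mpow σ s * mpow σ (-s)) * ρ * (mpow σ (-s) * mpow σ s) := by
          rw [mpow_mul_mpow hσ, mpow_mul_mpow hσ, add_neg_cancel, neg_add_cancel]
      _ = _ := by rw [hT]; simp only [Matrix.mul_assoc]
  have hPp : (mpow σ s * P * mpow σ s).PosSemidef := by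
    have := Matrix.posSemidef_self_mul_conjTranspose (mpow σ s * P)
    rwa [Matrix.conjTranspose_mul, (mpow_isHermitian σ _).eq, hP.eq, ← Matrix.mul_assoc,
      Matrix.mul_assoc _ P P, hPP] at this
  have h1 : rtr (P * ρ) = rtr (T * (mpow σ s * P * mpow σ s)) := by
    conv_lhs => rw [e]
    rw [rtr_mul_comm T, ← Matrix.mul_assoc, rtr_mul_comm _ (mpow σ s)]
    simp only [Matrix.mul_assoc]
  -- Hölder with exponents $a$ and $a/(a-1)$. In the second factor $\sigma^sP\sigma^s$ is exchanged
  -- for $P\sigma^{2s}P$, and Peierls applies with $2s\cdot a/(a-1)=1$.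
  have h2 := rtr_mul_le_holder hTp hPp
    ((Real.holderConjugate_iff_eq_conjExponent ha).2 (rfl : a / (a - 1) = a / (a - 1)))
  have h3 : rtr (mpow (mpow σ s * P * mpow σ s) (a / (a - 1))) ≤ rtr (P * σ) := by
    have e1 : mpow σ s * P * mpow σ s = (mpow σ s * P) * (mpow σ s * P)ᴴ := by
      rw [Matrix.conjTranspose_mul, (mpow_isHermitian σ _).eq, hP.eq, ← Matrix.mul_assoc,
        Matrix.mul_assoc _ P P, hPP]
    have e2 : (mpow σ s * P)ᴴ * (mpow σ s * P) = P * mpow σ (s + s) * P := by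
      rw [Matrix.conjTranspose_mul, (mpow_isHermitian σ _).eq, hP.eq, ← mpow_mul_mpow hσ]
      simp only [Matrix.mul_assoc]
    rw [e1, rtr_mpow_mul_conjTranspose, e2]
    refine (rtr_mpow_compress_le hP hPP (mpow_posSemidef hσ _) ?_).trans (le_of_eq ?_)
    · rw [le_div_iff₀ (by linarith)]; linarith
    · rw [mpow_mpow hσ]
      have : (s + s) * (a / (a - 1)) = 1 := by rw [hs]; field_simp; norm_num
      rw [this, mpow_one hσ]
  rw [h1]
  refine h2.trans (mul_le_mul_of_nonneg_left ?_
    (Real.rpow_nonneg (rtr_nonneg (mpow_posSemidef hTp _)) _))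
  rw [one_div_div]
  exact Real.rpow_le_rpow (rtr_nonneg (mpow_posSemidef hPp _)) h3
    (div_nonneg (by linarith) (by linarith))

/-- Hölder with exponents $1/r$ and $1/(1-r)$, then Peierls on each factor. At $r=1$ the second
exponent degenerates and $\rho^0\le\mathbb I$ replaces it. -/
theorem rtr_compress_mul_compress_le {n : Type*} [Fintype n] [DecidableEq n]
    {ρ σ P : Matrix n n ℂ} (hρ : ρ.PosSemidef) (hσ : σ.PosSemidef)
    (hP : P.IsHermitian) (hPP : P * P = P) {r : ℝ} (h0 : 0 < r) (h1 : r ≤ 1) :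
    rtr ((P * mpow σ r * P) * (P * mpow ρ (1 - r) * P)) ≤
      rtr (P * σ) ^ r * rtr (P * ρ) ^ (1 - r) := by
  have hc : ∀ T : Matrix n n ℂ, T.PosSemidef → (P * T * P).PosSemidef := fun T hT => by
    have := hT.mul_mul_conjTranspose_same P
    rwa [hP.eq] at this
  obtain rfl | h1 := h1.eq_or_lt
  · rw [sub_self, mpow_one hσ, Real.rpow_one, Real.rpow_zero, mul_one]
    have h2 : (1 - P * mpow ρ 0 * P).PosSemidef := by
      have := (one_sub_projection_posSemidef hP hPP).add (hc _ (one_sub_mpow_zero_posSemidef hρ))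
      rw [Matrix.mul_sub, Matrix.sub_mul, Matrix.mul_one, hPP] at this
      simpa using this
    refine (rtr_mul_le_mul_left (hc _ hσ) h2).trans (le_of_eq ?_)
    rw [Matrix.mul_one, rtr_mul_comm, ← Matrix.mul_assoc, hPP]
  have hr : (1 / r).HolderConjugate (1 / (1 - r)) := by
    rw [Real.holderConjugate_iff]
    refine ⟨(one_lt_div h0).2 h1, ?_⟩
    simp
  refine (rtr_mul_le_holder (hc _ (mpow_posSemidef hσ r)) (hc _ (mpow_posSemidef hρ _)) hr).trans ?_
  rw [one_div_one_div, one_div_one_div]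
  have key : ∀ (M : Matrix n n ℂ) (t : ℝ), M.PosSemidef → 0 < t → t ≤ 1 →
      rtr (mpow (P * mpow M t * P) (1 / t)) ^ t ≤ rtr (P * M) ^ t := by
    intro M t hM ht0 ht1
    refine Real.rpow_le_rpow (rtr_nonneg (mpow_posSemidef (hc _ (mpow_posSemidef hM _)) _)) ?_
      ht0.le
    refine (rtr_mpow_compress_le hP hPP (mpow_posSemidef hM _) ((one_le_div ht0).2 ht1)).trans
      (le_of_eq ?_)
    rw [mpow_mpow hM, mul_one_div_cancel ht0.ne', mpow_one hM]
  exact mul_le_mul (key σ r hσ h0 h1.le) (key ρ (1 - r) hρ (by linarith) (by linarith))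
    (Real.rpow_nonneg (rtr_nonneg (mpow_posSemidef (hc _ (mpow_posSemidef hρ _)) _)) _)
    (Real.rpow_nonneg (by
      have := rtr_nonneg (hc σ hσ)
      rwa [rtr_mul_comm, ← Matrix.mul_assoc, hPP] at this) _)

/-- Projector weights are controlled by the Petz divergence of order `1 < a ≤ 2`. -/
theorem rtr_projection_mul_le_petz {n : Type*} [Fintype n] [DecidableEq n]
    {ρ σ P : Matrix n n ℂ} (hρ : ρ.PosSemidef) (hσ : σ.PosSemidef) (h : SuppLE ρ σ)
    (hP : P.IsHermitian) (hPP : P * P = P) {a : ℝ} (ha : 1 < a) (ha2 : a ≤ 2) :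
    rtr (P * ρ) ≤ rtr (mpow ρ a * mpow σ (1 - a)) ^ (1 / a) * rtr (P * σ) ^ ((a - 1) / a) := by
  have ha0 : 0 < a := by linarith
  have hPp : P.PosSemidef := by
    have := Matrix.posSemidef_self_mul_conjTranspose P
    rwa [hP.eq, hPP] at this
  set Q := rtr (mpow ρ a * mpow σ (1 - a)) with hQ
  set p := rtr (P * ρ) with hp
  set q := rtr (P * σ) with hq
  have hQ0 : 0 ≤ Q := rtr_mul_nonneg (mpow_posSemidef hρ _) (mpow_posSemidef hσ _)
  have hq0 : 0 ≤ q := rtr_mul_nonneg hPp hσ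
  obtain hp0 | hp0 := (rtr_mul_nonneg hPp hρ).eq_or_lt
  · rw [hp, ← hp0]; positivity
  rw [← hp] at hp0
  -- In $\mathrm{tr}\,ZW=p$ the powers of `σ` cancel. Cauchy–Schwarz splits off
  -- $\mathrm{tr}\,W^\dagger W=Q$, and $\mathrm{tr}\,ZZ^\dagger\le q^{a-1}p^{2-a}$ by the
  -- compression lemma with $r=a-1\le1$. Dividing $p^2\le Q\,q^{a-1}p^{2-a}$ by $p^{2-a}$ finishes.
  set W := mpow σ ((1 - a) / 2) * mpow ρ (a / 2) with hW
  set Z := mpow ρ (1 - a / 2) * P * mpow σ ((a - 1) / 2) with hZ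
  have hWe : mpow σ ((a - 1) / 2) * W = mpow ρ (a / 2) := by
    rw [hW, ← Matrix.mul_assoc, mpow_mul_mpow hσ]
    have : (a - 1) / 2 + (1 - a) / 2 = 0 := by ring
    rw [this, ((suppLE_mpow_self hρ _).trans h).mpow_zero_mul hσ (mpow_isHermitian _ _)]
  have hZW : rtr (Z * W) = p := by
    rw [hZ, Matrix.mul_assoc, hWe, rtr_mul_comm, ← Matrix.mul_assoc, mpow_mul_mpow hρ, hp,
      rtr_mul_comm P]
    have : a / 2 + (1 - a / 2) = 1 := by ring
    rw [this, mpow_one hρ]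
  have hWW : rtr (Wᴴ * W) = Q := by
    rw [hW, Matrix.conjTranspose_mul, (mpow_isHermitian σ _).eq, (mpow_isHermitian ρ _).eq,
      Matrix.mul_assoc, ← Matrix.mul_assoc (mpow σ _), mpow_mul_mpow hσ, rtr_mul_comm,
      Matrix.mul_assoc, mpow_mul_mpow hρ, rtr_mul_comm, hQ]
    ring_nf
  have hZZ : rtr (Z * Zᴴ) = rtr ((P * mpow σ (a - 1) * P) * (P * mpow ρ (1 - (a - 1)) * P)) := by
    have e1 : mpow σ ((a - 1) / 2) * mpow σ ((a - 1) / 2) = mpow σ (a - 1) := by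
      rw [mpow_mul_mpow hσ]; ring_nf
    have e2 : mpow ρ (1 - a / 2) * mpow ρ (1 - a / 2) = mpow ρ (1 - (a - 1)) := by
      rw [mpow_mul_mpow hρ]; ring_nf
    have e3 : Z * Zᴴ = mpow ρ (1 - a / 2) *
        (P * (mpow σ ((a - 1) / 2) * mpow σ ((a - 1) / 2)) * P * mpow ρ (1 - a / 2)) := by
      rw [hZ]
      simp only [Matrix.conjTranspose_mul, (mpow_isHermitian _ _).eq, hP.eq, Matrix.mul_assoc]
    set K := P * mpow σ (a - 1) * P with hK
    have e4 : P * K * P = K := by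
      calc P * K * P = (P * P) * mpow σ (a - 1) * (P * P) := by
            rw [hK]; simp only [Matrix.mul_assoc]
        _ = K := by rw [hPP]
    have e5 : rtr (K * (P * mpow ρ (1 - (a - 1)) * P)) = rtr (K * mpow ρ (1 - (a - 1))) := by
      calc _ = rtr ((K * P * mpow ρ (1 - (a - 1))) * P) := by simp only [Matrix.mul_assoc]
        _ = rtr (P * K * P * mpow ρ (1 - (a - 1))) := by
            rw [rtr_mul_comm]; simp only [Matrix.mul_assoc]
        _ = _ := by rw [e4]
    rw [e3, e1, ← hK, rtr_mul_comm, Matrix.mul_assoc, e2, e5]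
  have h1 := rtr_mul_sq_le Z W
  rw [hZW, hWW, hZZ] at h1
  have h2 := rtr_compress_mul_compress_le hρ hσ hP hPP (r := a - 1) (by linarith) (by linarith)
  rw [← hp, ← hq] at h2
  have h3 : p ^ a ≤ Q * q ^ (a - 1) := by
    have e : p ^ (2 : ℝ) = p ^ a * p ^ (1 - (a - 1)) := by
      rw [← Real.rpow_add hp0]; ring_nf
    have h4 : p ^ a * p ^ (1 - (a - 1)) ≤ Q * q ^ (a - 1) * p ^ (1 - (a - 1)) := by
      rw [← e, Real.rpow_two]
      nlinarith [mul_le_mul_of_nonneg_right h2 hQ0]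
    exact le_of_mul_le_mul_right h4 (Real.rpow_pos_of_pos hp0 _)
  calc p = (p ^ a) ^ (1 / a) := by
        rw [← Real.rpow_mul hp0.le, mul_one_div_cancel ha0.ne', Real.rpow_one]
    _ ≤ (Q * q ^ (a - 1)) ^ (1 / a) := Real.rpow_le_rpow (by positivity) h3 (by positivity)
    _ = _ := by
        rw [Real.mul_rpow hQ0 (by positivity), ← Real.rpow_mul hq0, mul_one_div]

theorem IsState.ne_zero {n : Type*} [Fintype n] {ρ : Matrix n n ℂ} (h : IsState ρ) : ρ ≠ 0 := by
  rintro rfl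
  simpa using h.2

/-- Since `g` is real, the bound can be checked for one candidate at a time; an infinite divergence
contributes `⊥`. -/
theorem iSup_neg_sub_le {ι : Type*} {p : ι → Prop} {D : ι → EReal} {g : ℝ} {y : EReal}
    (h : ∀ i, p i → D i = ⊤ ∨ ∃ r : ℝ, D i = r ∧ ((-r : ℝ) : EReal) - (g : EReal) ≤ y) :
    (⨆ (i) (_ : p i), -D i) - (g : EReal) ≤ y := by
  refine EReal.sub_le_of_le_add (iSup₂_le fun i hi => ?_)
  obtain h | ⟨r, h, hr⟩ := h i hi
  · rw [h]; simp
  · rw [h, ← EReal.coe_neg]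
    calc ((-r : ℝ) : EReal) = (((-r : ℝ) : EReal) - (g : EReal)) + (g : EReal) := by
          rw [← EReal.coe_sub, ← EReal.coe_add, sub_add_cancel]
      _ ≤ _ := add_le_add_left hr _

theorem sandUp_sub_le_hMinSmooth {ρ : Matrix (X × S) (X × S) ℂ} (hρ : IsState ρ) {a ε : ℝ}
    (ha : 1 < a) (hε : 0 < ε) :
    sandUp a ρ - ((gFun ε / (a - 1) : ℝ) : EReal) ≤ hMinSmooth ε ρ := by
  refine iSup_neg_sub_le fun σ hσ => ?_
  have hσ1 : ((1 : Matrix X X ℂ) ⊗ₖ σ).PosSemidef := one_kron_posSemidef hσ.1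
  by_cases hs : SuppLE ρ ((1 : Matrix X X ℂ) ⊗ₖ σ)
  · right
    rw [sandDiv, if_pos hs, if_neg ha.ne']
    refine ⟨_, rfl, le_hMinSmooth_of_projection_bound hρ hσ ha ?_ (fun P hP hPP =>
      rtr_projection_mul_le_sandwiched hρ.1 hσ1 hs hP hPP ha) hε⟩
    -- Positivity of $Q$: as $\rho\ll\mathbb I\otimes\sigma$, undoing the sandwiching recovers
    -- $\rho$, so the sandwiched operator is nonzero.
    refine rtr_mpow_pos ?_ (fun h0 => hρ.ne_zero ?_) _
    · have := hρ.1.mul_mul_conjTranspose_same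
        (mpow ((1 : Matrix X X ℂ) ⊗ₖ σ) ((1 - a) / (2 * a)))
      rwa [(mpow_isHermitian _ _).eq] at this
    · set s := (1 - a) / (2 * a)
      calc ρ = mpow ((1 : Matrix X X ℂ) ⊗ₖ σ) 0 * ρ * mpow ((1 : Matrix X X ℂ) ⊗ₖ σ) 0 := by
            rw [hs.mpow_zero_mul hσ1 hρ.1.isHermitian, hs.mul_mpow_zero hσ1]
        _ = (mpow ((1 : Matrix X X ℂ) ⊗ₖ σ) (-s) * mpow ((1 : Matrix X X ℂ) ⊗ₖ σ) s) * ρ *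
            (mpow ((1 : Matrix X X ℂ) ⊗ₖ σ) s * mpow ((1 : Matrix X X ℂ) ⊗ₖ σ) (-s)) := by
            rw [mpow_mul_mpow hσ1, mpow_mul_mpow hσ1, add_neg_cancel, neg_add_cancel]
        _ = mpow ((1 : Matrix X X ℂ) ⊗ₖ σ) (-s) * (mpow ((1 : Matrix X X ℂ) ⊗ₖ σ) s * ρ *
            mpow ((1 : Matrix X X ℂ) ⊗ₖ σ) s) * mpow ((1 : Matrix X X ℂ) ⊗ₖ σ) (-s) := by
            simp only [Matrix.mul_assoc]
        _ = 0 := by rw [h0]; simp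
  · left
    rw [sandDiv, if_neg hs]

theorem petzUp_sub_le_hMinSmooth {ρ : Matrix (X × S) (X × S) ℂ} (hρ : IsState ρ) {a ε : ℝ}
    (ha : 1 < a) (ha2 : a ≤ 2) (hε : 0 < ε) :
    petzUp a ρ - ((gFun ε / (a - 1) : ℝ) : EReal) ≤ hMinSmooth ε ρ := by
  refine iSup_neg_sub_le fun σ hσ => ?_
  have hσ1 : ((1 : Matrix X X ℂ) ⊗ₖ σ).PosSemidef := one_kron_posSemidef hσ.1
  by_cases hs : SuppLE ρ ((1 : Matrix X X ℂ) ⊗ₖ σ)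
  · right
    rw [petzDiv, if_pos hs, if_neg ha.ne']
    exact ⟨_, rfl, le_hMinSmooth_of_projection_bound hρ hσ ha
      (rtr_mul_mpow_pos (mpow_posSemidef hρ.1 _) hσ1 (mpow_ne_zero hρ.1 hρ.ne_zero _)
        ((suppLE_mpow_self hρ.1 _).trans hs) _) (fun P hP hPP =>
      rtr_projection_mul_le_petz hρ.1 hσ1 hs hP hPP ha ha2) hε⟩
  · left
    rw [petzDiv, if_neg hs]

theorem sandDown_le_sandUp {ρ : Matrix (X × S) (X × S) ℂ} (hρ : IsState ρ) (a : ℝ) :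
    sandDown a ρ ≤ sandUp a ρ := le_iSup₂_of_le (trFst ρ) (isState_trFst hρ) le_rfl

theorem petzDown_le_petzUp {ρ : Matrix (X × S) (X × S) ℂ} (hρ : IsState ρ) (a : ℝ) :
    petzDown a ρ ≤ petzUp a ρ := le_iSup₂_of_le (trFst ρ) (isState_trFst hρ) le_rfl

end MinEntropy

/-! ### Pinching, block-diagonal matrices and the copying isometry -/

section Blocks

variable {C Y : Type*} [Fintype C] [DecidableEq C] [Fintype Y] [DecidableEq Y]

theorem pinch_apply (M : Matrix (C × Y) (C × Y) ℂ) (i j : C × Y) :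
    pinch M i j = if i.2 = j.2 then M i j else 0 := by
  have key : ∀ y, (((1 : Matrix C C ℂ) ⊗ₖ Matrix.single y y (1 : ℂ)) * M *
      ((1 : Matrix C C ℂ) ⊗ₖ Matrix.single y y (1 : ℂ))) i j =
      if y = i.2 ∧ y = j.2 then M i j else 0 := by
    intro y
    have hd : ((1 : Matrix C C ℂ) ⊗ₖ Matrix.single y y (1 : ℂ)) =
        Matrix.diagonal fun i : C × Y => if y = i.2 then (1 : ℂ) else 0 := by
      ext ⟨c, k⟩ ⟨c', k'⟩
      simp only [Matrix.kroneckerMap_apply, Matrix.one_apply, Matrix.single_apply,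
        Matrix.diagonal_apply, Prod.mk.injEq]
      by_cases h1 : c = c' <;> by_cases h2 : y = k <;> by_cases h3 : y = k' <;> grind
    rw [hd, Matrix.mul_diagonal, Matrix.diagonal_mul]
    by_cases h1 : y = i.2 <;> by_cases h2 : y = j.2 <;> simp [h1, h2]
  rw [pinch, Matrix.sum_apply, Finset.sum_congr rfl fun y _ => key y]
  by_cases h : i.2 = j.2
  · simp [h]
  · rw [if_neg h]
    exact Finset.sum_eq_zero fun y _ => if_neg fun h' => h (h'.1.symm.trans h'.2)

theorem pinch_eq_blockDiagonal (M : Matrix (C × Y) (C × Y) ℂ) :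
    pinch M = Matrix.blockDiagonal (block M) := by
  ext i j
  rw [pinch_apply, Matrix.blockDiagonal_apply]
  split_ifs with h
  · have : j = (j.1, i.2) := by rw [h]
    conv_lhs => rw [this]
    rfl
  · rfl

theorem sum_kron_single (N : Y → Matrix C C ℂ) :
    ∑ y, N y ⊗ₖ Matrix.single y y (1 : ℂ) = Matrix.blockDiagonal N := by
  ext ⟨c, k⟩ ⟨c', k'⟩
  rw [Matrix.sum_apply, Matrix.blockDiagonal_apply, Finset.sum_eq_single k]
  · by_cases h : k = k' <;> simp [h]
  · intro y _ hy
    simp [hy]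
  · simp

/-- Diagonalisations of the blocks assemble to one of the whole matrix. -/
theorem mpow_blockDiagonal {N : Y → Matrix C C ℂ} (hN : ∀ y, (N y).IsHermitian) (p : ℝ) :
    mpow (Matrix.blockDiagonal N) p = Matrix.blockDiagonal fun y => mpow (N y) p := by
  choose U d hU hU' hf hd h0 h1 using fun y => exists_diagonalization (hN y)
  have e1 : Matrix.blockDiagonal N = Matrix.blockDiagonal U *
      Matrix.diagonal (fun i : C × Y => (d i.2 i.1 : ℂ)) * (Matrix.blockDiagonal U)ᴴ := by
    rw [Matrix.blockDiagonal_conjTranspose,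
      ← Matrix.blockDiagonal_diagonal (fun y c => (d y c : ℂ)),
      ← Matrix.blockDiagonal_mul, ← Matrix.blockDiagonal_mul]
    exact congrArg _ (funext hd)
  have e2 : (Matrix.blockDiagonal U)ᴴ * Matrix.blockDiagonal U = 1 := by
    rw [Matrix.blockDiagonal_conjTranspose, ← Matrix.blockDiagonal_mul, funext hU]
    exact Matrix.blockDiagonal_one
  rw [e1, mpow_conj_isometry e2 (isHermitian_diagonal_ofReal _), mpow_diagonal,
    Matrix.blockDiagonal_conjTranspose,
    ← Matrix.blockDiagonal_diagonal (fun y c => ((spow p (d y c) : ℝ) : ℂ)),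
    ← Matrix.blockDiagonal_mul, ← Matrix.blockDiagonal_mul]
  exact congrArg _ (funext fun y => (hf y _).symm)

theorem rtr_blockDiagonal (N : Y → Matrix C C ℂ) :
    rtr (Matrix.blockDiagonal N) = ∑ y, rtr (N y) := by
  simp only [rtr, Matrix.trace_blockDiagonal, Complex.re_sum]

theorem block_blockDiagonal (N : Y → Matrix C C ℂ) (y : Y) :
    block (Matrix.blockDiagonal N) y = N y := by
  ext c c'
  simp [block]

theorem rtr_mul_blockDiagonal (M : Matrix (C × Y) (C × Y) ℂ) (N : Y → Matrix C C ℂ) :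
    rtr (M * Matrix.blockDiagonal N) = ∑ y, rtr (block M y * N y) := by
  have key : M.trace = ∑ y, (block M y).trace := by
    simp only [Matrix.trace, Fintype.sum_prod_type_right, Matrix.diag_apply, block,
      Matrix.submatrix_apply]
  have key' : ∀ K : Matrix (C × Y) (C × Y) ℂ, rtr K = ∑ y, rtr (block K y) := fun K => by
    simp only [rtr, ← Complex.re_sum]
    congr 1
    simp only [Matrix.trace, Fintype.sum_prod_type_right, Matrix.diag_apply, block,
      Matrix.submatrix_apply]
  rw [key']
  refine Finset.sum_congr rfl fun y _ => congrArg _ ?_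
  ext c c'
  simp only [block, Matrix.submatrix_apply, Matrix.mul_apply, Fintype.sum_prod_type,
    Matrix.blockDiagonal_apply]
  refine Finset.sum_congr rfl fun x _ => ?_
  simp

theorem block_posSemidef {M : Matrix (C × Y) (C × Y) ℂ} (hM : M.PosSemidef) (y : Y) :
    (block M y).PosSemidef := hM.submatrix _

theorem mpow_pinch {M : Matrix (C × Y) (C × Y) ℂ} (hM : M.PosSemidef) (p : ℝ) :
    mpow (pinch M) p = Matrix.blockDiagonal fun y => mpow (block M y) p := by
  rw [pinch_eq_blockDiagonal, mpow_blockDiagonal fun y => (block_posSemidef hM y).isHermitian]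

theorem pinch_mpow_pinch {M : Matrix (C × Y) (C × Y) ℂ} (hM : M.PosSemidef) (p : ℝ) :
    pinch (mpow (pinch M) p) = mpow (pinch M) p := by
  rw [mpow_pinch hM, pinch_eq_blockDiagonal]
  exact congrArg _ (funext fun y => block_blockDiagonal _ y)

theorem copyV_mul_apply {n : Type*} (M : Matrix (C × Y) n ℂ) (i : Y × (C × Y)) (j : n) :
    (copyV Y C * M) i j = if i.1 = i.2.2 then M i.2 j else 0 := by
  rw [Matrix.mul_apply, Finset.sum_eq_single i.2]
  · by_cases h : i.1 = i.2.2 <;> simp [copyV, h]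
  · intro k _ hk
    simp [copyV, hk.symm]
  · simp

theorem copyV_conjTranspose_mul_apply {n : Type*} (M : Matrix (Y × (C × Y)) n ℂ) (i : C × Y)
    (j : n) : ((copyV Y C)ᴴ * M) i j = M (i.2, i) j := by
  rw [Matrix.mul_apply, Finset.sum_eq_single (i.2, i)]
  · simp [copyV]
  · rintro ⟨y, k⟩ _ hk
    have : ¬ (y = i.2 ∧ k = i) := fun h => hk (Prod.ext h.1 h.2)
    simp [copyV, Matrix.conjTranspose_apply, this]
  · simp

theorem mul_copyV_apply {n : Type*} (M : Matrix n (Y × (C × Y)) ℂ) (i : n) (j : C × Y) :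
    (M * copyV Y C) i j = M i (j.2, j) := by
  have := copyV_conjTranspose_mul_apply Mᴴ j i
  rw [← Matrix.conjTranspose_mul, Matrix.conjTranspose_apply, Matrix.conjTranspose_apply] at this
  exact star_injective this

theorem mul_copyV_conjTranspose_apply {n : Type*} (M : Matrix n (C × Y) ℂ) (i : n)
    (j : Y × (C × Y)) : (M * (copyV Y C)ᴴ) i j = if j.1 = j.2.2 then M i j.2 else 0 := by
  have := copyV_mul_apply Mᴴ j i
  rw [← star_star ((M * (copyV Y C)ᴴ) i j), ← Matrix.conjTranspose_apply,
    Matrix.conjTranspose_mul, Matrix.conjTranspose_conjTranspose, this]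
  split_ifs <;> simp

theorem copyV_conjTranspose_mul_self : (copyV Y C)ᴴ * copyV Y C = 1 := by
  ext i j
  rw [copyV_conjTranspose_mul_apply, copyV, Matrix.one_apply]
  by_cases h : i = j <;> simp [h]

/-- The dual view of `trFst_copyV_conj`. That identity computes marginals; this one brings the
pinching into the sandwiched traces. -/
theorem copyV_conj_one_kron (M : Matrix (C × Y) (C × Y) ℂ) :
    (copyV Y C)ᴴ * ((1 : Matrix Y Y ℂ) ⊗ₖ M) * copyV Y C = pinch M := by
  ext i j
  rw [mul_copyV_apply, copyV_conjTranspose_mul_apply, pinch_apply, Matrix.kroneckerMap_apply,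
    Matrix.one_apply]
  split_ifs <;> simp

theorem trFst_copyV_conj (M : Matrix (C × Y) (C × Y) ℂ) :
    trFst (copyV Y C * M * (copyV Y C)ᴴ) = pinch M := by
  ext i j
  rw [trFst_apply, pinch_apply]
  simp only [mul_copyV_conjTranspose_apply, copyV_mul_apply]
  rw [Finset.sum_eq_single j.2]
  · by_cases h : i.2 = j.2
    · simp [h]
    · have h' : ¬ j.2 = i.2 := fun e => h e.symm
      simp [h, h']
  · intro y _ hy
    simp [hy]
  · simp

theorem pinch_posSemidef {M : Matrix (C × Y) (C × Y) ℂ} (hM : M.PosSemidef) :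
    (pinch M).PosSemidef := by
  rw [← trFst_copyV_conj]
  exact trFst_posSemidef (hM.mul_mul_conjTranspose_same _)

theorem schatten_of_posSemidef {n : Type*} [Fintype n] [DecidableEq n] {M : Matrix n n ℂ}
    (hM : M.PosSemidef) (b : ℝ) : schatten b M = rtr (mpow M b) ^ (1 / b) := by
  have h : Mᴴ * M = mpow M 2 := by
    conv_lhs => rw [hM.isHermitian.eq, ← mpow_one hM, mpow_mul_mpow hM]
    norm_num
  rw [schatten, h, mpow_mpow hM]
  ring_nf

/-- The two operators are $XX^\dagger$ and $X^\dagger X$ for $X=\sqrt M\sqrt N$. -/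
theorem rtr_mpow_sandwich_comm {n : Type*} [Fintype n] [DecidableEq n] {M N : Matrix n n ℂ}
    (hM : M.PosSemidef) (hN : N.PosSemidef) (b : ℝ) :
    rtr (mpow (mpow M (1 / 2) * N * mpow M (1 / 2)) b) =
      rtr (mpow (mpow N (1 / 2) * M * mpow N (1 / 2)) b) := by
  have key : ∀ {M N : Matrix n n ℂ}, M.PosSemidef → N.PosSemidef →
      mpow M (1 / 2) * N * mpow M (1 / 2) =
        (mpow M (1 / 2) * mpow N (1 / 2)) * (mpow M (1 / 2) * mpow N (1 / 2))ᴴ := by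
    intro M N hM hN
    rw [Matrix.conjTranspose_mul, (mpow_isHermitian M _).eq, (mpow_isHermitian N _).eq]
    conv_lhs => rw [← mpow_half_mul_self hN]
    simp only [Matrix.mul_assoc]
  rw [key hM hN, rtr_mpow_mul_conjTranspose, key hN hM]
  simp only [Matrix.conjTranspose_mul, (mpow_isHermitian _ _).eq]

/-- The sandwiched trace quantity of `V G V†` in terms of `G` and the pinching. -/
theorem rtr_mpow_sandwich_copyV {G σ : Matrix (C × Y) (C × Y) ℂ} (hG : G.PosSemidef)
    (hσ : σ.PosSemidef) (s b : ℝ) :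
    rtr (mpow (((1 : Matrix Y Y ℂ) ⊗ₖ mpow σ s) * (copyV Y C * G * (copyV Y C)ᴴ) *
      ((1 : Matrix Y Y ℂ) ⊗ₖ mpow σ s)) b) =
    rtr (mpow (mpow G (1 / 2) * pinch (mpow σ (s + s)) * mpow G (1 / 2)) b) := by
  set K := (1 : Matrix Y Y ℂ) ⊗ₖ mpow σ s with hK
  have hKh : Kᴴ = K := by
    rw [hK, ← mpow_one_kron hσ.isHermitian, (mpow_isHermitian _ _).eq]
  have hKK : K * K = (1 : Matrix Y Y ℂ) ⊗ₖ mpow σ (s + s) := by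
    rw [hK, ← mpow_mul_mpow hσ, one_kron_mul]
  -- This is $XX^\dagger$ for $X=(\mathbb I\otimes\sigma^s)V\sqrt G$; in $X^\dagger X$ the isometry
  -- compresses $\mathbb I\otimes\sigma^{2s}$ to its pinching.
  have e1 : K * (copyV Y C * G * (copyV Y C)ᴴ) * K =
      (K * copyV Y C * mpow G (1 / 2)) * (K * copyV Y C * mpow G (1 / 2))ᴴ := by
    simp only [Matrix.conjTranspose_mul, hKh, (mpow_isHermitian _ _).eq]
    conv_lhs => rw [← mpow_half_mul_self hG]
    simp only [Matrix.mul_assoc]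
  have e2 : (K * copyV Y C * mpow G (1 / 2))ᴴ * (K * copyV Y C * mpow G (1 / 2)) =
      mpow G (1 / 2) * pinch (mpow σ (s + s)) * mpow G (1 / 2) := by
    rw [← copyV_conj_one_kron, ← hKK]
    simp only [Matrix.conjTranspose_mul, hKh, (mpow_isHermitian _ _).eq, Matrix.mul_assoc]
  rw [e1, rtr_mpow_mul_conjTranspose, e2]

/-- The root in the norm cancels the factor `b`. If the trace vanishes, both logarithms take the
default value zero. -/
theorem mul_logb_schatten {n : Type*} [Fintype n] [DecidableEq n] {M : Matrix n n ℂ}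
    (hM : M.PosSemidef) {b : ℝ} (hb : b ≠ 0) :
    b / (1 - b) * Real.logb 2 (schatten b M) = 1 / (1 - b) * Real.logb 2 (rtr (mpow M b)) := by
  rw [schatten_of_posSemidef hM]
  obtain h | h := (rtr_nonneg (mpow_posSemidef hM b)).eq_or_lt
  · rw [← h, Real.zero_rpow (one_div_ne_zero hb)]; simp
  · rw [Real.logb_rpow_eq_mul_logb_of_pos h]
    field_simp

theorem sandwich_posSemidef {n : Type*} [Fintype n] [DecidableEq n] {G N : Matrix n n ℂ}
    (hN : N.PosSemidef) (p : ℝ) : (mpow G p * N * mpow G p).PosSemidef := by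
  have := hN.mul_mul_conjTranspose_same (mpow G p)
  rwa [(mpow_isHermitian G _).eq] at this

variable {G : Matrix (C × Y) (C × Y) ℂ}

theorem copyV_conj_posSemidef (hG : G.PosSemidef) :
    (copyV Y C * G * (copyV Y C)ᴴ).PosSemidef := hG.mul_mul_conjTranspose_same _

theorem trFst_mpow_copyV_conj (hG : G.PosSemidef) (b : ℝ) :
    trFst (mpow (copyV Y C * G * (copyV Y C)ᴴ) b) = pinch (mpow G b) := by
  rw [mpow_conj_isometry copyV_conjTranspose_mul_self hG.isHermitian, trFst_copyV_conj]

theorem petzDown_copyV_conj (hG : G.PosSemidef) {b : ℝ} (hb : b ≠ 1) :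
    petzDown b (copyV Y C * G * (copyV Y C)ᴴ) = ((1 / (1 - b) * Real.logb 2
      (∑ y, rtr (block (mpow G b) y * mpow (block G y) (1 - b))) : ℝ) : EReal) := by
  rw [petzDown_of_ne hb (copyV_conj_posSemidef hG), trFst_mpow_copyV_conj hG, trFst_copyV_conj,
    mpow_pinch hG, rtr_mul_blockDiagonal]
  simp only [pinch_eq_blockDiagonal, block_blockDiagonal]

theorem neg_sandDiv_copyV_conj (hG : G.PosSemidef) {σ : Matrix (C × Y) (C × Y) ℂ}
    (hσ : σ.PosSemidef) (h : SuppLE (pinch G) σ) {b : ℝ} (hb0 : 0 < b) (hb : b ≠ 1) :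
    -sandDiv b (copyV Y C * G * (copyV Y C)ᴴ) ((1 : Matrix Y Y ℂ) ⊗ₖ σ) =
      ((1 / (1 - b) * Real.logb 2 (rtr (mpow (mpow G (1 / 2) * pinch (mpow σ ((1 - b) / b)) *
        mpow G (1 / 2)) b)) : ℝ) : EReal) := by
  have hs : (1 - b) / (2 * b) + (1 - b) / (2 * b) = (1 - b) / b := by field_simp; ring
  rw [sandDiv_of_ne hb (copyV_conj_posSemidef hG) hσ (by rwa [trFst_copyV_conj]),
    rtr_mpow_sandwich_copyV hG hσ, hs, ← EReal.coe_neg, ← neg_sub b 1, one_div_neg_eq_neg_one_div, neg_mul]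


/-- States violating the support condition contribute $-\infty$ to the defining supremum, so
excluding them changes nothing. -/
theorem sandUp_copyV_conj (hG : G.PosSemidef) {b : ℝ} (hb0 : 0 < b) (hb : b ≠ 1) :
    sandUp b (copyV Y C * G * (copyV Y C)ᴴ) =
      ⨆ (σ : Matrix (C × Y) (C × Y) ℂ) (_ : IsState σ ∧ SuppLE (pinch G) σ),
        ((1 / (1 - b) * Real.logb 2 (rtr (mpow (mpow G (1 / 2) * pinch (mpow σ ((1 - b) / b)) *
          mpow G (1 / 2)) b)) : ℝ) : EReal) := by
  apply le_antisymm
  · refine iSup₂_le fun σ hσ => ?_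
    by_cases h : SuppLE (pinch G) σ
    · rw [neg_sandDiv_copyV_conj hG hσ.1 h hb0 hb]
      exact le_iSup₂_of_le σ ⟨hσ, h⟩ le_rfl
    · rw [sandDiv_of_not (copyV_conj_posSemidef hG) hσ.1 (by rwa [trFst_copyV_conj])]
      simp
  · refine iSup₂_le fun σ hσ => ?_
    rw [← neg_sandDiv_copyV_conj hG hσ.1.1 hσ.2 hb0 hb]
    exact le_iSup₂_of_le σ hσ.1 le_rfl

theorem sandDown_copyV_conj (hG : G.PosSemidef) {b : ℝ} (hb0 : 0 < b) (hb : b ≠ 1) :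
    sandDown b (copyV Y C * G * (copyV Y C)ᴴ) =
      ((1 / (1 - b) * Real.logb 2 (rtr (mpow (mpow G (1 / 2) * mpow (pinch G) ((1 - b) / b) *
        mpow G (1 / 2)) b)) : ℝ) : EReal) := by
  rw [sandDown, trFst_copyV_conj, neg_sandDiv_copyV_conj hG (pinch_posSemidef hG) (suppLE_refl _)
    hb0 hb, pinch_mpow_pinch hG]

end Blocks

/-! ### The key map and the vector of the full state -/

section KeyMap

variable {A B E Y : Type*} [Fintype A] [DecidableEq A] [Fintype B] [DecidableEq B]
  [Fintype E] [DecidableEq E] [Fintype Y] [DecidableEq Y]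

theorem sqrtL_isHermitian {Λ : Y → Matrix B B ℂ} (y : Y) : (sqrtL A Λ y).IsHermitian := by
  rw [Matrix.IsHermitian, sqrtL, Matrix.conjTranspose_kronecker, (mpow_isHermitian _ _).eq,
    Matrix.conjTranspose_one]

theorem block_keyMap (Λ : Y → Matrix B B ℂ) (M : Matrix (A × B) (A × B) ℂ) (y : Y) :
    block (keyMap Λ M) y = sqrtL A Λ y * M * sqrtL A Λ y := by
  nth_rewrite 2 [← (sqrtL_isHermitian (A := A) (Λ := Λ) y).eq]
  rfl

/-- $K^\dagger K=\mathbb I\otimes\sum_y\Lambda_y$. Without post-selection $K$ is an isometry, so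
powers pass through $\mathcal G$. -/
theorem keyOp_conjTranspose_mul_self {Λ : Y → Matrix B B ℂ} (hΛ : ∀ y, (Λ y).PosSemidef)
    (h1 : ∑ y, Λ y = 1) : (keyOp A Λ)ᴴ * keyOp A Λ = 1 := by
  have key : (keyOp A Λ)ᴴ * keyOp A Λ = ∑ y, (sqrtL A Λ y)ᴴ * sqrtL A Λ y := by
    ext i j
    rw [Matrix.sum_apply]
    simp only [Matrix.mul_apply]
    rw [Fintype.sum_prod_type_right]
    rfl
  have h2 : ∀ y, (sqrtL A Λ y)ᴴ * sqrtL A Λ y = (1 : Matrix A A ℂ) ⊗ₖ Λ y := fun y => by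
    rw [(sqrtL_isHermitian y).eq, sqrtL, one_kron_mul, mpow_half_mul_self (hΛ y)]
  rw [key, Finset.sum_congr rfl fun y _ => h2 y]
  ext ⟨a, b⟩ ⟨a', b'⟩
  have h3 := congrFun (congrFun h1 b) b'
  rw [Matrix.sum_apply] at h3
  rw [Matrix.sum_apply]
  simp only [Matrix.kroneckerMap_apply, ← Finset.mul_sum, h3, Matrix.one_apply, Prod.mk.injEq]
  by_cases ha : a = a' <;> by_cases hb : b = b' <;> simp [ha, hb]

theorem trSnd_kron_one_conj {m n : Type*} [Fintype m] [Fintype n] (M : Matrix m n ℂ)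
    (N : Matrix (n × E) (n × E) ℂ) :
    trSnd ((M ⊗ₖ (1 : Matrix E E ℂ)) * N * (M ⊗ₖ (1 : Matrix E E ℂ))ᴴ) = M * trSnd N * Mᴴ := by
  ext i j
  have h : ∀ e, ((M ⊗ₖ (1 : Matrix E E ℂ)) * N * (M ⊗ₖ (1 : Matrix E E ℂ))ᴴ) (i, e) (j, e) =
      (M * (Matrix.of fun k l => N (k, e) (l, e)) * Mᴴ) i j := by
    intro e
    simp only [Matrix.mul_apply, Fintype.sum_prod_type, Matrix.conjTranspose_apply,
      Matrix.kroneckerMap_apply, Matrix.one_apply, Matrix.of_apply]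
    simp [apply_ite (starRingEnd ℂ)]
  have e : trSnd N = ∑ e, Matrix.of fun k l => N (k, e) (l, e) := by
    ext k l
    simp [trSnd, Matrix.sum_apply]
  rw [e, Matrix.mul_sum, Matrix.sum_mul, Matrix.sum_apply]
  exact Finset.sum_congr rfl fun e _ => h e

theorem trace_trSnd {m : Type*} [Fintype m] (N : Matrix (m × E) (m × E) ℂ) :
    (trSnd N).trace = N.trace := by
  simp [Matrix.trace, trSnd, Fintype.sum_prod_type]

theorem mul_vecMulVec_star_mul {m n : Type*} [Fintype n] (M : Matrix m n ℂ) (v : n → ℂ) :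
    M * Matrix.vecMulVec v (star v) * Mᴴ = Matrix.vecMulVec (M *ᵥ v) (star (M *ᵥ v)) := by
  rw [Matrix.mul_vecMulVec, Matrix.vecMulVec_mul, Matrix.star_mulVec]

/-- The vector of the pure state `V 𝒢(|ψ⟩⟨ψ|) V†`. -/
noncomputable def fullVec (Λ : Y → Matrix B B ℂ) (ψ : (A × B) × E → ℂ) :
    (Y × ((A × B) × Y)) × E → ℂ :=
  (copyV Y (A × B) ⊗ₖ (1 : Matrix E E ℂ)) *ᵥ ((keyOp A Λ ⊗ₖ (1 : Matrix E E ℂ)) *ᵥ ψ)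

theorem rhoFull_eq (Λ : Y → Matrix B B ℂ) (ψ : (A × B) × E → ℂ) :
    rhoFull Λ ψ = Matrix.vecMulVec (fullVec Λ ψ) (star (fullVec Λ ψ)) := by
  rw [rhoFull, keyMapE, rhoABE, mul_vecMulVec_star_mul, mul_vecMulVec_star_mul]
  rfl

theorem rhoYE_eq (Λ : Y → Matrix B B ℂ) (ψ : (A × B) × E → ℂ) :
    rhoYE Λ ψ = marg (swapCE (fullVec Λ ψ)) := by
  rw [rhoYE, rhoFull_eq, trMid_vecMulVec]

theorem rhoYABY_eq (Λ : Y → Matrix B B ℂ) (ψ : (A × B) × E → ℂ) :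
    rhoYABY Λ ψ = marg (fullVec Λ ψ) := by
  rw [rhoYABY, rhoFull_eq, trSnd_vecMulVec]

theorem rhoYABY_eq_copyV_conj (Λ : Y → Matrix B B ℂ) (ψ : (A × B) × E → ℂ) :
    rhoYABY Λ ψ = copyV Y (A × B) * keyMap Λ (rhoAB ψ) * (copyV Y (A × B))ᴴ := by
  rw [rhoYABY, rhoFull, trSnd_kron_one_conj, keyMapE, trSnd_kron_one_conj]
  rfl

theorem trace_rhoFull (Λ : Y → Matrix B B ℂ) (ψ : (A × B) × E → ℂ) :
    (rhoFull Λ ψ).trace = (rtr (marg (fullVec Λ ψ)) : ℂ) := by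
  rw [← trace_trSnd, ← trace_eq_rtr (marg_posSemidef _), ← rhoYABY_eq]
  rfl

theorem rhoAB_posSemidef (ψ : (A × B) × E → ℂ) : (rhoAB ψ).PosSemidef := by
  have h : rhoAB ψ = (Matrix.of fun i e => ψ (i, e) : Matrix (A × B) E ℂ) *
      (Matrix.of fun i e => ψ (i, e) : Matrix (A × B) E ℂ)ᴴ := by
    ext i j
    rfl
  rw [h]
  exact Matrix.posSemidef_self_mul_conjTranspose _

theorem keyMap_posSemidef (Λ : Y → Matrix B B ℂ) {M : Matrix (A × B) (A × B) ℂ}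
    (hM : M.PosSemidef) : (keyMap Λ M).PosSemidef := hM.mul_mul_conjTranspose_same _

theorem rtr_keyMap_mul (Λ : Y → Matrix B B ℂ) (M : Matrix (A × B) (A × B) ℂ)
    (N : Matrix ((A × B) × Y) ((A × B) × Y) ℂ) :
    rtr (keyMap Λ M * N) = rtr (M * keyMapDual Λ N) := by
  have h : keyMap Λ M * N = keyOp A Λ * (M * (keyOp A Λ)ᴴ * N) := by
    simp only [keyMap, Matrix.mul_assoc]
  rw [h, rtr_mul_comm]
  simp only [keyMapDual, Matrix.mul_assoc]

/-- A vanishing sum of extended reals forces both terms to be finite. -/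
theorem eq_neg_mul_of_add_eq_zero {x y : EReal} (h : x + y = 0) (k : ℝ) :
    (k : EReal) * x = -((k : EReal) * y) := by
  induction x <;> induction y
  case coe.coe x y =>
    rw [← EReal.coe_add, EReal.coe_eq_zero] at h
    rw [← EReal.coe_mul, ← EReal.coe_mul, ← EReal.coe_neg, eq_neg_of_add_eq_zero_left h]
    congr 1
    ring
  all_goals simp at h

end KeyMap

end KeyDuality

/-! ### Assembly of the claims -/

theorem mainTheorem5 {A B E Y : Type*}
    [Fintype A] [DecidableEq A] [Fintype B] [DecidableEq B]
    [Fintype E] [DecidableEq E] [Fintype Y] [DecidableEq Y]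
    (Λ : Y → Matrix B B ℂ) (hΛ : ∀ y, (Λ y).PosSemidef) (hΛ1 : (1 - ∑ y, Λ y).PosSemidef)
    (ψ : (A × B) × E → ℂ) (hψ : ∑ i, ‖ψ i‖ ^ 2 = 1)
    (hne : (rhoFull Λ ψ).trace ≠ 0) :
    let ρ : Matrix (A × B) (A × B) ℂ := rhoAB ψ
    let G : Matrix ((A × B) × Y) ((A × B) × Y) ℂ := keyMap Λ ρ
    let YE : Matrix (Y × E) (Y × E) ℂ := rhoYE Λ ψ
    let YC : Matrix (Y × ((A × B) × Y)) (Y × ((A × B) × Y)) ℂ := rhoYABY Λ ψ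
    -- the marginals without `E`
    (YC = copyV Y (A × B) * G * (copyV Y (A × B))ᴴ ∧ trFst YC = pinch G) ∧
    -- duality relations for the systems `Y`, `E`, `ABY₁`
    (∀ a b : ℝ, a ∈ Set.Icc 0 2 → b ∈ Set.Icc 0 2 → a + b = 2 →
      petzDown a YE + petzDown b YC = 0) ∧
    (∀ a b : ℝ, 1 / 2 ≤ a → 1 / 2 ≤ b → 1 / a + 1 / b = 2 →
      (a = 1 → (rhoFull Λ ψ).trace = 1) → sandUp a YE + sandUp b YC = 0) ∧
    (∀ a b : ℝ, 0 < a → 0 < b → a * b = 1 → (a = 1 → (rhoFull Λ ψ).trace = 1) →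
      sandDown a YE + petzUp b YC = 0 ∧ petzUp a YE + sandDown b YC = 0) ∧
    -- `H_b^↓(Y|ABY₁)`
    (∀ b : ℝ, 0 ≤ b → b ≠ 1 →
      petzDown b YC =
        ((1 / (1 - b) * Real.logb 2 (rtr (mpow G b * mpow (pinch G) (1 - b))) : ℝ) : EReal) ∧
      petzDown b YC =
        ((1 / (1 - b) * Real.logb 2 (rtr (mpow G b *
          ∑ y, mpow (sqrtL A Λ y * ρ * sqrtL A Λ y) (1 - b) ⊗ₖ Matrix.single y y (1 : ℂ))) : ℝ) :
            EReal) ∧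
      petzDown b YC =
        ((1 / (1 - b) * Real.logb 2
          (rtr (pinch (mpow G b) * mpow (pinch G) (1 - b))) : ℝ) : EReal) ∧
      petzDown b YC =
        ((1 / (1 - b) * Real.logb 2 (∑ y, rtr (block (mpow G b) y *
          mpow (sqrtL A Λ y * ρ * sqrtL A Λ y) (1 - b))) : ℝ) : EReal) ∧
      -- without post-selection
      (∑ y, Λ y = 1 →
        petzDown b YC =
          ((1 / (1 - b) * Real.logb 2
            (rtr (keyMap Λ (mpow ρ b) * mpow (pinch G) (1 - b))) : ℝ) : EReal) ∧
        petzDown b YC =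
          ((1 / (1 - b) * Real.logb 2
            (rtr (mpow ρ b * keyMapDual Λ (mpow (pinch G) (1 - b)))) : ℝ) : EReal) ∧
        petzDown b YC =
          ((1 / (1 - b) * Real.logb 2 (∑ y, rtr (sqrtL A Λ y * mpow ρ b * sqrtL A Λ y *
            mpow (sqrtL A Λ y * ρ * sqrtL A Λ y) (1 - b))) : ℝ) : EReal))) ∧
    -- `H̃_b^↑(Y|ABY₁)`
    (∀ b : ℝ, 0 < b → b ≠ 1 →
      sandUp b YC =
        (⨆ (σ : Matrix ((A × B) × Y) ((A × B) × Y) ℂ) (_ : IsState σ ∧ SuppLE (pinch G) σ),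
          ((b / (1 - b) * Real.logb 2 (schatten b
            (mpow G (1 / 2) * pinch (mpow σ ((1 - b) / b)) * mpow G (1 / 2))) : ℝ) : EReal)) ∧
      sandUp b YC =
        (⨆ (σ : Matrix ((A × B) × Y) ((A × B) × Y) ℂ) (_ : IsState σ ∧ SuppLE (pinch G) σ),
          ((1 / (1 - b) * Real.logb 2 (rtr (mpow
            (mpow (pinch (mpow σ ((1 - b) / b))) (1 / 2) * G *
              mpow (pinch (mpow σ ((1 - b) / b))) (1 / 2)) b)) : ℝ) : EReal))) ∧
    -- `H_b^↑(Y|ABY₁)`, with a density matrix at which the supremum is attained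
    (∀ b : ℝ, 0 < b → b ≠ 1 →
      petzUp b YC =
        ((b / (1 - b) * Real.logb 2 (rtr (mpow (trFst (mpow YC b)) (1 / b))) : ℝ) : EReal) ∧
      (∀ σ : Matrix ((A × B) × Y) ((A × B) × Y) ℂ,
        σ = ((rtr (mpow (trFst (mpow YC b)) (1 / b)) : ℝ) : ℂ)⁻¹ •
          mpow (trFst (mpow YC b)) (1 / b) →
        IsState σ ∧ petzUp b YC = -petzDiv b YC ((1 : Matrix Y Y ℂ) ⊗ₖ σ)) ∧
      petzUp b YC =
        ((b / (1 - b) * Real.logb 2 (rtr (mpow (pinch (mpow G b)) (1 / b))) : ℝ) : EReal) ∧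
      petzUp b YC =
        ((b / (1 - b) * Real.logb 2 (∑ y, rtr (mpow (block (mpow G b) y) (1 / b))) : ℝ) :
          EReal)) ∧
    -- `H̃_b^↓(Y|ABY₁)`
    (∀ b : ℝ, 0 < b → b ≠ 1 →
      sandDown b YC =
        ((b / (1 - b) * Real.logb 2 (schatten b
          (mpow G (1 / 2) * mpow (pinch G) ((1 - b) / b) * mpow G (1 / 2))) : ℝ) : EReal) ∧
      sandDown b YC =
        ((1 / (1 - b) * Real.logb 2 (rtr (mpow
          (mpow (pinch G) ((1 - b) / (2 * b)) * G * mpow (pinch G) ((1 - b) / (2 * b))) b)) : ℝ) :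
            EReal)) ∧
    -- lower bounds on the smooth min-entropy of `n` copies
    ((rhoFull Λ ψ).trace = 1 → ∀ (n : ℕ) (ε : ℝ), 0 < ε → ε ≤ 1 →
      (∀ a : ℝ, 1 < a → a ≤ 2 →
        petzDown a (iidPow n YE) - ((gFun ε / (a - 1) : ℝ) : EReal) ≤
          hMinSmooth ε (iidPow n YE) ∧
        petzDown a (iidPow n YE) = -(((n : ℝ) : EReal) * petzDown (2 - a) YC)) ∧
      (∀ a : ℝ, 1 < a →
        sandUp a (iidPow n YE) - ((gFun ε / (a - 1) : ℝ) : EReal) ≤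
          hMinSmooth ε (iidPow n YE) ∧
        sandUp a (iidPow n YE) = -(((n : ℝ) : EReal) * sandUp (a / (2 * a - 1)) YC)) ∧
      (∀ a : ℝ, 1 < a → a ≤ 2 →
        sandDown a (iidPow n YE) - ((gFun ε / (a - 1) : ℝ) : EReal) ≤
          hMinSmooth ε (iidPow n YE) ∧
        sandDown a (iidPow n YE) = -(((n : ℝ) : EReal) * petzUp (1 / a) YC)) ∧
      (∀ a : ℝ, 1 < a → a ≤ 2 →
        petzUp a (iidPow n YE) - ((gFun ε / (a - 1) : ℝ) : EReal) ≤
          hMinSmooth ε (iidPow n YE) ∧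
        petzUp a (iidPow n YE) = -(((n : ℝ) : EReal) * sandDown (1 / a) YC))) := by
  intro ρ G YE YC
  have hρ : ρ.PosSemidef := rhoAB_posSemidef ψ
  have hG : G.PosSemidef := keyMap_posSemidef Λ hρ
  have hYE : YE = marg (swapCE (fullVec Λ ψ)) := rhoYE_eq Λ ψ
  have hYC : YC = marg (fullVec Λ ψ) := rhoYABY_eq Λ ψ
  have hV : YC = copyV Y (A × B) * G * (copyV Y (A × B))ᴴ := rhoYABY_eq_copyV_conj Λ ψ
  have hblock : ∀ y, block G y = sqrtL A Λ y * ρ * sqrtL A Λ y := block_keyMap Λ ρ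
  have hφ : marg (fullVec Λ ψ) ≠ 0 := fun h0 => hne (by rw [trace_rhoFull, h0, rtr_zero]; simp)
  have htr : (rhoFull Λ ψ).trace = 1 → rtr (marg (fullVec Λ ψ)) = 1 := fun h => by
    rw [trace_rhoFull] at h
    exact_mod_cast h
  have hYEp : YE.PosSemidef := hYE ▸ marg_posSemidef _
  have hYEne : YE ≠ 0 := hYE ▸ marg_swap_ne_zero hφ
  have hYCp : YC.PosSemidef := hYC ▸ marg_posSemidef _
  have dual1 : ∀ a b : ℝ, a + b = 2 → petzDown a YE + petzDown b YC = 0 := fun a b hab => by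
    rw [hYE, hYC]; exact petzDown_duality _ hab
  have dual2 : ∀ a b : ℝ, 0 < a → a * b = 1 → (a = 1 → (rhoFull Λ ψ).trace = 1) →
      sandDown a YE + petzUp b YC = 0 := fun a b ha hab h1 => by
    rw [hYE, hYC]; exact sandDown_petzUp_duality _ hφ ha hab fun h => htr (h1 h)
  -- The second mixed relation is the first one with `C` and `E` exchanged.
  have dual3 : ∀ a b : ℝ, 0 < b → a * b = 1 → (a = 1 → (rhoFull Λ ψ).trace = 1) →
      petzUp a YE + sandDown b YC = 0 := fun a b hb hab h1 => by
    rw [hYE, hYC, add_comm]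
    refine sandDown_petzUp_duality (swapCE (fullVec Λ ψ)) (marg_swap_ne_zero hφ) hb
      (by rw [mul_comm, hab]) fun h => ?_
    rw [rtr_marg_swap]
    exact htr (h1 (by rwa [h, mul_one] at hab))
  refine ⟨⟨hV, hV ▸ trFst_copyV_conj G⟩, fun a b _ _ => dual1 a b, ?_, ?_, ?_, ?_, ?_, ?_, ?_⟩
  · intro a b ha hb hab h1
    rw [hYE, hYC]
    exact sandUp_duality hφ ha hb hab fun h => htr (h1 h)
  · exact fun a b ha hb hab h1 => ⟨dual2 a b ha hab h1, dual3 a b hb hab h1⟩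
  · intro b _ hb1
    have h0 := petzDown_copyV_conj hG hb1
    rw [← hV] at h0
    have hpinch : mpow (pinch G) (1 - b) =
        Matrix.blockDiagonal fun y => mpow (sqrtL A Λ y * ρ * sqrtL A Λ y) (1 - b) := by
      rw [mpow_pinch hG]; simp only [hblock]
    have hsum : ∀ M : Matrix ((A × B) × Y) ((A × B) × Y) ℂ, rtr (M * mpow (pinch G) (1 - b)) =
        ∑ y, rtr (block M y * mpow (sqrtL A Λ y * ρ * sqrtL A Λ y) (1 - b)) := fun M => by
      rw [hpinch, rtr_mul_blockDiagonal]
    simp only [hblock] at h0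
    refine ⟨by rw [h0, hsum], by rw [h0, sum_kron_single, ← hpinch, hsum], ?_, h0, fun h1 => ?_⟩
    · rw [h0, hsum]
      simp only [pinch_eq_blockDiagonal, block_blockDiagonal]
    · have hGb : mpow G b = keyMap Λ (mpow ρ b) :=
        mpow_conj_isometry (keyOp_conjTranspose_mul_self hΛ h1) hρ.isHermitian b
      refine ⟨by rw [h0, hsum, hGb], by rw [h0, ← rtr_keyMap_mul, hsum, hGb], ?_⟩
      rw [h0, hGb]
      simp only [block_keyMap]
  · intro b hb0 hb1
    have h0 := sandUp_copyV_conj hG hb0 hb1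
    rw [← hV] at h0
    refine ⟨h0.trans (iSup_congr fun σ => iSup_congr fun hσ => ?_), h0.trans (iSup_congr fun σ => iSup_congr fun hσ => ?_)⟩
    · rw [mul_logb_schatten (sandwich_posSemidef
        (pinch_posSemidef (mpow_posSemidef hσ.1.1 _)) _) hb0.ne']
    · rw [rtr_mpow_sandwich_comm hG (pinch_posSemidef (mpow_posSemidef hσ.1.1 _))]
  · intro b hb0 hb1
    obtain ⟨h1, h2, h3⟩ := petzUp_closed_form hb0 hb1 hYCp (hYC ▸ hφ)
    have hQ : trFst (mpow YC b) = pinch (mpow G b) := by rw [hV]; exact trFst_mpow_copyV_conj hG b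
    refine ⟨h1, ?_, by rw [h1, hQ], ?_⟩
    · rintro σ rfl
      rw [← Complex.ofReal_inv, Complex.coe_smul]
      exact ⟨h2, h3⟩
    · rw [h1, hQ, mpow_pinch (mpow_posSemidef hG b), rtr_blockDiagonal]
  · intro b hb0 hb1
    have h0 := sandDown_copyV_conj hG hb0 hb1
    rw [← hV] at h0
    have hN := mpow_posSemidef (pinch_posSemidef hG) ((1 - b) / b)
    refine ⟨by rw [h0, mul_logb_schatten (sandwich_posSemidef hN _) hb0.ne'], ?_⟩
    have hs : (1 - b) / b * (1 / 2) = (1 - b) / (2 * b) := by field_simp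
    rw [h0, rtr_mpow_sandwich_comm hG hN, mpow_mpow (pinch_posSemidef hG), hs]
  · intro h1 n ε hε _
    have hst : IsState YE := isState_iff.2 ⟨hYEp, by rw [hYE, rtr_marg_swap, htr h1]⟩
    have hn := isState_iidPow n hst
    have hinv : ∀ a : ℝ, 1 < a → a * (1 / a) = 1 := fun a ha =>
      mul_one_div_cancel (by linarith)
    -- The marginal of a state is a candidate in the supremum, so $H^\downarrow\le H^\uparrow$ and
    -- the four bounds reduce to the two for $H^\uparrow$.
    refine ⟨fun a ha ha2 => ⟨(EReal.sub_le_sub (petzDown_le_petzUp hn a) le_rfl).trans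
        (petzUp_sub_le_hMinSmooth hn ha ha2 hε), ?_⟩,
      fun a ha => ⟨sandUp_sub_le_hMinSmooth hn ha hε, ?_⟩,
      fun a ha _ => ⟨(EReal.sub_le_sub (sandDown_le_sandUp hn a) le_rfl).trans
        (sandUp_sub_le_hMinSmooth hn ha hε), ?_⟩,
      fun a ha ha2 => ⟨petzUp_sub_le_hMinSmooth hn ha ha2 hε, ?_⟩⟩
    · rw [petzDown_iidPow n ha.ne' hYEp]
      exact eq_neg_mul_of_add_eq_zero (dual1 a (2 - a) (by ring)) n
    · rw [hYE, hYC]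
      exact sandUp_iidPow_duality n hφ ha rfl
    · rw [sandDown_iidPow n ha.ne' hYEp]
      exact eq_neg_mul_of_add_eq_zero (dual2 a (1 / a) (by linarith) (hinv a ha) fun _ => h1) n
    · rw [petzUp_iidPow n (by linarith) ha.ne' hYEp hYEne]
      exact eq_neg_mul_of_add_eq_zero
        (dual3 a (1 / a) (one_div_pos.2 (by linarith)) (hinv a ha) fun _ => h1) n
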